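/- Let $D\subset\mathbb R^3$ be a bounded open set satisfying the cone condition (there is a fixed finite open circular cone such that every point of $D$ is the vertex of a congruent cone contained in $D$), let $T>0$, $\theta\in(\tfrac12,1]$, and let $m_0\in H^1(D)^3$ with $|m_0|=1$ a.e. in $D$. Let $(e_i)_{i\in\mathbb N}$ be a complete orthonormal system of $L^2(D)^3$, let $(\beta_i)_{i\in\mathbb N}$ be independent real Brownian motions on $[0,T]$ on a probability space, let $W=\sum_i\beta_i e_i$ be the corresponding cylindrical Wiener process, and let $G:L^2(D)^3\to H^2(D)^3$ be a Hilbert–Schmidt operator, $G_i:=Ge_i$, $\|G\|_{2,2}^2=\sum_i\|G_i\|_{H^2(D)^3}^2<\infty$. Write $(\cdot,\cdot)$ and $\|\cdot\|$ for the inner product and norm of $L^2(D)^3$ and of $L^2(D)^{3\times 3}$. For $N\in\mathbb N^*$ put $\Delta t=T/N$ and $\Delta W_N^n=W((n+1)\Delta t)-W(n\Delta t)$, and define $m_N^0=m_0$ and, for $0\le n\le N-1$, almost surely: $v_N^n$ is the element of $$\mathbb W_{N,n}=\{\psi\in H^1(D)^3:\ \psi\cdot m_N^n=0\ \text{a.e.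 in } D\}$$ such that for all $\varphi\in\mathbb W_{N,n}$ $$\begin{aligned}(v_N^n-m_N^n\times v_N^n,\varphi)+2\theta\Delta t(\nabla v_N^n,\nabla\varphi)={}&-2\Delta t(\nabla m_N^n,\nabla\varphi)+\big((\mathrm{Id}-m_N^n\times)(m_N^n\times G\Delta W_N^n),\varphi\big)\\&+\tfrac{\Delta t}{2}\sum_{i}\big((\mathrm{Id}-m_N^n\times)((m_N^n\times G_i)\times G_i),\varphi\big),\end{aligned}$$ and $m_N^{n+1}=(m_N^n+v_N^n)/|m_N^n+v_N^n|$. Put $A_N^n=m_N^n\times G\Delta W_N^n$. (i) For fixed $D$ and $\theta$ and every bound $K\ge 0$ there is a constant $C=C(T,m_0,K)$ such that, whenever $\|G\|_{2,2}\le K$, for all $N\in\mathbb N^*$ $$\max_{0\le n\le N}\mathbb E\|\nabla m_N^n\|^2\le C,\qquad \mathbb E\sum_{n=0}^{N-1}\|v_N^n-A_N^n\|^2\le C\Delta t,$$ $$\mathbb E\sum_{n=0}^{N-1}\|v_N^n\|^2\le C,\qquad \mathbb E\sum_{n=0}^{N-1}\|\nabla v_N^n\|^2\le C.$$ (ii)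 For fixed $D$ and $\theta$, every $K\ge0$ and every $\epsilon$ with $0<\epsilon<2\theta-1$ there is a constant $C=C(\epsilon,K,T)>0$, not depending on $m_0$, such that, whenever $\|G\|_{2,2}\le K$, for all $N\in\mathbb N^*$ and $0\le n\le N-1$ $$\mathbb E\|\nabla m_N^{n+1}\|^2+\frac{1-\epsilon}{\Delta t}\,\mathbb E\|v_N^n-A_N^n\|^2+(2\theta-1-\epsilon)\,\mathbb E\|\nabla v_N^n\|^2\le(1+C\Delta t)\,\mathbb E\|\nabla m_N^n\|^2+C\Delta t.$$ -/

import Mathlib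

open MeasureTheory ProbabilityTheory Filter Topology
open scoped NNReal ENNReal

noncomputable section

namespace SLLG

/-! ### Euclidean space and the cross product -/

/-- The space `ℝ³` with its Euclidean structure. -/
abbrev E3 : Type := EuclideanSpace ℝ (Fin 3)

/-- The cross product of two vectors of `ℝ³`. -/
def cross (a b : E3) : E3 := WithLp.toLp 2 (crossProduct a.ofLp b.ofLp)

/-- The cone condition: there is one finite open circular cone (height `h`, opening given by `κ`)
such that every point of `D` is the vertex of a congruent cone contained in `D`. -/
def ConeCondition (D : Set E3) : Prop :=
  ∃ h : ℝ, 0 < h ∧ ∃ κ : ℝ, 0 < κ ∧ κ < 1 ∧ ∀ x ∈ D, ∃ ξ : E3, ‖ξ‖ = 1 ∧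
    ∀ y : E3, 0 < ‖y - x‖ → ‖y - x‖ < h → κ * ‖y - x‖ < inner ℝ (y - x) ξ → y ∈ D

/-! ### Lebesgue and Sobolev spaces of `ℝ³`-valued functions -/

/-- The Hilbert space `L²(D)³`. -/
abbrev L2 (D : Set E3) : Type := Lp E3 2 (volume.restrict D)

/-- The square of the `L²(D)³` norm of a function, with values in `[0, ∞]`. -/
def normSq (D : Set E3) (f : E3 → E3) : ℝ≥0∞ := ∫⁻ x in D, ‖f x‖ₑ ^ 2

/-- `g` is the weak partial derivative of `f` on `D` in the `i`-th coordinate direction. -/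
def HasWeakPartial (D : Set E3) (i : Fin 3) (f g : L2 D) : Prop :=
  ∀ φ : E3 → ℝ, ContDiff ℝ (⊤ : ℕ∞) φ → HasCompactSupport φ → tsupport φ ⊆ D →
    ∫ x in D, (fderiv ℝ φ x (EuclideanSpace.single i 1)) • f x = - ∫ x in D, φ x • g x

/-- Membership in `H¹(D)³`: all first weak partial derivatives exist in `L²(D)³`. -/
def MemH1 (D : Set E3) (f : L2 D) : Prop := ∀ i : Fin 3, ∃ g : L2 D, HasWeakPartial D i f g

open Classical in
/-- The weak partial derivative `∂ᵢ f` in `L²(D)³` (and `0` if there is none). -/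
def weakPartial (D : Set E3) (i : Fin 3) (f : L2 D) : L2 D :=
  if h : ∃ g : L2 D, HasWeakPartial D i f g then h.choose else 0

/-- The inner product `(∇f, ∇g)` in `L²(D)^{3×3}`. -/
def gradInner (D : Set E3) (f g : L2 D) : ℝ :=
  ∑ i : Fin 3, inner ℝ (weakPartial D i f) (weakPartial D i g)

open Classical in
/-- `‖∇f‖²` in `L²(D)^{3×3}`, with the value `∞` if `f` is not in `H¹(D)³`. -/
def gradSq (D : Set E3) (f : L2 D) : ℝ≥0∞ :=
  if MemH1 D f then ∑ i : Fin 3, ‖weakPartial D i f‖ₑ ^ 2 else ⊤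

/-- The square of the `H²(D)³` norm (sum of the squared `L²` norms of all weak derivatives of
order at most two), with the value `∞` if `f` is not in `H²(D)³`. -/
def h2Sq (D : Set E3) (f : L2 D) : ℝ≥0∞ :=
  ‖f‖ₑ ^ 2 + gradSq D f + ∑ i : Fin 3, gradSq D (weakPartial D i f)

/-- Membership in `H²(D)³`. -/
def MemH2 (D : Set E3) (f : L2 D) : Prop :=
  MemH1 D f ∧ ∀ i : Fin 3, MemH1 D (weakPartial D i f)

/-- The square of the Hilbert-Schmidt norm of `G` from `L²(D)³` to `H²(D)³`, computed in the
complete orthonormal system `e`. -/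
def hsSq (D : Set E3) (e : HilbertBasis ℕ ℝ (L2 D)) (G : L2 D →L[ℝ] L2 D) : ℝ≥0∞ :=
  ∑' i : ℕ, h2Sq D (G (e i))

/-! ### The noise -/

/-- `B` is a standard real Brownian motion on the time interval `[0, T]`. -/
structure IsBrownianOn {Ω : Type*} [MeasurableSpace Ω] (P : Measure Ω) (T : ℝ≥0)
    (B : ℝ≥0 → Ω → ℝ) : Prop where
  measurable : ∀ t ≤ T, Measurable (B t)
  hasLaw : ∀ I : Finset ℝ≥0, (∀ t ∈ I, t ≤ T) →
    HasLaw (fun ω ↦ I.restrict (fun t ↦ B t ω)) (BrownianReal.projectiveFamily I) P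
  cont : ∀ᵐ ω ∂P, ContinuousOn (fun t ↦ B t ω) (Set.Iic T)

/-- The coordinates `β i` of a cylindrical Wiener process `W = ∑ i, β i • e i` on `[0, T]`:
independent real Brownian motions. -/
structure IsCylindricalWiener {Ω : Type*} [MeasurableSpace Ω] (P : Measure Ω) (T : ℝ≥0)
    (β : ℕ → ℝ≥0 → Ω → ℝ) : Prop where
  brownian : ∀ i, IsBrownianOn P T (β i)
  indep : iIndepFun (fun i ω (t : Set.Iic T) ↦ β i t ω) P

/-- `GW` is (a version of) the process `GW(t) = ∑ i, β i t • G (e i)`, `t ∈ [0, T]`, the series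
being convergent in mean square, with values in `L²(D)³`. -/
structure IsGW {Ω : Type*} [MeasurableSpace Ω] (P : Measure Ω) (T : ℝ≥0) (D : Set E3)
    (e : HilbertBasis ℕ ℝ (L2 D)) (G : L2 D →L[ℝ] L2 D) (β : ℕ → ℝ≥0 → Ω → ℝ)
    (GW : ℝ≥0 → Ω → L2 D) : Prop where
  aestronglyMeasurable : ∀ t ≤ T, AEStronglyMeasurable (GW t) P
  tendsto : ∀ t ≤ T, Tendsto
    (fun k : ℕ ↦ ∫⁻ ω, ‖GW t ω - ∑ i ∈ Finset.range k, β i t ω • G (e i)‖ₑ ^ 2 ∂P)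
    atTop (𝓝 0)

/-- The time step `T / N`. -/
def dt (T : ℝ≥0) (N : ℕ) : ℝ≥0 := T / N

/-- The noise increment `GW((n+1)Δt) - GW(nΔt)`. -/
def incr {Ω : Type*} {D : Set E3} (T : ℝ≥0) (N : ℕ) (GW : ℝ≥0 → Ω → L2 D) (n : ℕ) (ω : Ω) : L2 D :=
  GW ((n + 1 : ℕ) * dt T N) ω - GW (n * dt T N) ω

/-! ### The scheme -/

/-- The space of the `ψ` in `H¹(D)³` that are orthogonal to `m` almost everywhere in `D`. -/
def tangentSpace (D : Set E3) (m : L2 D) : Set (L2 D) :=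
  {ψ | MemH1 D ψ ∧ ∀ᵐ x ∂(volume.restrict D), inner ℝ (ψ x) (m x) = 0}

/-- The operator `Id - m ×` applied to a vector. -/
def idSubCross (m a : E3) : E3 := a - cross m a

/-- `v` in the tangent space of `m` solves the variational problem of one time step of size `τ`,
with noise increment `ξ` and noise coefficients `g i = G (e i)`. -/
structure IsStep (D : Set E3) (θ τ : ℝ) (g : ℕ → L2 D) (ξ m v : L2 D) : Prop where
  mem : v ∈ tangentSpace D m
  eq : ∀ φ ∈ tangentSpace D m,
    (∫ x in D, inner ℝ (idSubCross (m x) (v x)) (φ x)) + 2 * θ * τ * gradInner D v φ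
      = -2 * τ * gradInner D m φ
        + (∫ x in D, inner ℝ (idSubCross (m x) (cross (m x) (ξ x))) (φ x))
        + τ / 2 * ∑' i : ℕ,
            ∫ x in D, inner ℝ (idSubCross (m x) (cross (cross (m x) (g i x)) (g i x))) (φ x)

/-- The sequences `m 0, …, m N` and `v 0, …, v (N-1)` are produced, almost surely, by the scheme
with `N` time steps started at `m₀` and driven by `GW`. -/
structure IsScheme {Ω : Type*} [MeasurableSpace Ω] (P : Measure Ω) (T : ℝ≥0) (θ : ℝ) (D : Set E3)
    (e : HilbertBasis ℕ ℝ (L2 D)) (G : L2 D →L[ℝ] L2 D) (GW : ℝ≥0 → Ω → L2 D)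
    (m₀ : L2 D) (N : ℕ) (m v : ℕ → Ω → L2 D) : Prop where
  init : ∀ᵐ ω ∂P, m 0 ω = m₀
  step : ∀ n < N, ∀ᵐ ω ∂P,
    IsStep D θ (dt T N) (fun i ↦ G (e i)) (incr T N GW n ω) (m n ω) (v n ω)
  renorm : ∀ n < N, ∀ᵐ ω ∂P, ∀ᵐ x ∂(volume.restrict D),
    m (n + 1) ω x = (‖m n ω x + v n ω x‖⁻¹ : ℝ) • (m n ω x + v n ω x)

/-- The noise term `A = m × ξ` of one time step, as a function on `D`. -/
def noiseTerm {D : Set E3} (m ξ : L2 D) (x : E3) : E3 := cross (m x) (ξ x)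

end SLLG

end

open SLLG

/-! The tested equation is an energy identity. Let ξ be the noise increment of a step of length τ
and A = m × ξ. The field w = v − A is tangential, hence an admissible test function, and since m ×
is skew the left side contributes exactly ‖w‖². This expresses 2(∇m,∇v) through −‖w‖²/τ − 2θ‖∇v‖²
and terms in A and in the Itô correction. On the other hand v ⊥ m and |m| = 1 give |m + v| ≥ 1, so
renormalising is the projection onto the closed unit ball. That map is 1-Lipschitz, whence ‖∇m'‖² ≤
‖∇m‖² + 2(∇m,∇v) + ‖∇v‖². Adding the two leaves −(2θ − 1)‖∇v‖², and Young's inequality spends a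
fraction ε of each good term (`step_energy`).

In the mean the noise costs only O(τ). The first order term (∇m,∇A) reduces to ∑ (∂ᵢm, m × ∂ᵢξ),
because ∂ᵢm ⊥ ∂ᵢm × ξ; past coefficients are paired with an independent centred increment, so its
mean vanishes. The second order term is bounded by ‖ξ‖∞²‖∇m‖² + ‖∇ξ‖², where the cone condition
gives H² ⊂ L^∞ (`exists_sobolev`), E‖ξ‖²_{H²} ≤ τK², and independence factorises the mean of the
product. The correction is controlled by ∑ ‖Gᵢ‖∞‖Gᵢ‖ ≤ C K². The result is `IsSolution.energy_step`,
that is (ii). A discrete Gronwall argument sums it, and ‖A‖ ≤ ‖ξ‖ turns the bound for w into one for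
v (`IsSolution.uniform`), that is (i).

Nothing is assumed on the measurability of m and v. A step has at most one solution, and the triples
(m, ξ, v) that solve it form a Borel set in a Polish space, so by the Lusin–Souslin theorem v is a
Borel function of (m, ξ) (`exists_measurable_step`). By induction m is adapted up to null sets
(`IsSolution.adapted`), and only then can independence be used. -/

noncomputable section

namespace SLLG

/-! ### Weak derivatives and mollification -/

/-- Smooth compactly supported real functions on `D`. -/
structure IsTest (D : Set E3) (φ : E3 → ℝ) : Prop where
  contDiff : ContDiff ℝ (⊤ : ℕ∞) φ
  compact : HasCompactSupport φ
  subset : tsupport φ ⊆ D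

/-- `g` is the weak derivative of `f` on `D` in the direction `e`. -/
def WeakDeriv {F : Type*} [NormedAddCommGroup F] [NormedSpace ℝ F] (D : Set E3) (e : E3)
    (f g : E3 → F) : Prop :=
  ∀ φ : E3 → ℝ, IsTest D φ →
    ∫ x in D, fderiv ℝ φ x e • f x = - ∫ x in D, φ x • g x

/-- The mollification of a function on `D` by a normed bump function. -/
def moll {F : Type*} [NormedAddCommGroup F] [NormedSpace ℝ F] (ψ : ContDiffBump (0 : E3))
    (D : Set E3) (f : E3 → F) (x : E3) : F :=
  ∫ y in D, ψ.normed volume (x - y) • f y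

section moll

variable {F : Type*} [NormedAddCommGroup F] [NormedSpace ℝ F]

lemma moll_eq_convolution (ψ : ContDiffBump (0 : E3)) {D : Set E3} (hD : MeasurableSet D)
    (f : E3 → F) :
    moll ψ D f = convolution (ψ.normed volume) (D.indicator f)
      (ContinuousLinearMap.lsmul ℝ ℝ) volume := by
  ext1 x
  rw [convolution_lsmul_swap, moll, ← integral_indicator hD]
  congr 1
  ext1 y
  by_cases hy : y ∈ D <;> simp [hy]

lemma locallyIntegrable_indicator {F : Type*} [NormedAddCommGroup F] {D : Set E3}
    (hD : MeasurableSet D) {f : E3 → F}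
    (hf : IntegrableOn f D) : LocallyIntegrable (D.indicator f) :=
  ((integrable_indicator_iff hD).2 hf).locallyIntegrable

lemma contDiff_moll (ψ : ContDiffBump (0 : E3)) {D : Set E3} (hD : MeasurableSet D)
    {f : E3 → F} (hf : IntegrableOn f D) : ContDiff ℝ (⊤ : ℕ∞) (moll ψ D f) := by
  rw [moll_eq_convolution ψ hD]
  exact ψ.hasCompactSupport_normed.contDiff_convolution_left _ ψ.contDiff_normed
    (locallyIntegrable_indicator hD hf)

lemma integrableOn_smul {D : Set E3} {f : E3 → F}
    (hf : IntegrableOn f D) {h : E3 → ℝ} (hh : Continuous h) (hc : HasCompactSupport h) :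
    IntegrableOn (fun y ↦ h y • f y) D := by
  obtain ⟨C, hC⟩ := hh.bounded_above_of_compact_support hc
  exact Integrable.bdd_smul hf C hh.aestronglyMeasurable (ae_of_all _ hC)

lemma isTest_normed_sub (ψ : ContDiffBump (0 : E3)) {D : Set E3} {x : E3}
    (hx : Metric.closedBall x ψ.rOut ⊆ D) : IsTest D (fun y ↦ ψ.normed volume (x - y)) := by
  have hts : tsupport (fun y ↦ ψ.normed volume (x - y)) ⊆ Metric.closedBall x ψ.rOut := by
    refine closure_minimal ?_ Metric.isClosed_closedBall
    intro y hy
    have hy' : x - y ∈ Function.support (ψ.normed volume) := hy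
    rw [ψ.support_normed_eq, Metric.mem_ball, dist_zero_right] at hy'
    rw [Metric.mem_closedBall, dist_comm, dist_eq_norm]
    exact hy'.le
  refine ⟨ψ.contDiff_normed.comp (contDiff_const.sub contDiff_id), ?_, hts.trans hx⟩
  exact HasCompactSupport.intro (isCompact_closedBall x ψ.rOut)
    (fun y hy ↦ by
      by_contra hne
      exact hy (hts (subset_tsupport _ hne)))

/-- When the ball lies in D, y ↦ ψ(x − y) is an admissible test function. Passing from the
x-derivative to the y-derivative of ψ(x − y) changes the sign, which cancels the sign in the weak
derivative. -/
lemma fderiv_moll_apply [CompleteSpace F] (ψ : ContDiffBump (0 : E3)) {D : Set E3}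
    (hD : MeasurableSet D) {f g : E3 → F} (hf : IntegrableOn f D) {e : E3}
    (h : WeakDeriv D e f g) {x : E3} (hx : Metric.closedBall x ψ.rOut ⊆ D) :
    fderiv ℝ (moll ψ D f) x e = moll ψ D g x := by
  have hc := ψ.hasCompactSupport_normed (μ := (volume : Measure E3))
  have hs : ContDiff ℝ 1 (ψ.normed (volume : Measure E3)) := ψ.contDiff_normed
  have hd := hc.hasFDerivAt_convolution_left (ContinuousLinearMap.lsmul ℝ ℝ) hs
    (locallyIntegrable_indicator hD hf) x
  rw [moll_eq_convolution ψ hD, hd.fderiv, convolution_eq_swap,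
    ContinuousLinearMap.integral_apply]
  · have ht := h _ (isTest_normed_sub ψ hx)
    rw [moll, eq_comm, ← neg_eq_iff_eq_neg.2 ht, ← integral_neg, ← integral_indicator hD]
    congr 1
    ext1 y
    by_cases hy : y ∈ D
    · have hdy : HasFDerivAt (fun y ↦ ψ.normed volume (x - y))
          (-(fderiv ℝ (ψ.normed (volume : Measure E3)) (x - y))) y := by
        have h1 := (hs.differentiable one_ne_zero (x - y)).hasFDerivAt
        have h2 : HasFDerivAt (fun y : E3 ↦ x - y) (-(ContinuousLinearMap.id ℝ E3)) y := by
          simpa using (hasFDerivAt_id y).const_sub x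
        refine (HasFDerivAt.comp y h1 h2).congr_fderiv ?_
        ext v
        simp
      simp [hy, hdy.fderiv]
    · simp [hy]
  · have h1 : Continuous (fun y ↦ fderiv ℝ (ψ.normed (volume : Measure E3)) (x - y)) :=
      (hs.continuous_fderiv one_ne_zero).comp (continuous_const.sub continuous_id)
    obtain ⟨C, hC⟩ := (hs.continuous_fderiv one_ne_zero).bounded_above_of_compact_support
      (hc.fderiv ℝ)
    have hi := (integrable_indicator_iff hD).2 hf
    refine Integrable.mono' (hi.norm.const_mul C) ?_ (ae_of_all _ fun y ↦ ?_)
    · exact (((ContinuousLinearMap.lsmul ℝ ℝ : ℝ →L[ℝ] F →L[ℝ] F).precompL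
        E3).aestronglyMeasurable_comp₂ h1.aestronglyMeasurable hi.aestronglyMeasurable)
    · refine ContinuousLinearMap.opNorm_le_bound _ (mul_nonneg ((norm_nonneg _).trans (hC 0)) (norm_nonneg _)) ?_
      intro v
      rw [ContinuousLinearMap.precompL_apply, ContinuousLinearMap.lsmul_apply, norm_smul]
      calc _ ≤ (C * ‖v‖) * ‖D.indicator f y‖ := by
            gcongr
            exact ContinuousLinearMap.le_of_opNorm_le _ (hC _) v
        _ = _ := by ring

lemma ae_tendsto_moll [CompleteSpace F] {D : Set E3} (hD : MeasurableSet D) {f : E3 → F}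
    (hf : IntegrableOn f D) {ψ : ℕ → ContDiffBump (0 : E3)}
    (hψ : Tendsto (fun k ↦ (ψ k).rOut) atTop (𝓝 0)) (hψ' : ∀ k, (ψ k).rOut ≤ 2 * (ψ k).rIn) :
    ∀ᵐ x ∂(volume.restrict D), Tendsto (fun k ↦ moll (ψ k) D f x) atTop (𝓝 (f x)) := by
  have h := ContDiffBump.ae_convolution_tendsto_right_of_locallyIntegrable
    (μ := (volume : Measure E3)) hψ (Eventually.of_forall hψ') (locallyIntegrable_indicator hD hf)
  rw [ae_restrict_iff' hD]
  filter_upwards [h] with x hx hxD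
  simpa [moll_eq_convolution _ hD, hxD] using hx

lemma lintegral_normed (ψ : ContDiffBump (0 : E3)) :
    ∫⁻ x, ENNReal.ofReal (ψ.normed volume x) = 1 := by
  rw [← ofReal_integral_eq_lintegral_ofReal ψ.integrable_normed
    (ae_of_all _ ψ.nonneg_normed), ψ.integral_normed, ENNReal.ofReal_one]

lemma norm_moll_le (ψ : ContDiffBump (0 : E3)) {D : Set E3} {f : E3 → F} {c : ℝ} (hc : 0 ≤ c)
    (hf : ∀ᵐ x ∂(volume.restrict D), ‖f x‖ ≤ c) (x : E3) : ‖moll ψ D f x‖ ≤ c := by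
  have hint : Integrable (fun y ↦ ψ.normed volume (x - y) * c) :=
    (ψ.integrable_normed.comp_sub_left x).mul_const c
  calc ‖moll ψ D f x‖ ≤ ∫ y in D, ψ.normed volume (x - y) * c := by
        refine norm_integral_le_of_norm_le hint.integrableOn ?_
        filter_upwards [hf] with y hy
        rw [norm_smul, Real.norm_of_nonneg (ψ.nonneg_normed _)]
        exact mul_le_mul_of_nonneg_left hy (ψ.nonneg_normed _)
    _ ≤ ∫ y, ψ.normed volume (x - y) * c :=
        setIntegral_le_integral hint (ae_of_all _ fun y ↦ mul_nonneg (ψ.nonneg_normed _) hc)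
    _ = c := by
        rw [integral_mul_const, integral_sub_left_eq_self (ψ.normed volume) volume x,
          ψ.integral_normed, one_mul]

/-- Jensen's inequality for the square and a sub-probability weight. -/
lemma enorm_sq_integral_smul_le {α : Type*} [MeasurableSpace α] {μ : Measure α} {w : α → ℝ}
    (hw : AEMeasurable w μ) (hw0 : ∀ x, 0 ≤ w x) (hw1 : ∫⁻ x, ENNReal.ofReal (w x) ∂μ ≤ 1)
    {f : α → F} (hf : AEStronglyMeasurable f μ) :
    ‖∫ x, w x • f x ∂μ‖ₑ ^ 2 ≤ ∫⁻ x, ENNReal.ofReal (w x) * ‖f x‖ₑ ^ 2 ∂μ := by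
  set p : α → ℝ≥0∞ := fun x ↦ ENNReal.ofReal (w x) with hp
  have hpm : AEMeasurable p μ := hw.ennreal_ofReal
  have hsq : ∀ x, (p x ^ (1 / 2 : ℝ)) * (p x ^ (1 / 2 : ℝ)) = p x := fun x ↦ by
    rw [← ENNReal.rpow_add_of_nonneg _ _ (by norm_num) (by norm_num)]
    norm_num
  -- Cauchy–Schwarz for the product of √w and √w‖f‖; the first factor has norm at most 1.
  have h1 : ‖∫ x, w x • f x ∂μ‖ₑ ≤ ∫⁻ x, (p x ^ (1 / 2 : ℝ)) * (p x ^ (1 / 2 : ℝ) * ‖f x‖ₑ) ∂μ := by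
    refine (enorm_integral_le_lintegral_enorm _).trans (le_of_eq ?_)
    congr 1
    ext1 x
    rw [← mul_assoc, hsq, enorm_smul, Real.enorm_of_nonneg (hw0 x)]
  have h2 := ENNReal.lintegral_mul_le_Lp_mul_Lq μ (Real.HolderConjugate.two_two)
    (hpm.pow_const (1 / 2 : ℝ)) ((hpm.pow_const (1 / 2 : ℝ)).mul hf.enorm)
  have h3 : (∫⁻ x, (p x ^ (1 / 2 : ℝ)) ^ (2 : ℝ) ∂μ) ≤ 1 := by
    refine le_trans (le_of_eq ?_) hw1
    congr 1
    ext1 x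
    rw [← ENNReal.rpow_mul]
    norm_num [hp]
  have h4 : (∫⁻ x, ((fun x ↦ p x ^ (1 / 2 : ℝ)) * fun x ↦ ‖f x‖ₑ) x ^ (2 : ℝ) ∂μ)
      = ∫⁻ x, p x * ‖f x‖ₑ ^ 2 ∂μ := by
    congr 1
    ext1 x
    rw [Pi.mul_apply, ENNReal.mul_rpow_of_nonneg _ _ (by norm_num), ← ENNReal.rpow_mul]
    norm_num
  rw [h4] at h2
  calc ‖∫ x, w x • f x ∂μ‖ₑ ^ 2
      ≤ (1 * (∫⁻ x, p x * ‖f x‖ₑ ^ 2 ∂μ) ^ (1 / 2 : ℝ)) ^ 2 := by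
        gcongr
        refine h1.trans (h2.trans ?_)
        gcongr
        exact ENNReal.rpow_le_one h3 (by norm_num)
    _ = _ := by
        rw [one_mul, ← ENNReal.rpow_natCast, ← ENNReal.rpow_mul]
        norm_num [hp]

/-- Jensen with the weight ψ(x − y), then Tonelli. The left integral runs over the whole space, so
that translations and dilations can be applied to it later. -/
lemma lintegral_moll_sq_le (ψ : ContDiffBump (0 : E3)) {D : Set E3} {f : E3 → F}
    (hf : AEStronglyMeasurable f (volume.restrict D)) :
    ∫⁻ x, ‖moll ψ D f x‖ₑ ^ 2 ≤ ∫⁻ x in D, ‖f x‖ₑ ^ 2 := by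
  have hm : Measurable (fun x ↦ ψ.normed (volume : Measure E3) x) :=
    ψ.continuous_normed.measurable
  calc ∫⁻ x, ‖moll ψ D f x‖ₑ ^ 2
      ≤ ∫⁻ x, ∫⁻ y in D, ENNReal.ofReal (ψ.normed volume (x - y)) * ‖f y‖ₑ ^ 2 := by
        refine lintegral_mono fun x ↦ ?_
        refine enorm_sq_integral_smul_le (w := fun y ↦ ψ.normed volume (x - y))
          (hm.comp (measurable_const.sub measurable_id)).aemeasurable (fun y ↦ ψ.nonneg_normed _) ?_ hf
        refine (setLIntegral_le_lintegral _ _).trans (le_of_eq ?_)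
        rw [lintegral_sub_left_eq_self (fun y ↦ ENNReal.ofReal (ψ.normed volume y)) x,
          lintegral_normed]
    _ = ∫⁻ y in D, ∫⁻ x, ENNReal.ofReal (ψ.normed volume (x - y)) * ‖f y‖ₑ ^ 2 := by
        refine lintegral_lintegral_swap ?_
        have h1 : Measurable (fun z : E3 × E3 ↦ ENNReal.ofReal (ψ.normed volume (z.1 - z.2))) :=
          (hm.comp (measurable_fst.sub measurable_snd)).ennreal_ofReal
        exact h1.aemeasurable.mul (hf.enorm.pow_const 2).comp_snd
    _ = ∫⁻ y in D, ‖f y‖ₑ ^ 2 := by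
        congr 1
        ext1 y
        rw [lintegral_mul_const' _ _ (by simp), lintegral_sub_right_eq_self
          (fun x ↦ ENNReal.ofReal (ψ.normed volume x)) y, lintegral_normed, one_mul]

end moll

/-- A sequence of bump functions with radii tending to zero. -/
def bump (k : ℕ) : ContDiffBump (0 : E3) where
  rIn := 1 / (k + 1)
  rOut := 2 / (k + 1)
  rIn_pos := by positivity
  rIn_lt_rOut := by gcongr; norm_num

lemma tendsto_bump : Tendsto (fun k ↦ (bump k).rOut) atTop (𝓝 0) := by
  have := (tendsto_one_div_add_atTop_nhds_zero_nat (𝕜 := ℝ)).const_mul 2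
  simpa [bump, div_eq_mul_inv] using this

/-- A bounded ratio of the radii is what almost everywhere convergence of the mollifications
requires. -/
lemma bump_ratio (k : ℕ) : (bump k).rOut ≤ 2 * (bump k).rIn := by
  simp [bump, div_eq_mul_inv]

lemma ae_tendsto_moll_bump {F : Type*} [NormedAddCommGroup F] [NormedSpace ℝ F] [CompleteSpace F]
    {D : Set E3} (hD : MeasurableSet D) {f : E3 → F} (hf : IntegrableOn f D) :
    ∀ᵐ x ∂(volume.restrict D), Tendsto (fun k ↦ moll (bump k) D f x) atTop (𝓝 (f x)) :=
  ae_tendsto_moll hD hf tendsto_bump bump_ratio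

/-- A compact subset of `D` has a neighbourhood of positive radius in `D`. -/
lemma eventually_closedBall_subset {D S : Set E3} (hD : IsOpen D) (hS : IsCompact S)
    (hSD : S ⊆ D) : ∀ᶠ k in atTop, ∀ x ∈ S, Metric.closedBall x (bump k).rOut ⊆ D := by
  obtain ⟨δ, hδ, h⟩ := hS.exists_cthickening_subset_open hD hSD
  filter_upwards [tendsto_bump.eventually (gt_mem_nhds hδ)] with k hk x hx
  exact (Metric.closedBall_subset_cthickening hx _).trans
    ((Metric.cthickening_mono hk.le _).trans h)

/-! ### Testing elements of `L²` -/

/-- The function `h • a` as an element of `L²(D)³`. -/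
def testVec (D : Set E3) (h : E3 → ℝ) (a : E3) : L2 D :=
  open Classical in
  if hm : MemLp (fun x ↦ h x • a) 2 (volume.restrict D) then hm.toLp else 0

lemma coeFn_testVec {D : Set E3} {h : E3 → ℝ} (hh : Continuous h) (hc : HasCompactSupport h)
    (a : E3) : testVec D h a =ᵐ[volume.restrict D] fun x ↦ h x • a := by
  have hm : MemLp (fun x ↦ h x • a) 2 (volume.restrict D) :=
    ((hh.smul continuous_const).memLp_of_hasCompactSupport hc.smul_right).restrict D
  rw [testVec, dif_pos hm]
  exact hm.coeFn_toLp

lemma L2_enorm_sq {D : Set E3} (f : L2 D) : ‖f‖ₑ ^ 2 = ∫⁻ x in D, ‖f x‖ₑ ^ 2 := by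
  rw [Lp.enorm_def, eLpNorm_eq_lintegral_rpow_enorm_toReal (by simp) (by simp)]
  rw [← ENNReal.rpow_natCast, ← ENNReal.rpow_mul]
  simp

lemma integrableOn_L2 {D : Set E3} [IsFiniteMeasure (volume.restrict D)] (f : L2 D) :
    IntegrableOn f D :=
  (Lp.memLp f).integrable (by norm_num)

lemma inner_testVec {D : Set E3} [IsFiniteMeasure (volume.restrict D)] {h : E3 → ℝ}
    (hh : Continuous h) (hc : HasCompactSupport h) (a : E3) (f : L2 D) :
    inner ℝ (testVec D h a) f = inner ℝ a (∫ x in D, h x • f x) := by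
  rw [L2.inner_def, ← integral_inner (integrableOn_smul (integrableOn_L2 f) hh hc) a]
  refine integral_congr_ae ?_
  filter_upwards [coeFn_testVec hh hc a] with x hx
  rw [hx, inner_smul_left, inner_smul_right]
  rfl

lemma IsTest.continuous {D : Set E3} {φ : E3 → ℝ} (hφ : IsTest D φ) : Continuous φ :=
  hφ.contDiff.continuous

lemma IsTest.continuous_fderiv {D : Set E3} {φ : E3 → ℝ} (hφ : IsTest D φ) (e : E3) :
    Continuous (fun x ↦ fderiv ℝ φ x e) :=
  (hφ.contDiff.continuous_fderiv (by simp)).clm_apply continuous_const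

lemma IsTest.compact_fderiv {D : Set E3} {φ : E3 → ℝ} (hφ : IsTest D φ) (e : E3) :
    HasCompactSupport (fun x ↦ fderiv ℝ φ x e) :=
  hφ.compact.fderiv_apply ℝ e

/-- Written as pairings with fixed vectors of L², the relation visibly survives weak limits and
defines a closed graph. -/
lemma weakDeriv_iff_inner {D : Set E3} [IsFiniteMeasure (volume.restrict D)] {e : E3}
    {f g : L2 D} :
    WeakDeriv D e f g ↔ ∀ φ : E3 → ℝ, IsTest D φ → ∀ a : E3,
      inner ℝ (testVec D (fun x ↦ fderiv ℝ φ x e) a) f = - inner ℝ (testVec D φ a) g := by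
  refine forall₂_congr fun φ hφ ↦ ?_
  simp_rw [inner_testVec (hφ.continuous_fderiv e) (hφ.compact_fderiv e),
    inner_testVec hφ.continuous hφ.compact, ← inner_neg_right]
  exact ⟨fun h a ↦ by rw [h], fun h ↦ ext_inner_left ℝ h⟩

/-! ### Translations and Lipschitz maps -/

/-- For the mollified function the increment is the integral of the derivative along the segment;
Jensen in the segment parameter and translation invariance give the bound, and Fatou removes the
mollification. -/
lemma lintegral_translate_sub_le {D : Set E3} (hD : IsOpen D) {F : Type*} [NormedAddCommGroup F]
    [NormedSpace ℝ F] [CompleteSpace F] {f g : E3 → F} (hf : IntegrableOn f D)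
    (hg : IntegrableOn g D) {e : E3} (h : WeakDeriv D e f g) {S : Set E3} (hS : IsCompact S)
    {r : ℝ} (hSr : ∀ x ∈ S, ∀ s ∈ Set.Icc (0 : ℝ) 1, x + (s * r) • e ∈ D) :
    ∫⁻ x in S, ‖f (x + r • e) - f x‖ₑ ^ 2
      ≤ ENNReal.ofReal (r ^ 2) * ∫⁻ x in D, ‖g x‖ₑ ^ 2 := by
  -- All the segments sweep out a compact subset of D, so one small mollification radius serves
  -- every point of them.
  set A : Set E3 := (fun p : E3 × ℝ ↦ p.1 + (p.2 * r) • e) '' (S ×ˢ Set.Icc (0 : ℝ) 1) with hA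
  have hAc : IsCompact A := (hS.prod isCompact_Icc).image (by fun_prop)
  have hAD : A ⊆ D := by
    rintro _ ⟨⟨x, s⟩, ⟨hx, hs⟩, rfl⟩
    exact hSr x hx s hs
  have hmem : ∀ x ∈ S, ∀ s ∈ Set.Icc (0 : ℝ) 1, x + (s * r) • e ∈ A := fun x hx s hs ↦
    ⟨(x, s), ⟨hx, hs⟩, rfl⟩
  have hsm : ∀ k, ContDiff ℝ (⊤ : ℕ∞) (moll (bump k) D f) := fun k ↦
    contDiff_moll _ hD.measurableSet hf
  have hsmg : ∀ k, ContDiff ℝ (⊤ : ℕ∞) (moll (bump k) D g) := fun k ↦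
    contDiff_moll _ hD.measurableSet hg
  have hlim := ae_tendsto_moll_bump hD.measurableSet hf
  rw [ae_restrict_iff' hD.measurableSet] at hlim
  have hlim' := (measurePreserving_add_right (volume : Measure E3)
    (r • e)).quasiMeasurePreserving.ae hlim
  have hSm := hS.measurableSet
  have hfatou : ∫⁻ x in S, ‖f (x + r • e) - f x‖ₑ ^ 2
      ≤ liminf (fun k ↦ ∫⁻ x in S, ‖moll (bump k) D f (x + r • e) - moll (bump k) D f x‖ₑ ^ 2)
        atTop := by
    refine le_trans (le_of_eq ?_) (lintegral_liminf_le' (fun k ↦ ?_))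
    · refine lintegral_congr_ae ?_
      rw [EventuallyEq, ae_restrict_iff' hSm]
      filter_upwards [hlim, hlim'] with x h1 h2 hx
      refine (Tendsto.liminf_eq ?_).symm
      have hx1 : x ∈ D := by simpa using hSr x hx 0 (by simp)
      have hx2 : x + r • e ∈ D := by simpa using hSr x hx 1 (by simp)
      exact ((ENNReal.continuous_pow 2).tendsto _).comp ((h2 hx2).sub (h1 hx1)).enorm
    · have := (hsm k).continuous
      exact (by fun_prop : Continuous fun x ↦
        ‖moll (bump k) D f (x + r • e) - moll (bump k) D f x‖ₑ ^ 2).aemeasurable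
  refine hfatou.trans (liminf_le_of_frequently_le' (Eventually.frequently ?_))
  filter_upwards [eventually_closedBall_subset hD hAc hAD] with k hk
  have hpt : ∀ x ∈ S, ‖moll (bump k) D f (x + r • e) - moll (bump k) D f x‖ₑ ^ 2
      ≤ ∫⁻ s in Set.Ioc (0 : ℝ) 1, ENNReal.ofReal (r ^ 2) *
        ‖moll (bump k) D g (x + (s * r) • e)‖ₑ ^ 2 := by
    intro x hx
    have hder : ∀ s ∈ Set.uIcc (0 : ℝ) 1, HasDerivAt (fun s ↦ moll (bump k) D f (x + (s * r) • e))
        (r • moll (bump k) D g (x + (s * r) • e)) s := by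
      intro s hs
      rw [Set.uIcc_of_le zero_le_one] at hs
      have h1 := ((hsm k).differentiable (by simp) (x + (s * r) • e)).hasFDerivAt
      have h2 : HasDerivAt (fun s : ℝ ↦ x + (s * r) • e) (r • e) s := by
        have := (((hasDerivAt_id s).mul_const r).smul_const e).const_add x
        simpa using this
      have h3 := h1.comp_hasDerivAt s h2
      rw [map_smul, fderiv_moll_apply (bump k) hD.measurableSet hf h (hk _ (hmem x hx s hs))] at h3
      exact h3
    have hcont : Continuous (fun s : ℝ ↦ r • moll (bump k) D g (x + (s * r) • e)) := by
      have := (hsmg k).continuous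
      fun_prop
    have hftc := intervalIntegral.integral_eq_sub_of_hasDerivAt hder
      (hcont.intervalIntegrable 0 1)
    rw [intervalIntegral.integral_of_le zero_le_one] at hftc
    simp only [one_mul, zero_mul, zero_smul, add_zero] at hftc
    rw [← hftc]
    have hj := enorm_sq_integral_smul_le (μ := volume.restrict (Set.Ioc (0 : ℝ) 1))
      (w := fun _ ↦ 1) aemeasurable_const (fun _ ↦ zero_le_one) (by simp)
      hcont.aestronglyMeasurable
    simp only [one_smul, ENNReal.ofReal_one, one_mul] at hj
    refine hj.trans (le_of_eq ?_)
    congr 1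
    ext1 s
    rw [enorm_smul, mul_pow, ← sq_abs, ENNReal.ofReal_pow (abs_nonneg r), ← Real.norm_eq_abs,
      ofReal_norm]
  calc ∫⁻ x in S, ‖moll (bump k) D f (x + r • e) - moll (bump k) D f x‖ₑ ^ 2
      ≤ ∫⁻ x in S, ∫⁻ s in Set.Ioc (0 : ℝ) 1, ENNReal.ofReal (r ^ 2) *
        ‖moll (bump k) D g (x + (s * r) • e)‖ₑ ^ 2 := setLIntegral_mono' hSm hpt
    _ = ∫⁻ s in Set.Ioc (0 : ℝ) 1, ∫⁻ x in S, ENNReal.ofReal (r ^ 2) *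
        ‖moll (bump k) D g (x + (s * r) • e)‖ₑ ^ 2 := by
        refine lintegral_lintegral_swap ?_
        have := (hsmg k).continuous
        refine Measurable.aemeasurable ?_
        refine Measurable.const_mul ?_ _
        exact (by fun_prop : Continuous fun p : E3 × ℝ ↦
          ‖moll (bump k) D g (p.1 + (p.2 * r) • e)‖ₑ ^ 2).measurable
    _ ≤ ∫⁻ s in Set.Ioc (0 : ℝ) 1, ENNReal.ofReal (r ^ 2) * ∫⁻ x in D, ‖g x‖ₑ ^ 2 := by
        refine lintegral_mono fun s ↦ ?_
        rw [lintegral_const_mul' _ _ (by simp)]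
        refine mul_le_mul' le_rfl ?_
        refine (setLIntegral_le_lintegral _ _).trans ?_
        rw [lintegral_add_right_eq_self (fun x ↦ ‖moll (bump k) D g x‖ₑ ^ 2)]
        exact lintegral_moll_sq_le _ hg.aestronglyMeasurable
    _ = _ := by simp

/-- A bounded sequence of a Hilbert space has a weak cluster point. -/
lemma exists_weak_cluster {H : Type*} [NormedAddCommGroup H] [InnerProductSpace ℝ H]
    [CompleteSpace H] (G : ℕ → H) {c : ℝ} (hG : ∀ k, ‖G k‖ ≤ c) :
    ∃ g : H, ‖g‖ ≤ c ∧ ∀ (u : H) (l : ℝ),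
      Tendsto (fun k ↦ inner ℝ u (G k)) atTop (𝓝 l) → inner ℝ u g = l := by
  let d : ℕ → WeakDual ℝ H := fun k ↦ (InnerProductSpace.toDual ℝ H (G k)).toWeakDual
  have hcpt := WeakDual.isCompact_closedBall (𝕜 := ℝ) (0 : StrongDual ℝ H) c
  -- An ultrafilter below `atTop` replaces a subsequence: by Banach–Alaoglu it converges weakly, and
  -- every pairing that converges along the sequence has the same limit along it.
  let U : Ultrafilter (WeakDual ℝ H) := (Ultrafilter.of (atTop : Filter ℕ)).map d
  obtain ⟨y, hy, hUy⟩ := hcpt.ultrafilter_le_nhds U (by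
    refine le_principal_iff.2 ?_
    refine Filter.mem_map.2 (Filter.univ_mem' fun k ↦ ?_)
    simpa [d] using hG k)
  refine ⟨(InnerProductSpace.toDual ℝ H).symm (WeakDual.toStrongDual y), by simpa using hy, ?_⟩
  intro u l hl
  have h1 : Tendsto (fun k ↦ d k u) (Ultrafilter.of (atTop : Filter ℕ)) (𝓝 (y u)) :=
    ((WeakDual.eval_continuous u).tendsto y).comp hUy
  have h2 : Tendsto (fun k ↦ d k u) (Ultrafilter.of (atTop : Filter ℕ)) (𝓝 l) := by
    refine (hl.mono_left (Ultrafilter.of_le _)).congr fun k ↦ ?_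
    rw [real_inner_comm]
    rfl
  rw [real_inner_comm, InnerProductSpace.toDual_symm_apply]
  exact tendsto_nhds_unique h1 h2

/-- The points of `D` at distance at least `δ` from the complement. -/
def innerPart (D : Set E3) (δ : ℝ) : Set E3 := {x | δ ≤ Metric.infDist x Dᶜ}

lemma compl_nonempty_of_isBounded {D : Set E3} (hb : Bornology.IsBounded D) : Dᶜ.Nonempty := by
  rw [Set.nonempty_compl]
  rintro rfl
  exact NormedSpace.unbounded_univ ℝ E3 hb

lemma mem_of_dist_lt_innerPart {D : Set E3} {δ : ℝ} {x y : E3} (hx : x ∈ innerPart D δ)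
    (hy : dist x y < δ) : y ∈ D := by
  by_contra hyD
  exact absurd (Metric.infDist_le_dist_of_mem (show y ∈ Dᶜ from hyD)) (not_le.2 (hy.trans_le hx))

lemma isCompact_innerPart {D : Set E3} (hb : Bornology.IsBounded D) {δ : ℝ} (hδ : 0 < δ) :
    IsCompact (innerPart D δ) := by
  refine Metric.isCompact_of_isClosed_isBounded
    (isClosed_le continuous_const (Metric.continuous_infDist_pt _)) (hb.subset fun x hx ↦ ?_)
  exact mem_of_dist_lt_innerPart hx (by simpa using hδ)

lemma exists_subset_innerPart {D K : Set E3} (hD : IsOpen D) (hb : Bornology.IsBounded D)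
    (hK : IsCompact K) (hKD : K ⊆ D) : ∃ δ, 0 < δ ∧ K ⊆ innerPart D δ := by
  obtain ⟨δ, hδ, h⟩ := hK.exists_cthickening_subset_open hD hKD
  refine ⟨δ, hδ, fun x hx ↦ ?_⟩
  -- `infDist` to the empty set is 0 by convention, so the complement has to be nonempty here.
  refine (Metric.le_infDist (compl_nonempty_of_isBounded hb)).2 fun y hy ↦ ?_
  by_contra hlt
  refine hy (h (Metric.closedBall_subset_cthickening hx δ ?_))
  rw [Metric.mem_closedBall, dist_comm]
  exact (not_le.1 hlt).le

lemma isFiniteMeasure_restrict {D : Set E3} (hb : Bornology.IsBounded D) :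
    IsFiniteMeasure (volume.restrict D) :=
  ⟨by simpa using hb.measure_lt_top⟩

/-- Summation by parts for difference quotients. -/
lemma integral_smul_translate_sub {D : Set E3} {F : Type*}
    [NormedAddCommGroup F] [NormedSpace ℝ F] {u : E3 → F} (hu : IntegrableOn u D)
    {φ : E3 → ℝ} (hφ : Continuous φ) (hc : HasCompactSupport φ) {z : E3}
    (h0 : tsupport φ ⊆ D) (hz : ∀ x ∈ tsupport φ, x + z ∈ D) :
    ∫ x in D, φ x • (u (x + z) - u x) = ∫ x in D, (φ (x - z) - φ x) • u x := by
  have hsupp : ∀ x, x ∉ D → φ x = 0 := fun x hx ↦ image_eq_zero_of_notMem_tsupport fun h ↦ hx (h0 h)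
  have hsupp' : ∀ x, x ∉ D → φ (x - z) = 0 := fun x hx ↦
    image_eq_zero_of_notMem_tsupport fun h ↦ hx (by simpa using hz _ h)
  have hc' : HasCompactSupport (fun x ↦ φ (x - z)) := by
    simpa [sub_eq_add_neg, Function.comp_def] using hc.comp_homeomorph (Homeomorph.addRight (-z))
  have i1 : IntegrableOn (fun x ↦ φ (x - z) • u x) D :=
    integrableOn_smul hu (by fun_prop) hc'
  have i2 : IntegrableOn (fun x ↦ φ x • u x) D := integrableOn_smul hu hφ hc
  have e1 : ∫ x in D, φ (x - z) • u x = ∫ x, φ (x - z) • u x :=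
    setIntegral_eq_integral_of_forall_compl_eq_zero fun x hx ↦ by simp [hsupp' x hx]
  have e2 : ∫ x in D, φ x • u (x + z) = ∫ x, φ x • u (x + z) :=
    setIntegral_eq_integral_of_forall_compl_eq_zero fun x hx ↦ by simp [hsupp x hx]
  have e3 : ∫ x, φ (x - z) • u x = ∫ x, φ x • u (x + z) := by
    rw [← integral_add_right_eq_self (fun x ↦ φ (x - z) • u x) z]
    simp
  have i1' : Integrable (fun x ↦ φ (x - z) • u x) :=
    (integrableOn_iff_integrable_of_support_subset fun x hx ↦ by
      by_contra hxD
      exact hx (by simp [hsupp' x hxD])).1 i1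
  have i3 : Integrable (fun x ↦ φ x • u (x + z)) := by
    simpa using i1'.comp_add_right z
  simp_rw [smul_sub, sub_smul]
  rw [integral_sub i3.integrableOn i2, integral_sub i1 i2, e1, e2, e3]

lemma tendsto_difference_quotient {D : Set E3} {φ : E3 → ℝ} (hφ : IsTest D φ) {F : Type*}
    [NormedAddCommGroup F] [NormedSpace ℝ F] {u : E3 → F} (hu : IntegrableOn u D) (e : E3)
    {r : ℕ → ℝ} (hr : Tendsto r atTop (𝓝 0)) (hr0 : ∀ k, r k ≠ 0) :
    Tendsto (fun k ↦ ∫ x in D, ((r k)⁻¹ * (φ (x - r k • e) - φ x)) • u x) atTop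
      (𝓝 (- ∫ x in D, fderiv ℝ φ x e • u x)) := by
  rw [← integral_neg]
  -- A Lipschitz constant of φ dominates all difference quotients at once.
  obtain ⟨C, hC⟩ := (hφ.contDiff.of_le (by simp) : ContDiff ℝ 1 φ).lipschitzWith_of_hasCompactSupport
    hφ.compact one_ne_zero
  refine tendsto_integral_of_dominated_convergence (fun x ↦ (C * ‖e‖) * ‖u x‖) (fun k ↦ ?_)
    (hu.norm.const_mul _) (fun k ↦ ae_of_all _ fun x ↦ ?_) (ae_of_all _ fun x ↦ ?_)
  · have := hφ.continuous
    exact (by fun_prop : Continuous fun x ↦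
      (r k)⁻¹ * (φ (x - r k • e) - φ x)).aestronglyMeasurable.smul hu.aestronglyMeasurable
  · rw [norm_smul]
    refine mul_le_mul_of_nonneg_right ?_ (norm_nonneg _)
    have h1 := hC.dist_le_mul (x - r k • e) x
    rw [dist_eq_norm, dist_eq_norm] at h1
    have h2 : ‖x - r k • e - x‖ = ‖r k‖ * ‖e‖ := by
      rw [← norm_smul, ← norm_neg (r k • e)]
      congr 1
      abel
    rw [h2] at h1
    rw [norm_mul, norm_inv]
    have h3 : 0 < ‖r k‖ := norm_pos_iff.2 (hr0 k)
    rw [inv_mul_le_iff₀ h3]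
    linarith
  · rw [← neg_smul]
    refine Tendsto.smul_const ?_ _
    have hd : HasDerivAt (fun s : ℝ ↦ φ (x - s • e)) (-(fderiv ℝ φ x e)) 0 := by
      have h1 := (hφ.contDiff.differentiable (by simp) x).hasFDerivAt
      have h2 : HasDerivAt (fun s : ℝ ↦ x - s • e) (-e) 0 := by
        simpa using ((hasDerivAt_id (0 : ℝ)).smul_const e).const_sub x
      have h1' : HasFDerivAt φ (fderiv ℝ φ x) (x - (0 : ℝ) • e) := by simpa using h1
      exact (h1'.comp_hasDerivAt 0 h2).congr_deriv (by simp)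
    have h3 := hd.tendsto_slope_zero.comp (tendsto_nhdsWithin_iff.2
      ⟨hr, Eventually.of_forall hr0⟩)
    simpa [Function.comp_def] using h3

/-- A `1`-Lipschitz map does not increase the norm of a weak derivative. -/
lemma exists_weakDeriv_lipschitz {D : Set E3} (hD : IsOpen D) (hb : Bornology.IsBounded D)
    {T : E3 → E3} (hT : LipschitzWith 1 T) {e : E3} {f g u : L2 D}
    (hfu : u =ᵐ[volume.restrict D] fun x ↦ T (f x)) (h : WeakDeriv D e f g) :
    ∃ g' : L2 D, ‖g'‖ ≤ ‖g‖ ∧ WeakDeriv D e u g' := by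
  have := isFiniteMeasure_restrict hb
  let δ : ℕ → ℝ := fun k ↦ 1 / ((k : ℝ) + 1)
  have hδ : ∀ k, 0 < δ k := fun k ↦ by positivity
  -- The shift has length r‖e‖ < δ, so points at distance δ from the complement stay in D; the
  -- summand 1 covers e = 0.
  let r : ℕ → ℝ := fun k ↦ δ k / (‖e‖ + 1)
  have hr : ∀ k, 0 < r k := fun k ↦ div_pos (hδ k) (by positivity)
  have hre : ∀ k, r k * ‖e‖ < δ k := fun k ↦ by
    have : r k * (‖e‖ + 1) = δ k := div_mul_cancel₀ _ (by positivity)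
    nlinarith [hr k]
  have hδ0 : Tendsto δ atTop (𝓝 0) := tendsto_one_div_add_atTop_nhds_zero_nat
  have hr0 : Tendsto r atTop (𝓝 0) := by simpa using hδ0.div_const (‖e‖ + 1)
  let S : ℕ → Set E3 := fun k ↦ innerPart D (δ k)
  have hS : ∀ k, IsCompact (S k) := fun k ↦ isCompact_innerPart hb (hδ k)
  have hSr : ∀ k, ∀ x ∈ S k, ∀ s ∈ Set.Icc (0 : ℝ) 1, x + (s * r k) • e ∈ D := by
    intro k x hx s hs
    refine mem_of_dist_lt_innerPart hx ?_
    rw [dist_self_add_right, norm_smul, Real.norm_of_nonneg (mul_nonneg hs.1 (hr k).le)]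
    have := mul_le_of_le_one_left (mul_nonneg (hr k).le (norm_nonneg e)) hs.2
    linarith [hre k, mul_assoc s (r k) ‖e‖]
  have hSD : ∀ k, S k ⊆ D := fun k x hx ↦ by simpa using hSr k x hx 0 (by simp)
  have hfm : StronglyMeasurable (f : E3 → E3) := Lp.stronglyMeasurable f
  have hTm : StronglyMeasurable (fun x ↦ T (f x)) := hT.continuous.comp_stronglyMeasurable hfm
  -- Difference quotients of T ∘ f, cut off near the boundary. Since T is 1-Lipschitz they are
  -- dominated by those of f, hence by ‖g‖ in L²; a weak cluster point is the derivative, and no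
  -- chain rule is involved.
  let G : ℕ → E3 → E3 := fun k ↦ (S k).indicator fun x ↦ (r k)⁻¹ • (T (f (x + r k • e)) - T (f x))
  have hGm : ∀ k, StronglyMeasurable (G k) := fun k ↦ by
    have h1 : StronglyMeasurable (fun x ↦ T (f (x + r k • e))) :=
      hTm.comp_measurable (measurable_id.add_const (r k • e))
    exact StronglyMeasurable.indicator ((h1.sub hTm).const_smul (r k)⁻¹) (hS k).measurableSet
  have hGn : ∀ k, ∫⁻ x in D, ‖G k x‖ₑ ^ 2 ≤ ∫⁻ x in D, ‖g x‖ₑ ^ 2 := by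
    intro k
    have h1 := lintegral_translate_sub_le hD (integrableOn_L2 f) (integrableOn_L2 g) h (hS k) (hSr k)
    calc ∫⁻ x in D, ‖G k x‖ₑ ^ 2
        ≤ ∫⁻ x, (S k).indicator (fun x ↦ ENNReal.ofReal ((r k)⁻¹ ^ 2) *
            ‖f (x + r k • e) - f x‖ₑ ^ 2) x := by
          refine (setLIntegral_le_lintegral _ _).trans (lintegral_mono fun x ↦ ?_)
          by_cases hx : x ∈ S k
          · simp only [G, Set.indicator_of_mem hx]
            rw [enorm_smul, mul_pow, Real.enorm_of_nonneg (inv_nonneg.2 (hr k).le),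
              ENNReal.ofReal_pow (inv_nonneg.2 (hr k).le)]
            gcongr
            have := hT (f (x + r k • e)) (f x)
            simpa [edist_eq_enorm_sub] using this
          · simp [G, hx]
      _ = ENNReal.ofReal ((r k)⁻¹ ^ 2) * ∫⁻ x in S k, ‖f (x + r k • e) - f x‖ₑ ^ 2 := by
          rw [lintegral_indicator (hS k).measurableSet, lintegral_const_mul' _ _ (by simp)]
      _ ≤ ENNReal.ofReal ((r k)⁻¹ ^ 2) * (ENNReal.ofReal ((r k) ^ 2) *
            ∫⁻ x in D, ‖g x‖ₑ ^ 2) := by gcongr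
      _ = _ := by
          rw [← mul_assoc, ← ENNReal.ofReal_mul (by positivity), ← mul_pow,
            inv_mul_cancel₀ (hr k).ne']
          simp
  have hGL : ∀ k, MemLp (G k) 2 (volume.restrict D) := fun k ↦ by
    refine ⟨(hGm k).aestronglyMeasurable, ?_⟩
    rw [eLpNorm_lt_top_iff_lintegral_rpow_enorm_lt_top (by simp) (by simp)]
    simp only [ENNReal.toReal_ofNat, ENNReal.rpow_ofNat]
    refine (hGn k).trans_lt ?_
    rw [← L2_enorm_sq g]
    exact ENNReal.pow_lt_top enorm_lt_top
  let Γ : ℕ → L2 D := fun k ↦ (hGL k).toLp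
  have hΓ : ∀ k, ‖Γ k‖ ≤ ‖g‖ := fun k ↦ by
    have h1 : ‖Γ k‖ₑ ^ 2 ≤ ‖g‖ₑ ^ 2 := by
      rw [L2_enorm_sq, L2_enorm_sq]
      refine le_trans (le_of_eq (lintegral_congr_ae ?_)) (hGn k)
      filter_upwards [(hGL k).coeFn_toLp] with x hx
      rw [hx]
    have h2 := (ENNReal.pow_le_pow_left_iff two_ne_zero).1 h1
    simpa [enorm_le_iff_norm_le] using h2
  obtain ⟨g', hg', hlim⟩ := exists_weak_cluster Γ hΓ
  refine ⟨g', hg', weakDeriv_iff_inner.2 fun φ hφ a ↦ ?_⟩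
  rw [eq_neg_iff_add_eq_zero, add_comm, ← eq_neg_iff_add_eq_zero]
  refine hlim _ _ ?_
  have hTu : IntegrableOn (fun x ↦ T (f x)) D := (integrableOn_L2 u).congr hfu
  have hdq := tendsto_difference_quotient hφ hTu e hr0 (fun k ↦ (hr k).ne')
  rw [inner_testVec (hφ.continuous_fderiv e) (hφ.compact_fderiv e), ← inner_neg_right]
  have hu' : ∫ x in D, fderiv ℝ φ x e • u x = ∫ x in D, fderiv ℝ φ x e • T (f x) := by
    refine integral_congr_ae ?_
    filter_upwards [hfu] with x hx
    rw [hx]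
  rw [hu']
  refine ((continuous_const.inner continuous_id).tendsto _ |>.comp hdq).congr' ?_
  -- For large k the cut-off equals 1 on the support of φ, and the difference quotient can be moved
  -- onto φ.
  obtain ⟨d, hd, hKd⟩ := exists_subset_innerPart hD hb hφ.compact hφ.subset
  filter_upwards [hδ0.eventually (gt_mem_nhds hd)] with k hk
  have hKS : tsupport φ ⊆ S k := fun x hx ↦ hk.le.trans (hKd hx)
  rw [inner_testVec hφ.continuous hφ.compact]
  simp only [Function.comp_apply, id]
  congr 1
  have e1 : ∫ x in D, φ x • Γ k x = ∫ x in D, (r k)⁻¹ • φ x • (T (f (x + r k • e)) - T (f x)) := by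
    refine integral_congr_ae ?_
    filter_upwards [(hGL k).coeFn_toLp] with x hx
    rw [hx]
    by_cases hxS : x ∈ S k
    · simp only [G, Set.indicator_of_mem hxS]
      rw [smul_comm]
    · rw [image_eq_zero_of_notMem_tsupport fun h ↦ hxS (hKS h)]
      simp
  rw [e1, integral_smul, integral_smul_translate_sub (u := fun x ↦ T (f x)) hTu
    hφ.continuous hφ.compact hφ.subset (fun x hx ↦ by simpa using hSr k x (hKS hx) 1 (by simp)),
    ← integral_smul]
  simp_rw [smul_smul]

/-! ### The product rule -/

section product

variable {F : Type*} [NormedAddCommGroup F] [NormedSpace ℝ F] [CompleteSpace F]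

lemma IsTest.mul_left {D : Set E3} {φ u : E3 → ℝ} (hφ : IsTest D φ)
    (hu : ContDiff ℝ (⊤ : ℕ∞) u) : IsTest D (fun x ↦ φ x * u x) :=
  ⟨hφ.contDiff.mul hu, hφ.compact.mul_right,
    (tsupport_mul_subset_left (f := φ) (g := u)).trans hφ.subset⟩

/-- The kernel is even, so mollification is symmetric under the integral. -/
lemma integral_moll_smul {D : Set E3} (ψ : ContDiffBump (0 : E3)) {u : E3 → ℝ} {f : E3 → F}
    (hu : IntegrableOn u D) (hf : IntegrableOn f D) :
    ∫ x in D, moll ψ D u x • f x = ∫ y in D, u y • moll ψ D f y := by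
  have hm : Continuous (fun p : E3 × E3 ↦ ψ.normed (volume : Measure E3) (p.1 - p.2)) :=
    ψ.continuous_normed.comp (continuous_fst.sub continuous_snd)
  obtain ⟨C, hC⟩ := (ψ.continuous_normed (μ := volume)).bounded_above_of_compact_support
    ψ.hasCompactSupport_normed
  have hint : Integrable (Function.uncurry fun x y ↦ ψ.normed volume (x - y) • u y • f x)
      ((volume.restrict D).prod (volume.restrict D)) := by
    have h1 : Integrable (fun p : E3 × E3 ↦ u p.2 • f p.1)
        ((volume.restrict D).prod (volume.restrict D)) := (Integrable.smul_prod hu hf).swap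
    exact Integrable.bdd_smul h1 C hm.aestronglyMeasurable (ae_of_all _ fun p ↦ hC _)
  calc ∫ x in D, moll ψ D u x • f x
      = ∫ x in D, ∫ y in D, ψ.normed volume (x - y) • u y • f x := by
        congr 1
        ext1 x
        rw [moll, ← integral_smul_const]
        simp_rw [smul_assoc]
    _ = ∫ y in D, ∫ x in D, ψ.normed volume (x - y) • u y • f x := integral_integral_swap hint
    _ = _ := by
        congr 1
        ext1 y
        rw [moll, ← integral_smul]
        congr 1
        ext1 x
        rw [smul_comm, ← ψ.normed_neg, neg_sub]

/-- The product rule for bounded functions. -/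
lemma WeakDeriv.smul {D : Set E3} (hD : IsOpen D) {e : E3} {u u' : E3 → ℝ} {f f' : E3 → F}
    (hui : IntegrableOn u D) (hui' : IntegrableOn u' D) (hfi : IntegrableOn f D)
    (hfi' : IntegrableOn f' D) {c : ℝ} (hc : 0 ≤ c)
    (huc : ∀ᵐ x ∂(volume.restrict D), ‖u x‖ ≤ c) (hfc : ∀ᵐ x ∂(volume.restrict D), ‖f x‖ ≤ c)
    (hu : WeakDeriv D e u u') (hf : WeakDeriv D e f f') :
    WeakDeriv D e (fun x ↦ u x • f x) (fun x ↦ u' x • f x + u x • f' x) := by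
  intro φ hφ
  have hDm := hD.measurableSet
  have hus : ∀ k, ContDiff ℝ (⊤ : ℕ∞) (moll (bump k) D u) := fun k ↦ contDiff_moll _ hDm hui
  have hulim := ae_tendsto_moll_bump hDm hui
  obtain ⟨C₀, hC₀⟩ := hφ.continuous.bounded_above_of_compact_support hφ.compact
  obtain ⟨C₁, hC₁⟩ := (hφ.continuous_fderiv e).bounded_above_of_compact_support
    (hφ.compact_fderiv e)
  have hprod : ∀ {h : E3 → ℝ} {C : ℝ} {p : E3 → F}, Continuous h → (∀ x, ‖h x‖ ≤ C) →
      IntegrableOn p D → Tendsto (fun k ↦ ∫ x in D, (h x * moll (bump k) D u x) • p x) atTop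
        (𝓝 (∫ x in D, h x • u x • p x)) := by
    intro h C p hh hC hp
    refine tendsto_integral_of_dominated_convergence (fun x ↦ (C * c) * ‖p x‖) (fun k ↦ ?_)
      (hp.norm.const_mul _) (fun k ↦ ae_of_all _ fun x ↦ ?_) ?_
    · exact (hh.mul (hus k).continuous).aestronglyMeasurable.smul hp.aestronglyMeasurable
    · rw [norm_smul, norm_mul]
      gcongr
      · exact (norm_nonneg _).trans (hC 0)
      · exact hC x
      · exact norm_moll_le _ hc huc x
    · filter_upwards [hulim] with x hx
      simpa [smul_smul] using (hx.const_mul (h x)).smul_const (p x)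
  have hlim1 := hprod (hφ.continuous_fderiv e) hC₁ hfi
  have hlim3 := hprod hφ.continuous hC₀ hfi'
  have hφf : IntegrableOn (fun x ↦ φ x • f x) D := integrableOn_smul hfi hφ.continuous hφ.compact
  -- The mollifications of the merely integrable u' have no evident dominating function. The
  -- mollifier is therefore moved onto φ f, which is bounded.
  have hlim2 : Tendsto (fun k ↦ ∫ x in D, moll (bump k) D u' x • φ x • f x) atTop
      (𝓝 (∫ x in D, u' x • φ x • f x)) := by
    simp_rw [integral_moll_smul _ hui' hφf]
    have hb : ∀ᵐ x ∂(volume.restrict D), ‖φ x • f x‖ ≤ C₀ * c := by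
      filter_upwards [hfc] with x hx
      rw [norm_smul]
      exact mul_le_mul (hC₀ x) hx (norm_nonneg _) ((norm_nonneg _).trans (hC₀ 0))
    refine tendsto_integral_of_dominated_convergence (fun x ↦ ‖u' x‖ * (C₀ * c)) (fun k ↦ ?_)
      (hui'.norm.mul_const _) (fun k ↦ ae_of_all _ fun x ↦ ?_) ?_
    · exact hui'.aestronglyMeasurable.smul (contDiff_moll _ hDm hφf).continuous.aestronglyMeasurable
    · rw [norm_smul]
      gcongr
      exact norm_moll_le _ (mul_nonneg ((norm_nonneg _).trans (hC₀ 0)) hc) hb x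
    · filter_upwards [ae_tendsto_moll_bump hDm hφf] with x hx
      exact hx.const_smul _
  have hev : ∀ᶠ k in atTop, ∫ x in D, (fderiv ℝ φ x e * moll (bump k) D u x) • f x
      = -(∫ x in D, (φ x * moll (bump k) D u x) • f' x)
        - ∫ x in D, moll (bump k) D u' x • φ x • f x := by
    filter_upwards [eventually_closedBall_subset hD hφ.compact hφ.subset] with k hk
    have htest := hφ.mul_left (hus k)
    have h1 := hf _ htest
    -- The derivative of the mollification is known only where its ball lies in D; elsewhere φ
    -- vanishes and its value is irrelevant.
    have hder : ∀ x, fderiv ℝ (fun x ↦ φ x * moll (bump k) D u x) x e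
        = fderiv ℝ φ x e * moll (bump k) D u x + moll (bump k) D u' x * φ x := by
      intro x
      rw [fderiv_fun_mul (hφ.contDiff.differentiable (by simp) x)
        ((hus k).differentiable (by simp) x)]
      by_cases hx : x ∈ tsupport φ
      · simp only [_root_.add_apply, _root_.smul_apply, smul_eq_mul]
        rw [fderiv_moll_apply _ hDm hui hu (hk x hx)]
        ring
      · simp [image_eq_zero_of_notMem_tsupport hx, mul_comm]
    simp_rw [hder, add_smul] at h1
    rw [integral_add] at h1
    · rw [← h1]
      simp_rw [mul_smul]
      abel
    · exact integrableOn_smul hfi ((hφ.continuous_fderiv e).mul (hus k).continuous)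
        (hφ.compact_fderiv e).mul_right
    · exact integrableOn_smul hfi ((contDiff_moll _ hDm hui').continuous.mul hφ.continuous)
        hφ.compact.mul_left
  have hfin := tendsto_nhds_unique (hlim1.congr' hev) (hlim3.neg.sub hlim2)
  rw [hfin]
  simp_rw [smul_add]
  have i1 : IntegrableOn (fun x ↦ φ x • u' x • f x) D := by
    refine integrableOn_smul ?_ hφ.continuous hφ.compact
    have hfm := hfi.aestronglyMeasurable
    exact (hui'.smul_bdd c hfm hfc :)
  have i2 : IntegrableOn (fun x ↦ φ x • u x • f' x) D := by
    refine integrableOn_smul ?_ hφ.continuous hφ.compact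
    exact Integrable.bdd_smul hfi' c hui.aestronglyMeasurable huc
  rw [integral_add i1 i2, neg_add, add_comm, sub_eq_add_neg]
  simp_rw [smul_comm (φ _) (u' _)]

end product

/-! ### The Sobolev embedding `H² ⊂ L^∞` -/

lemma lintegral_comp_add_smul_le (p : E3 → ℝ≥0∞) (x : E3) {t : ℝ} (ht : 0 < t) :
    ∫⁻ z, p (x + t • z) = ENNReal.ofReal ((t ^ 3)⁻¹) * ∫⁻ z, p z := by
  have he : MeasurableEmbedding (fun z : E3 ↦ t • z) :=
    (Homeomorph.smulOfNeZero t ht.ne').measurableEmbedding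
  have h1 : ∫⁻ z, p (x + t • z) = ∫⁻ w, p (x + w) ∂(Measure.map (fun z : E3 ↦ t • z) volume) :=
    (he.lintegral_map (fun w ↦ p (x + w))).symm
  rw [h1, Measure.map_addHaar_smul _ ht.ne', lintegral_smul_measure, lintegral_add_left_eq_self]
  simp [abs_of_pos ht]

/-- The probability density used in the Sobolev estimate. Splitting t = t^(−1/2) · t^(3/2), Jensen
leaves the square t³ of the second factor, exactly what compensates the Jacobian t⁻³ of a dilation
in dimension three. -/
lemma lintegral_inv_two_sqrt :
    ∫⁻ t in Set.Ioc (0 : ℝ) 1, ENNReal.ofReal (t ^ (-1 / 2 : ℝ) / 2) = 1 := by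
  have hi : IntervalIntegrable (fun t : ℝ ↦ t ^ (-1 / 2 : ℝ)) volume 0 1 :=
    intervalIntegral.intervalIntegrable_rpow' (by norm_num)
  rw [← ofReal_integral_eq_lintegral_ofReal]
  · rw [← intervalIntegral.integral_of_le zero_le_one, intervalIntegral.integral_div,
      integral_rpow (Or.inl (by norm_num))]
    norm_num
  · exact (((intervalIntegrable_iff_integrableOn_Ioc_of_le zero_le_one).1 hi)).div_const 2
  · filter_upwards [ae_restrict_mem measurableSet_Ioc] with t ht
    have := ht.1
    positivity

section sobolev

variable {F : Type*} [NormedAddCommGroup F] [NormedSpace ℝ F] [CompleteSpace F]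

/-- The squared pointwise size of a 2-jet. -/
def jetSq (u : E3 → F) (u₁ : Fin 3 → E3 → F) (u₂ : Fin 3 → Fin 3 → E3 → F) (x : E3) : ℝ :=
  ‖u x‖ ^ 2 + ∑ i, ‖u₁ i x‖ ^ 2 + ∑ i, ∑ j, ‖u₂ i j x‖ ^ 2

/-- The bracket is the second t-derivative of (1 − t)² u(x + tz), with a, b, c standing for u and
its first and second derivatives. The constant is 48 · 9: the factor 48 from squaring 4(‖a‖ + A +
B), and at most 9 from squaring the sums over indices. -/
lemma norm_sq_bracket_le {F : Type*} [NormedAddCommGroup F] [NormedSpace ℝ F] (a : F)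
    (b : Fin 3 → F) (c : Fin 3 → Fin 3 → F) {z : E3} (hz : ‖z‖ ≤ 1)
    {t : ℝ} (ht : t ∈ Set.Icc (0 : ℝ) 1) :
    ‖(2 : ℝ) • a - (4 * (1 - t)) • (∑ i, z i • b i)
      + (1 - t) ^ 2 • (∑ i, z i • ∑ j, z j • c i j)‖ ^ 2
      ≤ 432 * (‖a‖ ^ 2 + ∑ i, ‖b i‖ ^ 2 + ∑ i, ∑ j, ‖c i j‖ ^ 2) := by
  have hzi : ∀ i, ‖z i‖ ≤ 1 := fun i ↦ (PiLp.norm_apply_le z i).trans hz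
  have h1 : ‖∑ i, z i • b i‖ ≤ ∑ i, ‖b i‖ := norm_sum_le_of_le _ fun i _ ↦ by
    rw [norm_smul]
    exact mul_le_of_le_one_left (norm_nonneg _) (hzi i)
  have h2 : ‖∑ i, z i • ∑ j, z j • c i j‖ ≤ ∑ i, ∑ j, ‖c i j‖ := norm_sum_le_of_le _ fun i _ ↦ by
    rw [norm_smul]
    refine (mul_le_of_le_one_left (norm_nonneg _) (hzi i)).trans ?_
    refine norm_sum_le_of_le _ fun j _ ↦ ?_
    rw [norm_smul]
    exact mul_le_of_le_one_left (norm_nonneg _) (hzi j)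
  set A := ∑ i, ‖b i‖ with hA
  set B := ∑ i, ∑ j, ‖c i j‖ with hB
  have hA0 : 0 ≤ A := Finset.sum_nonneg fun _ _ ↦ norm_nonneg _
  have hB0 : 0 ≤ B := Finset.sum_nonneg fun _ _ ↦ Finset.sum_nonneg fun _ _ ↦ norm_nonneg _
  have hA2 : A ^ 2 ≤ 3 * ∑ i, ‖b i‖ ^ 2 := by
    simpa using sq_sum_le_card_mul_sum_sq (s := Finset.univ) (f := fun i ↦ ‖b i‖)
  have hB2 : B ^ 2 ≤ 9 * ∑ i, ∑ j, ‖c i j‖ ^ 2 := by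
    have := sq_sum_le_card_mul_sum_sq (s := (Finset.univ : Finset (Fin 3 × Fin 3)))
      (f := fun p ↦ ‖c p.1 p.2‖)
    rw [Fintype.sum_prod_type, Fintype.sum_prod_type] at this
    simpa using this
  have ht0 : 0 ≤ 1 - t := by linarith [ht.2]
  have ht1 : 1 - t ≤ 1 := by linarith [ht.1]
  have hn : ‖(2 : ℝ) • a - (4 * (1 - t)) • (∑ i, z i • b i)
      + (1 - t) ^ 2 • (∑ i, z i • ∑ j, z j • c i j)‖ ≤ 4 * (‖a‖ + A + B) := by
    refine (norm_add_le _ _).trans ?_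
    refine (add_le_add_left (norm_sub_le _ _) _).trans ?_
    rw [norm_smul, norm_smul, norm_smul, Real.norm_of_nonneg (by positivity),
      Real.norm_of_nonneg (by positivity), Real.norm_of_nonneg (by positivity)]
    have e1 : 4 * (1 - t) * ‖∑ i, z i • b i‖ ≤ 4 * A := by
      refine mul_le_mul (by linarith) h1 (norm_nonneg _) (by norm_num)
    have e2 : (1 - t) ^ 2 * ‖∑ i, z i • ∑ j, z j • c i j‖ ≤ 1 * B :=
      mul_le_mul (pow_le_one₀ ht0 ht1) h2 (norm_nonneg _) zero_le_one
    linarith [norm_nonneg a]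
  have hS1 : 0 ≤ ∑ i, ‖b i‖ ^ 2 := Finset.sum_nonneg fun _ _ ↦ by positivity
  have hS2 : 0 ≤ ∑ i, ∑ j, ‖c i j‖ ^ 2 :=
    Finset.sum_nonneg fun _ _ ↦ Finset.sum_nonneg fun _ _ ↦ by positivity
  calc _ ≤ (4 * (‖a‖ + A + B)) ^ 2 := by gcongr
    _ ≤ 48 * (‖a‖ ^ 2 + A ^ 2 + B ^ 2) := by
        nlinarith [sq_nonneg (‖a‖ - A), sq_nonneg (‖a‖ - B), sq_nonneg (A - B)]
    _ ≤ _ := by nlinarith [sq_nonneg ‖a‖]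

lemma hasDerivAt_segment {F : Type*} [NormedAddCommGroup F] [NormedSpace ℝ F] {u : E3 → F}
    (hu : Differentiable ℝ u) {u₁ : Fin 3 → E3 → F} {x z : E3}
    {t : ℝ} (h : ∀ i, fderiv ℝ u (x + t • z) (EuclideanSpace.single i 1) = u₁ i (x + t • z)) :
    HasDerivAt (fun t : ℝ ↦ u (x + t • z)) (∑ i, z i • u₁ i (x + t • z)) t := by
  have h2 : HasDerivAt (fun s : ℝ ↦ x + s • z) z t := by
    simpa using ((hasDerivAt_id t).smul_const z).const_add x
  refine ((hu (x + t • z)).hasFDerivAt.comp_hasDerivAt t h2).congr_deriv ?_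
  have hz : z = ∑ i, z i • EuclideanSpace.single i (1 : ℝ) := by
    ext j
    simp [Finset.sum_apply, Pi.single_apply]
  have hs : fderiv ℝ u (x + t • z) z
      = ∑ i, z i • fderiv ℝ u (x + t • z) (EuclideanSpace.single i 1) := by
    conv_lhs => enter [2]; rw [hz]
    simp only [map_sum, map_smul]
  rw [hs]
  simp_rw [h]

/-- Put q(t) = (1 − t)² u(x + tz). As q and q' vanish at t = 1, integration by parts gives u(x) =
∫₀¹ t q''(t) dt. Jensen with the density t^(−1/2)/2 leaves the factor (2 t^(3/2))² = 4t³, whence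
1728 = 4 · 432. Integrating over z in B and substituting y = x + tz costs t⁻³, which cancels t³. -/
lemma enorm_sq_mul_volume_le {u : E3 → F} {u₁ : Fin 3 → E3 → F} {u₂ : Fin 3 → Fin 3 → E3 → F}
    (hu : ContDiff ℝ 1 u) (hu₁ : ∀ i, ContDiff ℝ 1 (u₁ i)) (hu₂ : ∀ i j, Continuous (u₂ i j))
    {x : E3} {B : Set E3} (hB : MeasurableSet B) (hB1 : ∀ z ∈ B, ‖z‖ ≤ 1)
    (h₁ : ∀ z ∈ B, ∀ t ∈ Set.Icc (0 : ℝ) 1, ∀ i,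
      fderiv ℝ u (x + t • z) (EuclideanSpace.single i 1) = u₁ i (x + t • z))
    (h₂ : ∀ z ∈ B, ∀ t ∈ Set.Icc (0 : ℝ) 1, ∀ i j,
      fderiv ℝ (u₁ i) (x + t • z) (EuclideanSpace.single j 1) = u₂ i j (x + t • z)) :
    ‖u x‖ₑ ^ 2 * volume B ≤ 1728 * ∫⁻ y, ENNReal.ofReal (jetSq u u₁ u₂ y) := by
  have hjc : Continuous (jetSq u u₁ u₂) := by
    have := hu.continuous
    have := fun i ↦ (hu₁ i).continuous
    unfold jetSq
    fun_prop
  have hpt : ∀ z ∈ B, ‖u x‖ₑ ^ 2 ≤ ∫⁻ t in Set.Ioc (0 : ℝ) 1,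
      ENNReal.ofReal (t ^ (-1 / 2 : ℝ) / 2) *
        (ENNReal.ofReal (1728 * t ^ 3) * ENNReal.ofReal (jetSq u u₁ u₂ (x + t • z))) := by
    intro z hz
    set p : ℝ → F := fun t ↦ u (x + t • z)
    set p₁ : ℝ → F := fun t ↦ ∑ i, z i • u₁ i (x + t • z)
    set p₂ : ℝ → F := fun t ↦ ∑ i, z i • ∑ j, z j • u₂ i j (x + t • z)
    set br : ℝ → F := fun t ↦ (2 : ℝ) • p t - (4 * (1 - t)) • p₁ t + (1 - t) ^ 2 • p₂ t
    have hbrc : Continuous br := by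
      have := hu.continuous
      have := fun i ↦ (hu₁ i).continuous
      fun_prop
    -- The antiderivative is t q' − q; it is 0 at t = 1 and −u(x) at t = 0.
    have hder : ∀ t ∈ Set.uIcc (0 : ℝ) 1, HasDerivAt (fun t ↦
        t • ((1 - t) ^ 2 • p₁ t - (2 * (1 - t)) • p t) - (1 - t) ^ 2 • p t) (t • br t) t := by
      intro t ht
      rw [Set.uIcc_of_le zero_le_one] at ht
      have d0 : HasDerivAt p (p₁ t) t :=
        hasDerivAt_segment (hu.differentiable one_ne_zero) (h₁ z hz t ht)
      have d1 : HasDerivAt p₁ (p₂ t) t := by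
        refine HasDerivAt.fun_sum fun i _ ↦ HasDerivAt.const_smul (z i) ?_
        exact hasDerivAt_segment ((hu₁ i).differentiable one_ne_zero) (h₂ z hz t ht i)
      have c1 : HasDerivAt (fun t : ℝ ↦ 1 - t) (-1) t := (hasDerivAt_id t).const_sub 1
      have c2 : HasDerivAt (fun t : ℝ ↦ (1 - t) ^ 2) (-2 * (1 - t)) t := by
        refine (c1.pow 2).congr_deriv ?_
        norm_num
      have c3 : HasDerivAt (fun t : ℝ ↦ 2 * (1 - t)) (-2) t := by
        refine (c1.const_mul 2).congr_deriv ?_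
        norm_num
      refine (((hasDerivAt_id t).smul ((c2.smul d1).sub (c3.smul d0))).sub
        (c2.smul d0)).congr_deriv ?_
      simp only [br, id, Pi.sub_apply, Pi.smul_apply']
      module
    have hint := intervalIntegral.integral_eq_sub_of_hasDerivAt hder
      ((continuous_id.smul hbrc).intervalIntegrable 0 1)
    have hux : ∫ t in Set.Ioc (0 : ℝ) 1, t • br t = u x := by
      rw [← intervalIntegral.integral_of_le zero_le_one, hint]
      simp [p]
    have hux' : u x = ∫ t in Set.Ioc (0 : ℝ) 1,
        (t ^ (-1 / 2 : ℝ) / 2) • ((2 * t ^ (3 / 2 : ℝ)) • br t) := by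
      rw [← hux]
      refine setIntegral_congr_fun measurableSet_Ioc fun t ht ↦ ?_
      simp only [smul_smul]
      congr 1
      have : t ^ (-1 / 2 : ℝ) * t ^ (3 / 2 : ℝ) = t := by
        rw [← Real.rpow_add ht.1]
        norm_num
      linear_combination -this
    -- Jensen's inequality above wants a weight that is nonnegative on the whole line; the
    -- truncation changes nothing on (0, 1].
    have hm1 : Measurable (fun t : ℝ ↦ max 0 (t ^ (-1 / 2 : ℝ) / 2)) := by fun_prop
    have hmax : ∀ t ∈ Set.Ioc (0 : ℝ) 1,
        max 0 (t ^ (-1 / 2 : ℝ) / 2) = t ^ (-1 / 2 : ℝ) / 2 := fun t ht ↦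
      max_eq_right (by have := ht.1; positivity)
    have hux'' : u x = ∫ t in Set.Ioc (0 : ℝ) 1,
        (max 0 (t ^ (-1 / 2 : ℝ) / 2)) • ((2 * t ^ (3 / 2 : ℝ)) • br t) := by
      rw [hux']
      exact setIntegral_congr_fun measurableSet_Ioc fun t ht ↦ by simp only [hmax t ht]
    rw [hux'']
    refine (enorm_sq_integral_smul_le hm1.aemeasurable (fun t ↦ le_max_left _ _) ?_ ?_).trans ?_
    · refine le_of_eq ?_
      rw [← lintegral_inv_two_sqrt]
      exact setLIntegral_congr_fun measurableSet_Ioc fun t ht ↦ by simp only [hmax t ht]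
    · have : Measurable (fun t : ℝ ↦ 2 * t ^ (3 / 2 : ℝ)) := by fun_prop
      exact this.aestronglyMeasurable.smul hbrc.aestronglyMeasurable
    · refine setLIntegral_mono' measurableSet_Ioc fun t ht ↦ ?_
      rw [hmax t ht]
      refine mul_le_mul' le_rfl ?_
      rw [← ENNReal.ofReal_mul (by have := ht.1; positivity), ← ofReal_norm,
        ← ENNReal.ofReal_pow (norm_nonneg _)]
      refine ENNReal.ofReal_le_ofReal ?_
      rw [norm_smul, mul_pow, Real.norm_eq_abs, sq_abs, mul_pow, ← Real.rpow_natCast,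
        ← Real.rpow_natCast, ← Real.rpow_mul ht.1.le]
      have hb := norm_sq_bracket_le (u (x + t • z)) (fun i ↦ u₁ i (x + t • z))
        (fun i j ↦ u₂ i j (x + t • z)) (hB1 z hz) ⟨ht.1.le, ht.2⟩
      have ht3 : t ^ ((3 / 2 : ℝ) * ((2 : ℕ) : ℝ)) = t ^ 3 := by
        rw [← Real.rpow_natCast t 3]
        norm_num
      rw [ht3]
      have h0 : 0 ≤ t ^ 3 := by have := ht.1; positivity
      have := mul_le_mul_of_nonneg_left hb h0
      unfold jetSq
      norm_num
      simp only [br, p, p₁, p₂]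
      linarith
  calc ‖u x‖ₑ ^ 2 * volume B = ∫⁻ z in B, ‖u x‖ₑ ^ 2 := by simp
    _ ≤ ∫⁻ z in B, ∫⁻ t in Set.Ioc (0 : ℝ) 1, ENNReal.ofReal (t ^ (-1 / 2 : ℝ) / 2) *
        (ENNReal.ofReal (1728 * t ^ 3) * ENNReal.ofReal (jetSq u u₁ u₂ (x + t • z))) :=
        setLIntegral_mono' hB hpt
    _ = ∫⁻ t in Set.Ioc (0 : ℝ) 1, ∫⁻ z in B, ENNReal.ofReal (t ^ (-1 / 2 : ℝ) / 2) *
        (ENNReal.ofReal (1728 * t ^ 3) * ENNReal.ofReal (jetSq u u₁ u₂ (x + t • z))) := by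
        refine lintegral_lintegral_swap (Measurable.aemeasurable ?_)
        have h1 : Measurable (fun q : E3 × ℝ ↦ jetSq u u₁ u₂ (q.1 |> fun z ↦ x + q.2 • z)) :=
          (hjc.comp (by fun_prop)).measurable
        refine Measurable.mul ?_ (Measurable.mul ?_ h1.ennreal_ofReal)
        · fun_prop
        · fun_prop
    _ ≤ ∫⁻ t in Set.Ioc (0 : ℝ) 1, ENNReal.ofReal (t ^ (-1 / 2 : ℝ) / 2) *
        (1728 * ∫⁻ y, ENNReal.ofReal (jetSq u u₁ u₂ y)) := by
        refine setLIntegral_mono' measurableSet_Ioc fun t ht ↦ ?_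
        rw [lintegral_const_mul' _ _ ENNReal.ofReal_ne_top,
          lintegral_const_mul' _ _ ENNReal.ofReal_ne_top]
        refine mul_le_mul' le_rfl ?_
        refine (mul_le_mul' le_rfl (setLIntegral_le_lintegral _ _)).trans ?_
        rw [lintegral_comp_add_smul_le (fun y ↦ ENNReal.ofReal (jetSq u u₁ u₂ y)) x ht.1, ← mul_assoc,
          ← ENNReal.ofReal_mul (by have := ht.1; positivity), mul_assoc,
          mul_inv_cancel₀ (by have := ht.1; positivity)]
        simp
    _ = _ := by
        rw [lintegral_mul_const _ (by fun_prop), lintegral_inv_two_sqrt, one_mul]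

lemma lintegral_jetSq {F : Type*} [NormedAddCommGroup F] {α : Type*} [MeasurableSpace α]
    {μ : Measure α} {u : α → F}
    {u₁ : Fin 3 → α → F} {u₂ : Fin 3 → Fin 3 → α → F} (hu : AEStronglyMeasurable u μ)
    (hu₁ : ∀ i, AEStronglyMeasurable (u₁ i) μ) (hu₂ : ∀ i j, AEStronglyMeasurable (u₂ i j) μ) :
    ∫⁻ y, (‖u y‖ₑ ^ 2 + ∑ i, ‖u₁ i y‖ₑ ^ 2 + ∑ i, ∑ j, ‖u₂ i j y‖ₑ ^ 2) ∂μ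
      = ∫⁻ y, ‖u y‖ₑ ^ 2 ∂μ + ∑ i, ∫⁻ y, ‖u₁ i y‖ₑ ^ 2 ∂μ
        + ∑ i, ∑ j, ∫⁻ y, ‖u₂ i j y‖ₑ ^ 2 ∂μ := by
  have h0 : AEMeasurable (fun y ↦ ‖u y‖ₑ ^ 2) μ := hu.enorm.pow_const 2
  have h1 : ∀ i, AEMeasurable (fun y ↦ ‖u₁ i y‖ₑ ^ 2) μ := fun i ↦ (hu₁ i).enorm.pow_const 2
  have h2 : ∀ i j, AEMeasurable (fun y ↦ ‖u₂ i j y‖ₑ ^ 2) μ :=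
    fun i j ↦ (hu₂ i j).enorm.pow_const 2
  rw [lintegral_add_left' (by fun_prop), lintegral_add_left' h0,
    lintegral_finsetSum' _ fun i _ ↦ h1 i, lintegral_finsetSum' _ fun i _ ↦ by fun_prop]
  congr 1
  exact Finset.sum_congr rfl fun i _ ↦ lintegral_finsetSum' _ fun j _ ↦ h2 i j

/-- The Sobolev embedding `H² ⊂ L^∞` on a domain with the cone condition. -/
lemma exists_sobolev {D : Set E3} (hD : IsOpen D) (hcone : ConeCondition D) :
    ∃ C : ℝ≥0, ∀ (f : E3 → F) (f₁ : Fin 3 → E3 → F) (f₂ : Fin 3 → Fin 3 → E3 → F),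
      IntegrableOn f D → (∀ i, IntegrableOn (f₁ i) D) → (∀ i j, IntegrableOn (f₂ i j) D) →
      (∀ i, WeakDeriv D (EuclideanSpace.single i 1) f (f₁ i)) →
      (∀ i j, WeakDeriv D (EuclideanSpace.single j 1) (f₁ i) (f₂ i j)) →
      ∀ᵐ x ∂(volume.restrict D), ‖f x‖ₑ ^ 2 ≤ C * ((∫⁻ y in D, ‖f y‖ₑ ^ 2)
        + (∑ i, ∫⁻ y in D, ‖f₁ i y‖ₑ ^ 2) + ∑ i, ∑ j, ∫⁻ y in D, ‖f₂ i j y‖ₑ ^ 2) := by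
  obtain ⟨h, hh, κ, hκ0, hκ1, hc⟩ := hcone
  set η : ℝ := min h 1 with hη
  have hη0 : 0 < η := lt_min hh one_pos
  -- The ball of radius ρ about (η/2)ξ has to lie in the cone with axis ξ, for which ρ(1 + κ) < (1 −
  -- κ)η/2 suffices. Since η ≤ 1 it also lies in the unit ball. Neither ρ nor its volume depends on
  -- x.
  set ρ : ℝ := (1 - κ) * η / 8 with hρ
  have hρ0 : 0 < ρ := by have : 0 < 1 - κ := by linarith
                         positivity
  have hρη : ρ ≤ η / 8 := by
    rw [hρ]
    have : (1 - κ) * η ≤ 1 * η := by gcongr; linarith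
    linarith
  set V : ℝ≥0∞ := volume (Metric.closedBall (0 : E3) ρ) with hV
  have hV0 : V ≠ 0 := (Metric.measure_closedBall_pos volume _ hρ0).ne'
  have hVt : V ≠ ⊤ := measure_closedBall_lt_top.ne
  refine ⟨(1728 / V).toNNReal, fun f f₁ f₂ hf hf₁ hf₂ h₁ h₂ ↦ ?_⟩
  have hCV : ((1728 / V).toNNReal : ℝ≥0∞) = 1728 / V :=
    ENNReal.coe_toNNReal (ENNReal.div_ne_top (by simp) hV0)
  rw [hCV]
  have hDm := hD.measurableSet
  filter_upwards [ae_tendsto_moll_bump hDm hf, ae_restrict_mem hDm] with x hx hxD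
  obtain ⟨ξ, hξ, hcx⟩ := hc x hxD
  set B : Set E3 := Metric.closedBall ((η / 2) • ξ) ρ with hB
  have hBn : ∀ z ∈ B, 0 < ‖z‖ ∧ ‖z‖ < η ∧ κ * ‖z‖ < inner ℝ z ξ := by
    intro z hz
    rw [hB, mem_closedBall_iff_norm] at hz
    have e1 : ‖(η / 2) • ξ‖ = η / 2 := by
      rw [norm_smul, hξ, mul_one, Real.norm_of_nonneg (by positivity)]
    have e2 := norm_le_norm_add_norm_sub' z ((η / 2) • ξ)
    have e3 := norm_sub_norm_le ((η / 2) • ξ) z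
    rw [norm_sub_rev] at e3
    have e4 : inner ℝ z ξ = η / 2 + inner ℝ (z - (η / 2) • ξ) ξ := by
      rw [inner_sub_left, real_inner_smul_left, real_inner_self_eq_norm_sq, hξ]
      ring
    have e5 := abs_real_inner_le_norm (z - (η / 2) • ξ) ξ
    rw [hξ, mul_one] at e5
    have e6 := neg_le_of_abs_le e5
    have e7 : κ * ‖z‖ ≤ κ * (η / 2 + ρ) := by gcongr; linarith
    refine ⟨by linarith, by linarith, ?_⟩
    rw [e4]
    have e8 : ρ * (1 + κ) ≤ (1 - κ) * η / 4 := by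
      rw [hρ]
      have : 0 ≤ (1 - κ) * η := mul_nonneg (by linarith) hη0.le
      nlinarith
    have e9 : 0 < (1 - κ) * η := mul_pos (by linarith) hη0
    nlinarith
  -- A cone is star-shaped about its vertex; the vertex itself, t = 0, is not in the open cone but
  -- is in D.
  have hseg : ∀ z ∈ B, ∀ t ∈ Set.Icc (0 : ℝ) 1, x + t • z ∈ D := by
    intro z hz t ht
    obtain ⟨z1, z2, z3⟩ := hBn z hz
    rcases ht.1.eq_or_lt with h0 | h0
    · rw [← h0]
      simpa using hxD
    · have e : x + t • z - x = t • z := by abel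
      have en : ‖t • z‖ = t * ‖z‖ := by rw [norm_smul, Real.norm_of_nonneg ht.1]
      refine hcx _ ?_ ?_ ?_
      · rw [e, en]
        positivity
      · rw [e, en]
        exact (mul_le_of_le_one_left z1.le ht.2).trans_lt (z2.trans_le (min_le_left _ _))
      · rw [e, en, real_inner_smul_left]
        nlinarith
  set A : Set E3 := (fun p : E3 × ℝ ↦ x + p.2 • p.1) '' (B ×ˢ Set.Icc (0 : ℝ) 1) with hA
  have hAc : IsCompact A := ((isCompact_closedBall _ _).prod isCompact_Icc).image (by fun_prop)
  have hAD : A ⊆ D := by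
    rintro _ ⟨⟨z, t⟩, ⟨hz, ht⟩, rfl⟩
    exact hseg z hz t ht
  have hVB : volume B = V := by
    rw [hB, hV, Measure.addHaar_closedBall_center]
  -- The estimate is proved for the mollifications at x, with a right side free of k, and passes to
  -- the limit at almost every x.
  refine le_of_tendsto (((ENNReal.continuous_pow 2).tendsto _).comp hx.enorm) ?_
  filter_upwards [eventually_closedBall_subset hD hAc hAD] with k hk
  have hmem : ∀ z ∈ B, ∀ t ∈ Set.Icc (0 : ℝ) 1,
      Metric.closedBall (x + t • z) (bump k).rOut ⊆ D := fun z hz t ht ↦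
    hk _ ⟨(z, t), ⟨hz, ht⟩, rfl⟩
  have hc1 : ∀ {p : E3 → F}, IntegrableOn p D → ContDiff ℝ 1 (moll (bump k) D p) := fun hp ↦
    (contDiff_moll _ hDm hp).of_le (by simp)
  have hmain := enorm_sq_mul_volume_le (x := x) (hc1 hf) (fun i ↦ hc1 (hf₁ i))
    (fun i j ↦ (hc1 (hf₂ i j)).continuous) (B := B) Metric.isClosed_closedBall.measurableSet
    (fun z hz ↦ (hBn z hz).2.1.le.trans (min_le_right _ _))
    (fun z hz t ht i ↦ fderiv_moll_apply _ hDm hf (h₁ i) (hmem z hz t ht))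
    (fun z hz t ht i j ↦ fderiv_moll_apply _ hDm (hf₁ i) (h₂ i j) (hmem z hz t ht))
  rw [hVB] at hmain
  have hjet : ∫⁻ y, ENNReal.ofReal (jetSq (moll (bump k) D f) (fun i ↦ moll (bump k) D (f₁ i))
      (fun i j ↦ moll (bump k) D (f₂ i j)) y) ≤ (∫⁻ y in D, ‖f y‖ₑ ^ 2)
        + (∑ i, ∫⁻ y in D, ‖f₁ i y‖ₑ ^ 2) + ∑ i, ∑ j, ∫⁻ y in D, ‖f₂ i j y‖ₑ ^ 2 := by
    have e : ∀ a : F, ENNReal.ofReal (‖a‖ ^ 2) = ‖a‖ₑ ^ 2 := fun a ↦ by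
      rw [ENNReal.ofReal_pow (norm_nonneg _), ofReal_norm]
    have e0 : ∀ y, ENNReal.ofReal (jetSq (moll (bump k) D f) (fun i ↦ moll (bump k) D (f₁ i))
      (fun i j ↦ moll (bump k) D (f₂ i j)) y) = ‖moll (bump k) D f y‖ₑ ^ 2
        + ∑ i, ‖moll (bump k) D (f₁ i) y‖ₑ ^ 2
        + ∑ i, ∑ j, ‖moll (bump k) D (f₂ i j) y‖ₑ ^ 2 := by
      intro y
      unfold jetSq
      rw [ENNReal.ofReal_add (by positivity) (by positivity), ENNReal.ofReal_add (by positivity)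
        (by positivity), ENNReal.ofReal_sum_of_nonneg (fun _ _ ↦ by positivity),
        ENNReal.ofReal_sum_of_nonneg (fun _ _ ↦ by positivity)]
      simp_rw [ENNReal.ofReal_sum_of_nonneg (fun _ _ ↦ sq_nonneg _), e]
    simp_rw [e0]
    rw [lintegral_jetSq (hc1 hf).continuous.aestronglyMeasurable
      (fun i ↦ (hc1 (hf₁ i)).continuous.aestronglyMeasurable)
      (fun i j ↦ (hc1 (hf₂ i j)).continuous.aestronglyMeasurable)]
    have m0 := lintegral_moll_sq_le (bump k) hf.aestronglyMeasurable
    have m1 := fun i ↦ lintegral_moll_sq_le (bump k) (hf₁ i).aestronglyMeasurable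
    have m2 := fun i j ↦ lintegral_moll_sq_le (bump k) (hf₂ i j).aestronglyMeasurable
    exact add_le_add (add_le_add m0 (Finset.sum_le_sum fun i _ ↦ m1 i))
      (Finset.sum_le_sum fun i _ ↦ Finset.sum_le_sum fun j _ ↦ m2 i j)
  rw [Function.comp_apply]
  calc ‖moll (bump k) D f x‖ₑ ^ 2 = ‖moll (bump k) D f x‖ₑ ^ 2 * V / V := by
        rw [ENNReal.mul_div_cancel_right hV0 hVt]
    _ ≤ 1728 * ((∫⁻ y in D, ‖f y‖ₑ ^ 2)
        + (∑ i, ∫⁻ y in D, ‖f₁ i y‖ₑ ^ 2) + ∑ i, ∑ j, ∫⁻ y in D, ‖f₂ i j y‖ₑ ^ 2) / V := by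
        exact ENNReal.div_le_div_right (hmain.trans (mul_le_mul' le_rfl hjet)) V
    _ = _ := (ENNReal.mul_div_right_comm).symm ▸ rfl

end sobolev

/-! ### The cross product -/

lemma cross_apply_zero (a b : E3) : cross a b 0 = a 1 * b 2 - a 2 * b 1 := by
  simp [cross, crossProduct]

lemma cross_apply_one (a b : E3) : cross a b 1 = a 2 * b 0 - a 0 * b 2 := by
  simp [cross, crossProduct]

lemma cross_apply_two (a b : E3) : cross a b 2 = a 0 * b 1 - a 1 * b 0 := by
  simp [cross, crossProduct]

lemma E3_ext {a b : E3} (h0 : a 0 = b 0) (h1 : a 1 = b 1) (h2 : a 2 = b 2) : a = b := by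
  ext i
  fin_cases i <;> assumption

lemma E3_inner (a b : E3) : inner ℝ a b = a 0 * b 0 + a 1 * b 1 + a 2 * b 2 := by
  simp [PiLp.inner_apply, Fin.sum_univ_three, mul_comm]

lemma cross_add_left (a b c : E3) : cross (a + b) c = cross a c + cross b c := by
  apply E3_ext <;> simp only [cross_apply_zero, cross_apply_one, cross_apply_two, PiLp.add_apply] <;>
    ring

lemma cross_add_right (a b c : E3) : cross a (b + c) = cross a b + cross a c := by
  apply E3_ext <;> simp only [cross_apply_zero, cross_apply_one, cross_apply_two, PiLp.add_apply] <;>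
    ring

lemma cross_smul_left (r : ℝ) (a b : E3) : cross (r • a) b = r • cross a b := by
  apply E3_ext <;> simp only [cross_apply_zero, cross_apply_one, cross_apply_two, PiLp.smul_apply,
    smul_eq_mul] <;> ring

lemma cross_smul_right (r : ℝ) (a b : E3) : cross a (r • b) = r • cross a b := by
  apply E3_ext <;> simp only [cross_apply_zero, cross_apply_one, cross_apply_two, PiLp.smul_apply,
    smul_eq_mul] <;> ring

lemma inner_cross_left (a b c : E3) : inner ℝ (cross a b) c = - inner ℝ b (cross a c) := by
  simp only [E3_inner, cross_apply_zero, cross_apply_one, cross_apply_two]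
  ring

lemma inner_cross_self_left (a b : E3) : inner ℝ (cross a b) a = 0 := by
  simp only [E3_inner, cross_apply_zero, cross_apply_one, cross_apply_two]
  ring

lemma inner_cross_self_right (a b : E3) : inner ℝ (cross a b) b = 0 := by
  simp only [E3_inner, cross_apply_zero, cross_apply_one, cross_apply_two]
  ring

lemma cross_cross_self (a b : E3) :
    cross a (cross a b) = (inner ℝ b a : ℝ) • a - (inner ℝ a a : ℝ) • b := by
  apply E3_ext <;> simp only [E3_inner, cross_apply_zero, cross_apply_one, cross_apply_two,
    PiLp.smul_apply, PiLp.sub_apply, smul_eq_mul] <;> ring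

lemma norm_cross_le (a b : E3) : ‖cross a b‖ ≤ ‖a‖ * ‖b‖ := by
  refine le_of_sq_le_sq ?_ (by positivity)
  have h : ‖cross a b‖ ^ 2 = ‖a‖ ^ 2 * ‖b‖ ^ 2 - (inner ℝ a b) ^ 2 := by
    simp only [← real_inner_self_eq_norm_sq, E3_inner, cross_apply_zero, cross_apply_one,
      cross_apply_two]
    ring
  rw [mul_pow, h]
  linarith [sq_nonneg (inner ℝ a b : ℝ)]

/-- The cross product as a continuous bilinear map. -/
def crossCLM : E3 →L[ℝ] E3 →L[ℝ] E3 :=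
  LinearMap.mkContinuous₂ (LinearMap.mk₂ ℝ cross cross_add_left cross_smul_left cross_add_right
    cross_smul_right) 1 (fun a b ↦ by simpa using norm_cross_le a b)

lemma crossCLM_apply (a b : E3) : crossCLM a b = cross a b := rfl

lemma cross_sub_left (a b c : E3) : cross (a - b) c = cross a c - cross b c := by
  simp [← crossCLM_apply]

lemma cross_sub_right (a b c : E3) : cross a (b - c) = cross a b - cross a c := by
  simp [← crossCLM_apply]

lemma cross_eq_sum (a b : E3) :
    cross a b = ∑ j, b j • cross a (EuclideanSpace.single j 1) := by
  apply E3_ext <;> simp [Fin.sum_univ_three, cross_apply_zero, cross_apply_one, cross_apply_two] <;>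
    ring

/-! ### The radial projection on the unit ball -/

/-- The projection on the closed unit ball. -/
def ballProj (u : E3) : E3 := (max 1 ‖u‖)⁻¹ • u

lemma ballProj_of_one_le {u : E3} (hu : 1 ≤ ‖u‖) : ballProj u = ‖u‖⁻¹ • u := by
  rw [ballProj, max_eq_right hu]

lemma ballProj_zero : ballProj 0 = 0 := by simp [ballProj]

lemma norm_ballProj_le (u : E3) : ‖ballProj u‖ ≤ 1 := by
  rw [ballProj, norm_smul, norm_inv, Real.norm_of_nonneg (by positivity), inv_mul_le_iff₀
    (by positivity), mul_one]
  exact le_max_right _ _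

/-- The variational inequality of the projection onto a convex set. Adding it for two points yields
the Lipschitz constant 1. -/
lemma inner_sub_ballProj_le (u : E3) {w : E3} (hw : ‖w‖ ≤ 1) :
    inner ℝ (u - ballProj u) (w - ballProj u) ≤ 0 := by
  rcases le_total ‖u‖ 1 with h | h
  · simp [ballProj, max_eq_left h]
  · have h0 : 0 < ‖u‖ := one_pos.trans_le h
    have hn : ‖ballProj u‖ = 1 := by
      rw [ballProj_of_one_le h, norm_smul, norm_inv, norm_norm, inv_mul_cancel₀ h0.ne']
    have hu : u - ballProj u = (‖u‖ - 1) • ballProj u := by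
      rw [sub_smul, one_smul, ballProj_of_one_le h, smul_smul, mul_inv_cancel₀ h0.ne', one_smul]
    rw [hu, real_inner_smul_left, inner_sub_right, real_inner_self_eq_norm_sq, hn]
    have := real_inner_le_norm (ballProj u) w
    rw [hn, one_mul] at this
    exact mul_nonpos_of_nonneg_of_nonpos (by linarith) (by linarith)

lemma lipschitzWith_ballProj : LipschitzWith 1 ballProj := by
  refine LipschitzWith.of_dist_le_mul fun u v ↦ ?_
  rw [NNReal.coe_one, one_mul, dist_eq_norm, dist_eq_norm]
  have h1 := inner_sub_ballProj_le u (norm_ballProj_le v)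
  have h2 := inner_sub_ballProj_le v (norm_ballProj_le u)
  set a := ballProj u
  set b := ballProj v
  have h3 : inner ℝ (a - b) (a - b) ≤ (inner ℝ (u - v) (a - b) : ℝ) := by
    have e : (inner ℝ (u - v) (a - b) : ℝ) - inner ℝ (a - b) (a - b)
        = - inner ℝ (u - a) (b - a) - inner ℝ (v - b) (a - b) := by
      simp only [inner_sub_left, inner_sub_right]
      ring
    linarith
  rw [real_inner_self_eq_norm_sq] at h3
  have h4 := real_inner_le_norm (u - v) (a - b)
  rcases (norm_nonneg (a - b)).eq_or_lt with h0 | h0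
  · rw [← h0]
    exact norm_nonneg _
  · nlinarith

/-! ### Pointwise cross products in `L²` -/

/-- `f` is bounded by `c` almost everywhere on `D`. -/
def EssBdd (D : Set E3) (c : ℝ) (f : E3 → E3) : Prop := ∀ᵐ x ∂(volume.restrict D), ‖f x‖ ≤ c

/-- The pointwise cross product of two elements of `L²(D)³`, if it is again in `L²(D)³`. -/
def crossL {D : Set E3} (f g : L2 D) : L2 D :=
  open Classical in
  if h : MemLp (fun x ↦ cross (f x) (g x)) 2 (volume.restrict D) then h.toLp else 0

section crossL

variable {D : Set E3} {c : ℝ} {m f g : L2 D}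

lemma aestronglyMeasurable_cross (f g : L2 D) :
    AEStronglyMeasurable (fun x ↦ cross (f x) (g x)) (volume.restrict D) :=
  crossCLM.aestronglyMeasurable_comp₂ (Lp.aestronglyMeasurable f) (Lp.aestronglyMeasurable g)

lemma norm_cross_ae_le_left (hm : EssBdd D c m) (f : L2 D) :
    ∀ᵐ x ∂(volume.restrict D), ‖cross (m x) (f x)‖ ≤ c * ‖f x‖ := by
  filter_upwards [hm] with x hx
  exact (norm_cross_le _ _).trans (by gcongr)

lemma norm_cross_ae_le_right (hm : EssBdd D c m) (f : L2 D) :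
    ∀ᵐ x ∂(volume.restrict D), ‖cross (f x) (m x)‖ ≤ c * ‖f x‖ := by
  filter_upwards [hm] with x hx
  refine (norm_cross_le _ _).trans ?_
  rw [mul_comm]
  gcongr

lemma coeFn_crossL_left (hm : EssBdd D c m) (f : L2 D) :
    crossL m f =ᵐ[volume.restrict D] fun x ↦ cross (m x) (f x) := by
  have h : MemLp (fun x ↦ cross (m x) (f x)) 2 (volume.restrict D) :=
    (Lp.memLp f).of_le_mul (aestronglyMeasurable_cross m f) (norm_cross_ae_le_left hm f)
  rw [crossL, dif_pos h]
  exact h.coeFn_toLp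

lemma coeFn_crossL_right (hm : EssBdd D c m) (f : L2 D) :
    crossL f m =ᵐ[volume.restrict D] fun x ↦ cross (f x) (m x) := by
  have h : MemLp (fun x ↦ cross (f x) (m x)) 2 (volume.restrict D) :=
    (Lp.memLp f).of_le_mul (aestronglyMeasurable_cross f m) (norm_cross_ae_le_right hm f)
  rw [crossL, dif_pos h]
  exact h.coeFn_toLp

lemma norm_crossL_le_left (hm : EssBdd D c m) (f : L2 D) : ‖crossL m f‖ ≤ c * ‖f‖ := by
  refine Lp.norm_le_mul_norm_of_ae_le_mul ?_
  filter_upwards [norm_cross_ae_le_left hm f, coeFn_crossL_left hm f] with x h1 h2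
  rwa [h2]

lemma norm_crossL_le_right (hm : EssBdd D c m) (f : L2 D) : ‖crossL f m‖ ≤ c * ‖f‖ := by
  refine Lp.norm_le_mul_norm_of_ae_le_mul ?_
  filter_upwards [norm_cross_ae_le_right hm f, coeFn_crossL_right hm f] with x h1 h2
  rwa [h2]

lemma crossL_sub_right (hm : EssBdd D c m) (f g : L2 D) :
    crossL m (f - g) = crossL m f - crossL m g := by
  refine Lp.ext ?_
  filter_upwards [coeFn_crossL_left hm (f - g), coeFn_crossL_left hm f, coeFn_crossL_left hm g,
    Lp.coeFn_sub f g, Lp.coeFn_sub (crossL m f) (crossL m g)] with x h1 h2 h3 h4 h5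
  rw [h1, h5, h4, Pi.sub_apply, Pi.sub_apply, h2, h3, cross_sub_right]

lemma crossL_add_right (hm : EssBdd D c m) (f g : L2 D) :
    crossL m (f + g) = crossL m f + crossL m g := by
  refine Lp.ext ?_
  filter_upwards [coeFn_crossL_left hm (f + g), coeFn_crossL_left hm f, coeFn_crossL_left hm g,
    Lp.coeFn_add f g, Lp.coeFn_add (crossL m f) (crossL m g)] with x h1 h2 h3 h4 h5
  rw [h1, h5, h4, Pi.add_apply, Pi.add_apply, h2, h3, cross_add_right]

lemma crossL_smul_right (hm : EssBdd D c m) (r : ℝ) (f : L2 D) :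
    crossL m (r • f) = r • crossL m f := by
  refine Lp.ext ?_
  filter_upwards [coeFn_crossL_left hm (r • f), coeFn_crossL_left hm f,
    Lp.coeFn_smul r f, Lp.coeFn_smul r (crossL m f)] with x h1 h2 h3 h4
  rw [h1, h4, h3, Pi.smul_apply, Pi.smul_apply, h2, cross_smul_right]

lemma crossL_sub_left (hm : EssBdd D c m) (f g : L2 D) :
    crossL (f - g) m = crossL f m - crossL g m := by
  refine Lp.ext ?_
  filter_upwards [coeFn_crossL_right hm (f - g), coeFn_crossL_right hm f, coeFn_crossL_right hm g,
    Lp.coeFn_sub f g, Lp.coeFn_sub (crossL f m) (crossL g m)] with x h1 h2 h3 h4 h5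
  rw [h1, h5, h4, Pi.sub_apply, Pi.sub_apply, h2, h3, cross_sub_left]

lemma inner_crossL_left (hm : EssBdd D c m) (f g : L2 D) :
    inner ℝ (crossL m f) g = - inner ℝ f (crossL m g) := by
  rw [L2.inner_def, L2.inner_def, ← integral_neg]
  refine integral_congr_ae ?_
  filter_upwards [coeFn_crossL_left hm f, coeFn_crossL_left hm g] with x h1 h2
  rw [h1, h2, inner_cross_left]

lemma inner_crossL_self (hm : EssBdd D c m) (f : L2 D) : inner ℝ (crossL m f) f = (0 : ℝ) := by
  rw [L2.inner_def, integral_eq_zero_of_ae]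
  filter_upwards [coeFn_crossL_left hm f] with x h1
  rw [h1, inner_cross_self_right]
  rfl

lemma inner_crossL_self_left (hm : EssBdd D c m) (f : L2 D) : inner ℝ f (crossL f m) = (0 : ℝ) := by
  rw [L2.inner_def, integral_eq_zero_of_ae]
  filter_upwards [coeFn_crossL_right hm f] with x h1
  rw [h1, real_inner_comm, inner_cross_self_left]
  rfl

end crossL

/-! ### Weak gradients -/

section grad

variable {D : Set E3} [IsFiniteMeasure (volume.restrict D)]

lemma hasWeakPartial_iff_inner {i : Fin 3} {f g : L2 D} :
    HasWeakPartial D i f g ↔ ∀ φ : E3 → ℝ, IsTest D φ → ∀ a : E3,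
      inner ℝ (testVec D (fun x ↦ fderiv ℝ φ x (EuclideanSpace.single i 1)) a) f
        + inner ℝ (testVec D φ a) g = 0 := by
  have h : HasWeakPartial D i f g ↔ WeakDeriv D (EuclideanSpace.single i 1) f g :=
    ⟨fun h φ hφ ↦ h φ hφ.1 hφ.2 hφ.3, fun h φ h1 h2 h3 ↦ h φ ⟨h1, h2, h3⟩⟩
  rw [h, weakDeriv_iff_inner]
  simp_rw [eq_neg_iff_add_eq_zero]

lemma hasWeakPartial_iff {D : Set E3} {i : Fin 3} {f g : L2 D} :
    HasWeakPartial D i f g ↔ WeakDeriv D (EuclideanSpace.single i 1) f g :=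
  ⟨fun h φ hφ ↦ h φ hφ.1 hφ.2 hφ.3, fun h φ h1 h2 h3 ↦ h φ ⟨h1, h2, h3⟩⟩

lemma HasWeakPartial.add {i : Fin 3} {f g f' g' : L2 D} (h : HasWeakPartial D i f g)
    (h' : HasWeakPartial D i f' g') : HasWeakPartial D i (f + f') (g + g') := by
  rw [hasWeakPartial_iff_inner] at *
  intro φ hφ a
  rw [inner_add_right, inner_add_right]
  linear_combination h φ hφ a + h' φ hφ a

lemma HasWeakPartial.smul {i : Fin 3} {f g : L2 D} (r : ℝ) (h : HasWeakPartial D i f g) :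
    HasWeakPartial D i (r • f) (r • g) := by
  rw [hasWeakPartial_iff_inner] at *
  intro φ hφ a
  rw [real_inner_smul_right, real_inner_smul_right]
  linear_combination r * h φ hφ a

lemma HasWeakPartial.sub {i : Fin 3} {f g f' g' : L2 D} (h : HasWeakPartial D i f g)
    (h' : HasWeakPartial D i f' g') : HasWeakPartial D i (f - f') (g - g') := by
  rw [sub_eq_add_neg, sub_eq_add_neg, ← neg_one_smul ℝ f', ← neg_one_smul ℝ g']
  exact h.add (h'.smul (-1))

lemma HasWeakPartial.zero (i : Fin 3) : HasWeakPartial D i (0 : L2 D) 0 := by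
  rw [hasWeakPartial_iff_inner]
  simp

/-- Since `weakPartial` is obtained by choice, uniqueness is what makes it computable and linear on
H¹. -/
lemma HasWeakPartial.unique (hD : IsOpen D) {i : Fin 3} {f g g' : L2 D}
    (h : HasWeakPartial D i f g) (h' : HasWeakPartial D i f g') : g = g' := by
  rw [← sub_eq_zero]
  have h0 := h.sub h'
  rw [sub_self, hasWeakPartial_iff] at h0
  have hae : ∀ᵐ x ∂(volume : Measure E3), x ∈ D → (g - g' : L2 D) x = 0 := by
    refine hD.ae_eq_zero_of_integral_contDiff_smul_eq_zero
      (integrableOn_L2 (g - g')).locallyIntegrableOn fun φ h1 h2 h3 ↦ ?_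
    have h4 := h0 φ ⟨h1, h2, h3⟩
    have h5 : ∫ x in D, fderiv ℝ φ x (EuclideanSpace.single i 1) • (0 : L2 D) x = 0 := by
      refine integral_eq_zero_of_ae ?_
      filter_upwards [Lp.coeFn_zero E3 2 (volume.restrict D)] with x hx
      rw [hx]
      exact smul_zero _
    rw [h5, eq_comm, neg_eq_zero] at h4
    rw [← h4, setIntegral_eq_integral_of_forall_compl_eq_zero fun x hx ↦ ?_]
    rw [image_eq_zero_of_notMem_tsupport fun hx' ↦ hx (h3 hx'), zero_smul]
  refine Lp.ext ?_
  rw [EventuallyEq]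
  filter_upwards [(ae_restrict_iff' hD.measurableSet).2 hae,
    Lp.coeFn_zero E3 2 (volume.restrict D)] with x hx h0
  rw [hx, h0]
  rfl

lemma MemH1.hasWeakPartial {D : Set E3} {f : L2 D} (h : MemH1 D f) (i : Fin 3) :
    HasWeakPartial D i f (weakPartial D i f) := by
  rw [weakPartial, dif_pos (h i)]
  exact (h i).choose_spec

lemma HasWeakPartial.weakPartial_eq (hD : IsOpen D) {i : Fin 3} {f g : L2 D}
    (h : HasWeakPartial D i f g) : weakPartial D i f = g := by
  have h' : ∃ g : L2 D, HasWeakPartial D i f g := ⟨g, h⟩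
  rw [weakPartial, dif_pos h']
  exact h'.choose_spec.unique hD h

lemma gradSq_of_memH1 {D : Set E3} {f : L2 D} (h : MemH1 D f) :
    gradSq D f = ∑ i : Fin 3, ‖weakPartial D i f‖ₑ ^ 2 := if_pos h

lemma MemH1.gradSq_ne_top {D : Set E3} {f : L2 D} (h : MemH1 D f) : gradSq D f ≠ ⊤ := by
  rw [gradSq_of_memH1 h]
  exact ENNReal.sum_ne_top.2 fun i _ ↦ ENNReal.pow_ne_top enorm_ne_top

end grad

lemma normSq_eq {D : Set E3} (f : L2 D) : normSq D f = ‖f‖ₑ ^ 2 := (L2_enorm_sq f).symm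

/-- The Sobolev embedding for elements of `H²(D)³`. -/
lemma exists_essBdd_h2 {D : Set E3} (hD : IsOpen D) (hb : Bornology.IsBounded D)
    (hcone : ConeCondition D) : ∃ C : ℝ≥0, ∀ f : L2 D, MemH2 D f →
      EssBdd D (Real.sqrt (C * (h2Sq D f).toReal)) f := by
  have := isFiniteMeasure_restrict hb
  obtain ⟨C, hC⟩ := exists_sobolev (F := E3) hD hcone
  refine ⟨C, fun f hf ↦ ?_⟩
  have h1 := hC f (fun i ↦ weakPartial D i f) (fun i j ↦ weakPartial D j (weakPartial D i f))
    (integrableOn_L2 _) (fun i ↦ integrableOn_L2 _) (fun i j ↦ integrableOn_L2 _)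
    (fun i ↦ hasWeakPartial_iff.1 (hf.1.hasWeakPartial i))
    (fun i j ↦ hasWeakPartial_iff.1 ((hf.2 i).hasWeakPartial j))
  have h2 : h2Sq D f = (∫⁻ y in D, ‖f y‖ₑ ^ 2)
      + (∑ i, ∫⁻ y in D, ‖weakPartial D i f y‖ₑ ^ 2)
      + ∑ i, ∑ j, ∫⁻ y in D, ‖weakPartial D j (weakPartial D i f) y‖ₑ ^ 2 := by
    simp_rw [h2Sq, gradSq_of_memH1 hf.1, fun i ↦ gradSq_of_memH1 (hf.2 i), L2_enorm_sq]
  have hfin : h2Sq D f ≠ ⊤ := by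
    simp only [h2Sq, ne_eq, ENNReal.add_eq_top, not_or]
    exact ⟨⟨ENNReal.pow_ne_top enorm_ne_top, hf.1.gradSq_ne_top⟩,
      ENNReal.sum_ne_top.2 fun i _ ↦ (hf.2 i).gradSq_ne_top⟩
  filter_upwards [h1] with x hx
  rw [← h2] at hx
  refine Real.le_sqrt_of_sq_le ?_
  have h3 := ENNReal.toReal_mono (ENNReal.mul_ne_top ENNReal.coe_ne_top hfin) hx
  simpa using h3

/-! ### Weak gradients of products and projections -/

lemma WeakDeriv.congr {F : Type*} [NormedAddCommGroup F] [NormedSpace ℝ F] {D : Set E3} {e : E3}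
    {f g f' g' : E3 → F} (h : WeakDeriv D e f g) (hf : f =ᵐ[volume.restrict D] f')
    (hg : g =ᵐ[volume.restrict D] g') : WeakDeriv D e f' g' := by
  intro φ hφ
  have e1 : ∫ x in D, fderiv ℝ φ x e • f' x = ∫ x in D, fderiv ℝ φ x e • f x :=
    integral_congr_ae (hf.mono fun x hx ↦ by simp only [hx])
  have e2 : ∫ x in D, φ x • g' x = ∫ x in D, φ x • g x :=
    integral_congr_ae (hg.mono fun x hx ↦ by simp only [hx])
  rw [e1, e2, h φ hφ]

lemma WeakDeriv.clm {F G : Type*} [NormedAddCommGroup F] [NormedSpace ℝ F] [CompleteSpace F]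
    [NormedAddCommGroup G] [NormedSpace ℝ G] [CompleteSpace G] {D : Set E3} {e : E3}
    {f g : E3 → F} (hf : IntegrableOn f D) (hg : IntegrableOn g D) (h : WeakDeriv D e f g)
    (L : F →L[ℝ] G) : WeakDeriv D e (fun x ↦ L (f x)) (fun x ↦ L (g x)) := by
  intro φ hφ
  simp_rw [← map_smul L]
  rw [L.integral_comp_comm (integrableOn_smul hf (hφ.continuous_fderiv e) (hφ.compact_fderiv e)),
    L.integral_comp_comm (integrableOn_smul hg hφ.continuous hφ.compact), h φ hφ, map_neg]

lemma WeakDeriv.sum {F : Type*} [NormedAddCommGroup F] [NormedSpace ℝ F] {D : Set E3} {e : E3}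
    {ι : Type*}
    (s : Finset ι) {f g : ι → E3 → F} (hf : ∀ i, IntegrableOn (f i) D)
    (hg : ∀ i, IntegrableOn (g i) D) (h : ∀ i, WeakDeriv D e (f i) (g i)) :
    WeakDeriv D e (fun x ↦ ∑ i ∈ s, f i x) (fun x ↦ ∑ i ∈ s, g i x) := by
  intro φ hφ
  simp_rw [Finset.smul_sum]
  rw [integral_finsetSum _ fun i _ ↦ integrableOn_smul (hf i) (hφ.continuous_fderiv e)
      (hφ.compact_fderiv e),
    integral_finsetSum _ fun i _ ↦ integrableOn_smul (hg i) hφ.continuous hφ.compact,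
    ← Finset.sum_neg_distrib]
  exact Finset.sum_congr rfl fun i _ ↦ h i φ hφ

section grad

variable {D : Set E3} [IsFiniteMeasure (volume.restrict D)]

/-- The product rule for the cross product of bounded functions. -/
lemma HasWeakPartial.crossL (hD : IsOpen D) {i : Fin 3} {m m' f f' : L2 D} {c : ℝ} (hc : 0 ≤ c)
    (hm : EssBdd D c m) (hf : EssBdd D c f) (h : HasWeakPartial D i m m')
    (h' : HasWeakPartial D i f f') :
    HasWeakPartial D i (crossL m f) (SLLG.crossL m' f + SLLG.crossL m f') := by
  rw [hasWeakPartial_iff] at *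
  -- Writing m × f = ∑ fⱼ (m × eⱼ) reduces the claim to the product rule for a scalar times a
  -- vector.
  let L : Fin 3 → E3 →L[ℝ] E3 := fun j ↦ crossCLM.flip (EuclideanSpace.single j 1)
  let p : Fin 3 → E3 →L[ℝ] ℝ := fun j ↦ EuclideanSpace.proj j
  have hL : ∀ j a, ‖L j a‖ ≤ ‖a‖ := fun j a ↦ by
    refine (norm_cross_le _ _).trans ?_
    simp
  have hp : ∀ j a, ‖p j a‖ ≤ ‖a‖ := fun j a ↦ PiLp.norm_apply_le a j
  have hi := fun g : L2 D ↦ integrableOn_L2 g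
  have key : ∀ j, WeakDeriv D (EuclideanSpace.single i 1) (fun x ↦ p j (f x) • L j (m x))
      (fun x ↦ p j (f' x) • L j (m x) + p j (f x) • L j (m' x)) := fun j ↦ by
    refine WeakDeriv.smul hD ((p j).integrable_comp (hi f)) ((p j).integrable_comp (hi f'))
      ((L j).integrable_comp (hi m)) ((L j).integrable_comp (hi m')) hc ?_ ?_
      (h'.clm (hi f) (hi f') (p j)) (h.clm (hi m) (hi m') (L j))
    · filter_upwards [hf] with x hx using (hp j _).trans hx
    · filter_upwards [hm] with x hx using (hL j _).trans hx
  have b1 : ∀ g : L2 D, ∀ j, IntegrableOn (fun x ↦ p j (g x) • L j (m x)) D := fun g j ↦ by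
    refine Integrable.smul_bdd ((p j).integrable_comp (hi g)) c
      ((L j).integrable_comp (hi m)).aestronglyMeasurable ?_
    filter_upwards [hm] with x hx using (hL j _).trans hx
  have b2 : ∀ j, IntegrableOn (fun x ↦ p j (f x) • L j (m' x)) D := fun j ↦ by
    refine Integrable.bdd_smul ((L j).integrable_comp (hi m')) c
      ((p j).integrable_comp (hi f)).aestronglyMeasurable ?_
    filter_upwards [hf] with x hx using (hp j _).trans hx
  refine (WeakDeriv.sum Finset.univ (b1 f) (fun j ↦ (b1 f' j).add (b2 j)) key).congr ?_ ?_
  · filter_upwards [coeFn_crossL_left hm f] with x hx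
    rw [hx, cross_eq_sum]
    rfl
  · filter_upwards [coeFn_crossL_left hm f', coeFn_crossL_right hf m',
      Lp.coeFn_add (SLLG.crossL m' f) (SLLG.crossL m f')] with x h1 h2 h3
    rw [h3, Pi.add_apply, h1, h2, cross_eq_sum, cross_eq_sum (m x), add_comm,
      ← Finset.sum_add_distrib]
    rfl

/-- The squared `L²` norm of the gradient as a real number. -/
def gradReal (D : Set E3) (f : L2 D) : ℝ := ∑ i : Fin 3, ‖weakPartial D i f‖ ^ 2

lemma gradReal_nonneg {D : Set E3} (f : L2 D) : 0 ≤ gradReal D f :=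
  Finset.sum_nonneg fun _ _ ↦ by positivity

lemma gradSq_eq_ofReal {D : Set E3} {f : L2 D} (hf : MemH1 D f) :
    gradSq D f = ENNReal.ofReal (gradReal D f) := by
  rw [gradSq_of_memH1 hf, gradReal, ENNReal.ofReal_sum_of_nonneg fun _ _ ↦ by positivity]
  simp_rw [ENNReal.ofReal_pow (norm_nonneg _), ofReal_norm]

lemma gradInner_self {D : Set E3} (f : L2 D) : gradInner D f f = gradReal D f := by
  simp [gradInner, gradReal]

lemma MemH1.add {f g : L2 D} (hf : MemH1 D f) (hg : MemH1 D g) : MemH1 D (f + g) := fun i ↦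
  ⟨_, (hf.hasWeakPartial i).add (hg.hasWeakPartial i)⟩

lemma MemH1.sub {f g : L2 D} (hf : MemH1 D f) (hg : MemH1 D g) : MemH1 D (f - g) := fun i ↦
  ⟨_, (hf.hasWeakPartial i).sub (hg.hasWeakPartial i)⟩

lemma gradInner_sub_right (hD : IsOpen D) {f g h : L2 D} (hg : MemH1 D g) (hh : MemH1 D h) :
    gradInner D f (g - h) = gradInner D f g - gradInner D f h := by
  simp_rw [gradInner, ← Finset.sum_sub_distrib, ← inner_sub_right]
  refine Finset.sum_congr rfl fun i _ ↦ ?_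
  rw [((hg.hasWeakPartial i).sub (hh.hasWeakPartial i)).weakPartial_eq hD]

lemma gradReal_add (hD : IsOpen D) {f g : L2 D} (hf : MemH1 D f) (hg : MemH1 D g) :
    gradReal D (f + g) = gradReal D f + 2 * gradInner D f g + gradReal D g := by
  simp_rw [gradReal, gradInner, Finset.mul_sum, ← Finset.sum_add_distrib]
  refine Finset.sum_congr rfl fun i _ ↦ ?_
  rw [((hf.hasWeakPartial i).add (hg.hasWeakPartial i)).weakPartial_eq hD, norm_add_sq_real]

/-- Young's inequality, from the square of ε∂f − θ∂g divided by ε. -/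
lemma gradInner_le {D : Set E3} (f g : L2 D) {ε : ℝ} (hε : 0 < ε) (θ : ℝ) :
    2 * θ * gradInner D f g ≤ ε * gradReal D f + θ ^ 2 / ε * gradReal D g := by
  simp_rw [gradReal, gradInner, Finset.mul_sum, ← Finset.sum_add_distrib]
  refine Finset.sum_le_sum fun i _ ↦ ?_
  set a := weakPartial D i f
  set b := weakPartial D i g
  have h1 : 0 ≤ ‖ε • a - θ • b‖ ^ 2 := by positivity
  rw [norm_sub_sq_real, real_inner_smul_left, real_inner_smul_right, norm_smul, norm_smul, mul_pow,
    mul_pow, Real.norm_eq_abs, Real.norm_eq_abs, sq_abs, sq_abs] at h1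
  have h2 : ε * ‖a‖ ^ 2 + θ ^ 2 / ε * ‖b‖ ^ 2 - 2 * θ * inner ℝ a b
      = (ε ^ 2 * ‖a‖ ^ 2 - 2 * (ε * (θ * inner ℝ a b)) + θ ^ 2 * ‖b‖ ^ 2) / ε := by
    field_simp
    ring
  have h3 := div_nonneg h1 hε.le
  linarith

lemma memH1_ballProj (hD : IsOpen D) (hb : Bornology.IsBounded D) {u u' : L2 D} (hu : MemH1 D u)
    (h : u' =ᵐ[volume.restrict D] fun x ↦ ballProj (u x)) :
    MemH1 D u' ∧ gradReal D u' ≤ gradReal D u := by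
  have key : ∀ i, ∃ g : L2 D, ‖g‖ ≤ ‖weakPartial D i u‖ ∧ HasWeakPartial D i u' g := fun i ↦ by
    obtain ⟨g, h1, h2⟩ := exists_weakDeriv_lipschitz hD hb lipschitzWith_ballProj h
      (hasWeakPartial_iff.1 (hu.hasWeakPartial i))
    exact ⟨g, h1, hasWeakPartial_iff.2 h2⟩
  refine ⟨fun i ↦ ?_, Finset.sum_le_sum fun i _ ↦ ?_⟩
  · obtain ⟨g, -, hg⟩ := key i
    exact ⟨g, hg⟩
  · obtain ⟨g, hg, hg'⟩ := key i
    rw [hg'.weakPartial_eq hD]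
    gcongr

end grad

/-! ### The energy inequality of one step -/

/-- The Itô correction `(Id - m ×)((m × g) × g)`. -/
def noiseCorr {D : Set E3} (m g : L2 D) : L2 D :=
  crossL (crossL m g) g - crossL m (crossL (crossL m g) g)

section step

variable {D : Set E3} {m : L2 D}

lemma essBdd_of_norm_eq_one (hm : ∀ᵐ x ∂(volume.restrict D), ‖m x‖ = 1) : EssBdd D 1 m :=
  hm.mono fun _ hx ↦ hx.le

lemma integral_idSubCross (hm : EssBdd D 1 m) (f φ : L2 D) :
    ∫ x in D, inner ℝ (idSubCross (m x) (f x)) (φ x) = inner ℝ (f - crossL m f) φ := by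
  rw [L2.inner_def]
  refine integral_congr_ae ?_
  filter_upwards [coeFn_crossL_left hm f, Lp.coeFn_sub f (crossL m f)] with x h1 h2
  rw [h2, Pi.sub_apply, h1, idSubCross]

lemma integral_idSubCross_cross (hm : EssBdd D 1 m) (ξ φ : L2 D) :
    ∫ x in D, inner ℝ (idSubCross (m x) (cross (m x) (ξ x))) (φ x)
      = inner ℝ (crossL m ξ - crossL m (crossL m ξ)) φ := by
  rw [← integral_idSubCross hm]
  refine integral_congr_ae ?_
  filter_upwards [coeFn_crossL_left hm ξ] with x h1
  rw [h1]

lemma integral_noiseCorr (hm : EssBdd D 1 m) {c : ℝ} {g : L2 D} (hg : EssBdd D c g) (φ : L2 D) :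
    ∫ x in D, inner ℝ (idSubCross (m x) (cross (cross (m x) (g x)) (g x))) (φ x)
      = inner ℝ (noiseCorr m g) φ := by
  rw [noiseCorr, ← integral_idSubCross hm]
  refine integral_congr_ae ?_
  filter_upwards [coeFn_crossL_left hm g, coeFn_crossL_right hg (crossL m g)] with x h1 h2
  rw [h2, h1]

lemma norm_noiseCorr_le (hm : EssBdd D 1 m) {c : ℝ} (hc : 0 ≤ c) {g : L2 D} (hg : EssBdd D c g) :
    ‖noiseCorr m g‖ ≤ 2 * (c * ‖g‖) := by
  have h1 : ‖crossL m g‖ ≤ ‖g‖ := by simpa using norm_crossL_le_left hm g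
  have h2 := norm_crossL_le_right hg (crossL m g)
  have h3 := norm_crossL_le_left hm (crossL (crossL m g) g)
  have h4 : c * ‖crossL m g‖ ≤ c * ‖g‖ := by gcongr
  refine (norm_sub_le _ _).trans ?_
  linarith

variable [IsFiniteMeasure (volume.restrict D)]

/-- By the product rule ∂(m × ξ) = ∂m × ξ + m × ∂ξ. Paired with ∂m, the first summand drops
pointwise; what remains is linear in ∂ξ and will have mean zero. -/
lemma gradReal_crossL_le (hD : IsOpen D) (hm1 : MemH1 D m) (hm : EssBdd D 1 m) {ξ : L2 D}
    (hξ1 : MemH1 D ξ) {c : ℝ} (hξ : EssBdd D c ξ) :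
    MemH1 D (crossL m ξ) ∧ gradReal D (crossL m ξ) ≤ 2 * (c ^ 2 * gradReal D m + gradReal D ξ) ∧
      gradInner D m (crossL m ξ)
        = ∑ i, inner ℝ (weakPartial D i m) (crossL m (weakPartial D i ξ)) := by
  have h1 : EssBdd D (max 1 c) m := hm.mono fun x hx ↦ hx.trans (le_max_left _ _)
  have h2 : EssBdd D (max 1 c) ξ := hξ.mono fun x hx ↦ hx.trans (le_max_right _ _)
  have key := fun i ↦ HasWeakPartial.crossL hD (by positivity) h1 h2 (hm1.hasWeakPartial i)
    (hξ1.hasWeakPartial i)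
  refine ⟨fun i ↦ ⟨_, key i⟩, ?_, ?_⟩
  · rw [gradReal, gradReal, gradReal, Finset.mul_sum, ← Finset.sum_add_distrib, Finset.mul_sum]
    refine Finset.sum_le_sum fun i _ ↦ ?_
    rw [(key i).weakPartial_eq hD]
    have e1 := norm_crossL_le_right hξ (weakPartial D i m)
    have e2 := norm_crossL_le_left hm (weakPartial D i ξ)
    rw [one_mul] at e2
    have e3 := norm_add_le (crossL (weakPartial D i m) ξ) (crossL m (weakPartial D i ξ))
    calc _ ≤ (c * ‖weakPartial D i m‖ + ‖weakPartial D i ξ‖) ^ 2 := by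
          gcongr
          linarith
      _ ≤ _ := by nlinarith [sq_nonneg (c * ‖weakPartial D i m‖ - ‖weakPartial D i ξ‖)]
  · refine Finset.sum_congr rfl fun i _ ↦ ?_
    rw [(key i).weakPartial_eq hD, inner_add_right, inner_crossL_self_left hξ, zero_add]

/-- The constraint `|m| = 1` gives `|m + v| ≥ 1` for tangential `v`. -/
lemma one_le_norm_add {a b : E3} (ha : ‖a‖ = 1) (hab : inner ℝ b a = (0 : ℝ)) : 1 ≤ ‖a + b‖ := by
  have h : ‖a + b‖ ^ 2 = 1 + ‖b‖ ^ 2 := by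
    rw [norm_add_sq_real, ha, real_inner_comm, hab]
    ring
  nlinarith [norm_nonneg (a + b), norm_nonneg b]

lemma step_renorm (hD : IsOpen D) (hb : Bornology.IsBounded D) {v m' : L2 D} (hm1 : MemH1 D m)
    (hm : ∀ᵐ x ∂(volume.restrict D), ‖m x‖ = 1) (hv : v ∈ tangentSpace D m)
    (hm' : ∀ᵐ x ∂(volume.restrict D), m' x = (‖m x + v x‖⁻¹ : ℝ) • (m x + v x)) :
    (∀ᵐ x ∂(volume.restrict D), m' x = ballProj ((m + v : L2 D) x)) ∧
    (∀ᵐ x ∂(volume.restrict D), ‖m' x‖ = 1) ∧ MemH1 D m' ∧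
      gradReal D m' ≤ gradReal D (m + v) := by
  have h1 : ∀ᵐ x ∂(volume.restrict D), m' x = ballProj ((m + v : L2 D) x) := by
    filter_upwards [hm, hv.2, hm', Lp.coeFn_add m v] with x h1 h2 h3 h4
    rw [h3, h4, Pi.add_apply, ballProj_of_one_le (one_le_norm_add h1 h2)]
  refine ⟨h1, ?_, memH1_ballProj hD hb (hm1.add hv.1) h1⟩
  filter_upwards [hm, hv.2, hm'] with x h1 h2 h3
  have := one_le_norm_add h1 h2
  rw [h3, norm_smul, norm_inv, norm_norm, inv_mul_cancel₀ (by linarith)]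

lemma crossL_mem_tangentSpace (hD : IsOpen D) (hm1 : MemH1 D m) (hm : EssBdd D 1 m) {ξ : L2 D}
    (hξ1 : MemH1 D ξ) {c : ℝ} (hξ : EssBdd D c ξ) :
    crossL m ξ ∈ tangentSpace D m := by
  refine ⟨(gradReal_crossL_le hD hm1 hm hξ1 hξ).1, ?_⟩
  filter_upwards [coeFn_crossL_left hm ξ] with x hx
  rw [hx, inner_cross_self_left]

lemma sub_mem_tangentSpace {v w : L2 D} (hv : v ∈ tangentSpace D m) (hw : w ∈ tangentSpace D m) :
    v - w ∈ tangentSpace D m := by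
  refine ⟨hv.1.sub hw.1, ?_⟩
  filter_upwards [hv.2, hw.2, Lp.coeFn_sub v w] with x h1 h2 h3
  rw [h3, Pi.sub_apply, inner_sub_left, h1, h2, sub_zero]

/-- The pathwise energy inequality. The term linear in ∂ξ is kept exactly, since an absolute
estimate of it would be of order √τ rather than τ; the rest is already of the order wanted. -/
lemma step_energy (hD : IsOpen D) (hb : Bornology.IsBounded D) {θ τ ε : ℝ} (hτ : 0 < τ)
    (hε : 0 < ε) {g : ℕ → L2 D} {ξ v m' : L2 D} (hm1 : MemH1 D m)
    (hm : ∀ᵐ x ∂(volume.restrict D), ‖m x‖ = 1) (hs : IsStep D θ τ g ξ m v)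
    (hm' : ∀ᵐ x ∂(volume.restrict D), m' x = (‖m x + v x‖⁻¹ : ℝ) • (m x + v x))
    (hξ1 : MemH1 D ξ) {c : ℝ} (hξ : EssBdd D c ξ) {b : ℕ → ℝ} (hb0 : ∀ i, 0 ≤ b i)
    (hg : ∀ i, EssBdd D (b i) (g i)) {S : ℝ} (hS : HasSum (fun i ↦ b i * ‖g i‖) S) :
    gradReal D m' + (1 - ε) / τ * ‖v - crossL m ξ‖ ^ 2 + (2 * θ - 1 - ε) * gradReal D v
      ≤ gradReal D m + 2 * ∑ i, inner ℝ (weakPartial D i m) (crossL m (weakPartial D i ξ))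
        + 2 * θ ^ 2 / ε * (c ^ 2 * gradReal D m + gradReal D ξ) + S ^ 2 / (4 * ε) * τ := by
  have hmb := essBdd_of_norm_eq_one hm
  obtain ⟨hA1, hA2, hA3⟩ := gradReal_crossL_le hD hm1 hmb hξ1 hξ
  have hAt := crossL_mem_tangentSpace hD hm1 hmb hξ1 hξ
  set A := crossL m ξ with hA
  set w := v - A with hw
  have hwt : w ∈ tangentSpace D m := sub_mem_tangentSpace hs.mem hAt
  have hproj := (step_renorm hD hb hm1 hm hs.mem hm').2.2.2
  rw [gradReal_add hD hm1 hs.mem.1] at hproj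
  have heq := hs.eq w hwt
  rw [integral_idSubCross hmb, integral_idSubCross_cross hmb, ← hA,
    gradInner_sub_right hD hs.mem.1 hA1, gradInner_sub_right hD hs.mem.1 hA1, gradInner_self] at heq
  simp_rw [fun i ↦ integral_noiseCorr hmb (hg i) w] at heq
  -- The noise term of the equation is (Id − m ×)A, so both sides combine to (Id − m ×)w, whose skew
  -- part is invisible to w.
  have hwin : inner ℝ (v - crossL m v) w - inner ℝ (A - crossL m A) w = ‖w‖ ^ 2 := by
    rw [← inner_sub_left]
    have : v - crossL m v - (A - crossL m A) = w - crossL m w := by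
      rw [hw, crossL_sub_right hmb]
      abel
    rw [this, inner_sub_left, inner_crossL_self hmb, sub_zero, real_inner_self_eq_norm_sq]
  have hR : |∑' i, inner ℝ (noiseCorr m (g i)) w| ≤ 2 * (S * ‖w‖) := by
    have h1 : HasSum (fun i ↦ 2 * (b i * ‖g i‖ * ‖w‖)) (2 * (S * ‖w‖)) :=
      (hS.mul_right ‖w‖).mul_left 2
    refine tsum_of_norm_bounded (f := fun i ↦ (inner ℝ (noiseCorr m (g i)) w : ℝ)) h1 fun i ↦ ?_
    refine (abs_real_inner_le_norm (noiseCorr m (g i)) w).trans ?_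
    have := mul_le_mul_of_nonneg_right (norm_noiseCorr_le hmb (hb0 i) (hg i)) (norm_nonneg w)
    linarith
  set R := ∑' i, inner ℝ (noiseCorr m (g i)) w
  have hR' := (le_abs_self R).trans hR
  have hvA := gradInner_le v A hε θ
  have hkey : 2 * gradInner D m v = 2 * gradInner D m A + R / 2 - ‖w‖ ^ 2 / τ
      - 2 * θ * gradReal D v + 2 * θ * gradInner D v A := by
    field_simp
    linarith
  -- Here S‖w‖ bounds R/2. The weight ε/τ is what the term ‖w‖²/τ can absorb, leaving a remainder of
  -- order τ.
  have hSw : S * ‖w‖ ≤ ε / τ * ‖w‖ ^ 2 + S ^ 2 / (4 * ε) * τ := by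
    have e : ε / τ * ‖w‖ ^ 2 + S ^ 2 / (4 * ε) * τ - S * ‖w‖
        = (2 * ε * ‖w‖ - S * τ) ^ 2 / (4 * ε * τ) := by
      field_simp
      ring
    have : 0 ≤ (2 * ε * ‖w‖ - S * τ) ^ 2 / (4 * ε * τ) := by positivity
    linarith
  have hA2' : θ ^ 2 / ε * gradReal D A
      ≤ 2 * θ ^ 2 / ε * (c ^ 2 * gradReal D m + gradReal D ξ) := by
    have : θ ^ 2 / ε * gradReal D A
        ≤ θ ^ 2 / ε * (2 * (c ^ 2 * gradReal D m + gradReal D ξ)) := by gcongr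
    refine this.trans (le_of_eq ?_)
    ring
  have e1 : (1 - ε) / τ * ‖w‖ ^ 2 = ‖w‖ ^ 2 / τ - ε / τ * ‖w‖ ^ 2 := by ring
  rw [e1, ← hA3]
  linarith

end step

/-! ### The graph of the weak gradient -/

/-- The Hilbert space `L²(D)³ × L²(D)^{3×3}`, the function being the component `none`. -/
abbrev Jet1 (D : Set E3) : Type := PiLp 2 (fun _ : Option (Fin 3) ↦ L2 D)

section

variable {D : Set E3} [IsFiniteMeasure (volume.restrict D)]

variable (D) in
/-- The graph of the weak gradient. -/
def jet1 : Submodule ℝ (Jet1 D) where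
  carrier := {p | ∀ i, HasWeakPartial D i (p none) (p (some i))}
  add_mem' hp hq i := (hp i).add (hq i)
  zero_mem' i := HasWeakPartial.zero i
  smul_mem' r _ hp i := (hp i).smul r

lemma isClosed_hasWeakPartial {α : Type*} [TopologicalSpace α] (i : Fin 3) {f g : α → L2 D}
    (hf : Continuous f) (hg : Continuous g) : IsClosed {a | HasWeakPartial D i (f a) (g a)} := by
  simp_rw [hasWeakPartial_iff_inner, Set.ofPred_forall]
  refine isClosed_iInter fun φ ↦ isClosed_iInter fun _ ↦ isClosed_iInter fun a ↦ ?_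
  exact isClosed_eq ((continuous_const.inner hf).add (continuous_const.inner hg)) continuous_const

lemma isClosed_jet1 : IsClosed (jet1 D : Set (Jet1 D)) := by
  have h : (jet1 D : Set (Jet1 D)) = ⋂ i, {p | HasWeakPartial D i (p none) (p (some i))} := by
    ext p
    rw [Set.mem_iInter]
    rfl
  rw [h]
  exact isClosed_iInter fun i ↦ isClosed_hasWeakPartial i (by fun_prop) (by fun_prop)

instance : CompleteSpace (jet1 D) := isClosed_jet1.completeSpace_coe

/-- The jet of an element of `H¹(D)³`. -/
def toJet1 {D : Set E3} [IsFiniteMeasure (volume.restrict D)] (f : L2 D) (hf : MemH1 D f) :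
    jet1 D :=
  ⟨WithLp.toLp 2 (fun o ↦ o.elim f (fun i ↦ weakPartial D i f)), fun i ↦ hf.hasWeakPartial i⟩

lemma jet1_memH1 (p : jet1 D) : MemH1 D (p.1 none) := fun i ↦ ⟨_, p.2 i⟩

lemma jet1_weakPartial (hD : IsOpen D) (p : jet1 D) (i : Fin 3) :
    weakPartial D i (p.1 none) = p.1 (some i) := (p.2 i).weakPartial_eq hD

lemma jet1_ext (hD : IsOpen D) {p q : jet1 D} (h : p.1 none = q.1 none) : p = q := by
  ext1
  refine PiLp.ext fun o ↦ ?_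
  cases o with
  | none => exact h
  | some i => rw [← jet1_weakPartial hD p, ← jet1_weakPartial hD q, h]

/-- The Borel structure of `L²(D)³`. -/
instance instMeasurableSpaceL2 {D : Set E3} : MeasurableSpace (L2 D) := borel (L2 D)

instance {D : Set E3} : BorelSpace (L2 D) := ⟨rfl⟩

instance {D : Set E3} : SecondCountableTopology (L2 D) :=
  haveI : Fact ((2 : ℝ≥0∞) ≠ ∞) := ⟨by norm_num⟩
  inferInstance

instance : PolishSpace (jet1 D) := inferInstance

instance : BorelSpace (jet1 D) := inferInstance

/-- The weak derivative is a Borel map on `H¹(D)³`. -/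
lemma exists_measurable_weakPartial (hD : IsOpen D) (i : Fin 3) :
    ∃ d : L2 D → L2 D, Measurable d ∧ ∀ f, MemH1 D f → d f = weakPartial D i f := by
  have hc : Continuous (fun p : jet1 D ↦ p.1 none) := by fun_prop
  -- H¹ is not closed in L², but its graph is Polish and projects injectively and continuously, so
  -- Lusin–Souslin applies. The derivative, continuous on the graph, becomes Borel on the image.
  have he : MeasurableEmbedding (fun p : jet1 D ↦ p.1 none) :=
    hc.measurableEmbedding fun p q h ↦ jet1_ext hD h
  have hg : Measurable (fun p : jet1 D ↦ p.1 (some i)) :=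
    (by fun_prop : Continuous (fun p : jet1 D ↦ p.1 (some i))).measurable
  obtain ⟨d, hd, hdg⟩ := he.exists_measurable_extend hg fun _ ↦ inferInstance
  exact ⟨d, hd, fun f hf ↦ congrFun hdg (toJet1 f hf)⟩

lemma measurableSet_memH1 (hD : IsOpen D) : MeasurableSet {f : L2 D | MemH1 D f} := by
  have hc : Continuous (fun p : jet1 D ↦ p.1 none) := by fun_prop
  have he : MeasurableEmbedding (fun p : jet1 D ↦ p.1 none) :=
    hc.measurableEmbedding fun p q h ↦ jet1_ext hD h
  convert he.measurableSet_range
  ext f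
  exact ⟨fun hf ↦ ⟨toJet1 f hf, rfl⟩, by rintro ⟨p, rfl⟩; exact jet1_memH1 p⟩

/-! ### Continuity of the pointwise cross product -/

lemma exists_essBdd_near (f : L2 D) {ε : ℝ} (hε : 0 < ε) :
    ∃ (c : ℝ) (h : L2 D), 0 ≤ c ∧ EssBdd D c h ∧ ‖f - h‖ < ε := by
  obtain ⟨b, hb⟩ := (BoundedContinuousFunction.toLp_denseRange (p := 2) E3 (volume.restrict D) ℝ
    (by simp)).exists_dist_lt f hε
  refine ⟨‖b‖, _, norm_nonneg b, ?_, by rwa [dist_eq_norm] at hb⟩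
  filter_upwards [BoundedContinuousFunction.coeFn_toLp (p := 2) (volume.restrict D) ℝ b] with x hx
  rw [hx]
  exact b.norm_coe_le_norm x

/-- The pointwise product of L² fields need not lie in L², so joint continuity uses |m| ≤ 1: f₀ is
replaced by a bounded h, for which the L² distance of m and m₀ is enough. -/
lemma norm_crossL_sub_le {D : Set E3} {m m₀ f f₀ h : L2 D} (hm : EssBdd D 1 m)
    (hm₀ : EssBdd D 1 m₀) {c : ℝ}
    (hh : EssBdd D c h) :
    ‖crossL m f - crossL m₀ f₀‖ ≤ ‖f - f₀‖ + c * ‖m - m₀‖ + 2 * ‖f₀ - h‖ := by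
  have e : crossL m f - crossL m₀ f₀ = crossL m (f - f₀) + crossL (m - m₀) h
      + (crossL m (f₀ - h) - crossL m₀ (f₀ - h)) := by
    rw [crossL_sub_right hm, crossL_sub_right hm, crossL_sub_right hm₀, crossL_sub_left hh]
    abel
  have e1 := norm_crossL_le_left hm (f - f₀)
  have e2 := norm_crossL_le_right hh (m - m₀)
  have e3 := norm_crossL_le_left hm (f₀ - h)
  have e4 := norm_crossL_le_left hm₀ (f₀ - h)
  have e5 := norm_sub_le (crossL m (f₀ - h)) (crossL m₀ (f₀ - h))
  rw [e]
  refine (norm_add₃_le).trans ?_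
  linarith

lemma continuous_crossL {α : Type*} [TopologicalSpace α] {m f : α → L2 D} (hm : Continuous m)
    (hf : Continuous f) (hb : ∀ a, EssBdd D 1 (m a)) : Continuous (fun a ↦ crossL (m a) (f a)) := by
  rw [continuous_iff_continuousAt]
  intro a
  rw [ContinuousAt, Metric.tendsto_nhds]
  intro ε hε
  obtain ⟨c, h, hc, hh, hfh⟩ := exists_essBdd_near (f a) (show 0 < ε / 4 by positivity)
  have h1 := (Metric.tendsto_nhds.1 (hf.tendsto a)) (ε / 4) (by positivity)
  have h2 := (Metric.tendsto_nhds.1 (hm.tendsto a)) (ε / (4 * (c + 1))) (by positivity)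
  filter_upwards [h1, h2] with b h1 h2
  rw [dist_eq_norm] at *
  refine (norm_crossL_sub_le (hb b) (hb a) hh).trans_lt ?_
  have h3 : c * ‖m b - m a‖ ≤ ε / 4 := by
    calc c * ‖m b - m a‖ ≤ (c + 1) * (ε / (4 * (c + 1))) := by gcongr; linarith
      _ = ε / 4 := by field_simp
  linarith

lemma continuous_crossL_right {D : Set E3} {α : Type*} [TopologicalSpace α] {f : α → L2 D}
    {g : L2 D} {c : ℝ}
    (hf : Continuous f) (hg : EssBdd D c g) : Continuous (fun a ↦ crossL (f a) g) := by
  have h : LipschitzWith c.toNNReal (fun f : L2 D ↦ crossL f g) := by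
    refine LipschitzWith.of_dist_le_mul fun f f' ↦ ?_
    rw [dist_eq_norm, dist_eq_norm, ← crossL_sub_left hg]
    refine (norm_crossL_le_right hg _).trans ?_
    gcongr
    exact Real.le_coe_toNNReal c
  exact h.continuous.comp hf

lemma isClosed_norm_eq_one : IsClosed {m : L2 D | ∀ᵐ x ∂(volume.restrict D), ‖m x‖ = 1} := by
  have hn : LipschitzWith 1 (norm : E3 → ℝ) := lipschitzWith_one_norm
  have hc := hn.continuous_compLp (p := 2) (μ := volume.restrict D) norm_zero
  have h1 : MemLp (fun _ : E3 ↦ (1 : ℝ)) 2 (volume.restrict D) := memLp_const 1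
  convert isClosed_eq hc (continuous_const (y := h1.toLp)) using 1
  ext m
  constructor
  · intro h
    refine Lp.ext ?_
    filter_upwards [h, hn.coeFn_compLp norm_zero m, h1.coeFn_toLp] with x h2 h3 h4
    rw [h3, h4, Function.comp_apply, h2]
  · intro h
    have h' : hn.compLp norm_zero m = h1.toLp := h
    filter_upwards [hn.coeFn_compLp norm_zero m, h1.coeFn_toLp] with x h3 h4
    rw [h', h4] at h3
    exact h3.symm

end

/-! ### The solution of one step is a Borel function of the data -/

section solution

variable {D : Set E3} [IsFiniteMeasure (volume.restrict D)]

/-- The component of `f` along `m`, if `|m| = 1`. -/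
def normalPart (m f : L2 D) : L2 D := f + crossL m (crossL m f)

/-- From m × (m × f) = (f·m)m − |m|²f. Expressing the normal part by cross products makes it
continuous in m by `continuous_crossL`. -/
lemma coeFn_normalPart {D : Set E3} {m : L2 D} (hm : ∀ᵐ x ∂(volume.restrict D), ‖m x‖ = 1)
    (f : L2 D) :
    ∀ᵐ x ∂(volume.restrict D), normalPart m f x = (inner ℝ (f x) (m x) : ℝ) • m x := by
  have hb := essBdd_of_norm_eq_one hm
  filter_upwards [hm, coeFn_crossL_left hb f, coeFn_crossL_left hb (crossL m f),
    Lp.coeFn_add f (crossL m (crossL m f))] with x h1 h2 h3 h4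
  rw [normalPart, h4, Pi.add_apply, h3, h2, cross_cross_self, real_inner_self_eq_norm_sq, h1]
  simp

lemma normalPart_eq_zero_iff {D : Set E3} {m : L2 D} (hm : ∀ᵐ x ∂(volume.restrict D), ‖m x‖ = 1) (f : L2 D) :
    normalPart m f = 0 ↔ ∀ᵐ x ∂(volume.restrict D), inner ℝ (f x) (m x) = (0 : ℝ) := by
  constructor
  · intro h
    filter_upwards [hm, coeFn_normalPart hm f, Lp.coeFn_zero E3 2 (volume.restrict D)] with x h1 h2 h3
    rw [h, h3] at h2
    have h4 : m x ≠ 0 := norm_ne_zero_iff.1 (by rw [h1]; exact one_ne_zero)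
    exact (smul_eq_zero.1 h2.symm).resolve_right h4
  · intro h
    refine Lp.ext ?_
    filter_upwards [h, coeFn_normalPart hm f, Lp.coeFn_zero E3 2 (volume.restrict D)] with x h1 h2 h3
    rw [h2, h3, h1, zero_smul]
    rfl

lemma inner_normalPart {D : Set E3} {m : L2 D} (hm : EssBdd D 1 m) (f g : L2 D) :
    inner ℝ (normalPart m f) g = (inner ℝ f (normalPart m g) : ℝ) := by
  rw [normalPart, normalPart, inner_add_left, inner_add_right, inner_crossL_left hm,
    inner_crossL_left hm, neg_neg]

/-- `normalPart m` as a continuous linear map. -/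
def normalPartL (m : L2 D) (hm : EssBdd D 1 m) : L2 D →L[ℝ] L2 D :=
  LinearMap.mkContinuous
    { toFun := normalPart m
      map_add' := fun f g ↦ by
        simp only [normalPart, crossL_add_right hm]
        abel
      map_smul' := fun r f ↦ by
        simp only [normalPart, crossL_smul_right hm, smul_add, RingHom.id_apply] } 2 (fun f ↦ by
    have h1 := norm_crossL_le_left hm (crossL m f)
    have h2 := norm_crossL_le_left hm f
    refine (norm_add_le _ _).trans ?_
    linarith)

/-- The embedding of `L²(D)³` as the first component of the jets. -/
def jetFst (f : L2 D) : Jet1 D := WithLp.toLp 2 (fun o ↦ o.elim f (fun _ ↦ 0))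

lemma continuous_jet {D : Set E3} {α : Type*} [TopologicalSpace α] {f : α → L2 D}
    {g : Fin 3 → α → L2 D}
    (hf : Continuous f) (hg : ∀ i, Continuous (g i)) :
    Continuous (fun a ↦ (WithLp.toLp 2 (fun o : Option (Fin 3) ↦ o.elim (f a) (fun i ↦ g i a)) :
      Jet1 D)) := by
  refine (PiLp.continuous_toLp 2 _).comp (continuous_pi fun o ↦ ?_)
  cases o with
  | none => exact hf
  | some i => exact hg i

lemma inner_jet {D : Set E3} (f : L2 D) (g : Fin 3 → L2 D) (q : Jet1 D) :
    inner ℝ (WithLp.toLp 2 (fun o : Option (Fin 3) ↦ o.elim f g) : Jet1 D) q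
      = inner ℝ f (q none) + ∑ i, inner ℝ (g i) (q (some i)) := by
  simp [PiLp.inner_apply, Fintype.sum_option]

/-- A vector is orthogonal to the tangential jets iff it can be approximated, after projection to
the jets, by normal fields. -/
lemma orthogonal_tangent_iff {m : L2 D} (hm : ∀ᵐ x ∂(volume.restrict D), ‖m x‖ = 1)
    {s : ℕ → L2 D} (hs : DenseRange s) (r : Jet1 D) :
    (∀ p : jet1 D, normalPart m (p.1 none) = 0 → inner ℝ r p.1 = (0 : ℝ)) ↔
      ∀ n : ℕ, ∃ k : ℕ, ‖(jet1 D).orthogonalProjectionOnto (r - jetFst (normalPart m (s k)))‖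
        < 1 / ((n : ℝ) + 1) := by
  have hb := essBdd_of_norm_eq_one hm
  set P := (jet1 D).orthogonalProjectionOnto with hP
  have hfst : ∀ (f : L2 D) (p : jet1 D), inner ℝ (jetFst f) p.1 = (inner ℝ f (p.1 none) : ℝ) := by
    intro f p
    simp [jetFst, inner_jet]
  have hPin : ∀ (x : Jet1 D) (p : jet1 D), inner ℝ (P x) p = (inner ℝ x p.1 : ℝ) := fun x p ↦
    Submodule.inner_orthogonalProjectionOnto_eq_of_mem_right p x
  constructor
  · intro h n
    let pr : jet1 D →L[ℝ] L2 D :=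
      (PiLp.proj 2 (fun _ : Option (Fin 3) ↦ L2 D) none : Jet1 D →L[ℝ] L2 D).comp (jet1 D).subtypeL
    -- The kernel of T is the space of tangential jets, and its orthogonal complement is the closure
    -- of the range of the adjoint, computed below. A dense sequence exhausts that range, so a
    -- quantifier over a test space moving with m turns into countably many conditions.
    let T : jet1 D →L[ℝ] L2 D := (normalPartL m hb).comp pr
    have hT : ∀ p, T p = normalPart m (p.1 none) := fun p ↦ rfl
    have hmem : P r ∈ T.kerᗮ := by
      rw [Submodule.mem_orthogonal']
      intro p hp
      rw [hPin]
      exact h p ((hT p).symm.trans hp)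
    rw [ContinuousLinearMap.orthogonal_ker] at hmem
    have hadj : ∀ f, ContinuousLinearMap.adjoint T f = P (jetFst (normalPart m f)) := by
      intro f
      refine ext_inner_right ℝ fun p ↦ ?_
      rw [ContinuousLinearMap.adjoint_inner_left, hPin, hfst, hT, inner_normalPart hb]
    obtain ⟨_, ⟨f, rfl⟩, hf⟩ := Metric.mem_closure_iff.1 hmem (1 / ((n : ℝ) + 1)) (by positivity)
    have hopen : IsOpen {f | ‖P r - ContinuousLinearMap.adjoint T f‖ < 1 / ((n : ℝ) + 1)} :=
      isOpen_lt (by fun_prop) continuous_const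
    obtain ⟨k, hk⟩ := hs.exists_mem_open hopen ⟨f, by rw [dist_eq_norm] at hf; exact hf⟩
    refine ⟨k, ?_⟩
    rw [map_sub, ← hadj]
    exact hk
  · intro h p hp
    by_contra hne
    have hpos : 0 < |inner ℝ r p.1| := abs_pos.2 hne
    obtain ⟨n, hn⟩ := exists_nat_one_div_lt (div_pos hpos (show 0 < ‖p‖ + 1 by positivity))
    obtain ⟨k, hk⟩ := h n
    have e1 : inner ℝ r p.1 = (inner ℝ (P (r - jetFst (normalPart m (s k)))) p : ℝ) := by
      rw [hPin, inner_sub_left, hfst, inner_normalPart hb, hp, inner_zero_right, sub_zero]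
    have e2 := abs_real_inner_le_norm (P (r - jetFst (normalPart m (s k)))) p
    rw [← e1] at e2
    have e3 := hk.trans hn
    rw [lt_div_iff₀ (by positivity)] at e3
    nlinarith [norm_nonneg (P (r - jetFst (normalPart m (s k)))), norm_nonneg p]

lemma mem_tangentSpace_iff {m f : L2 D} (hm : ∀ᵐ x ∂(volume.restrict D), ‖m x‖ = 1) :
    f ∈ tangentSpace D m ↔ MemH1 D f ∧ normalPart m f = 0 := by
  rw [normalPart_eq_zero_iff hm]
  rfl

/-- The solution of one step is unique. -/
lemma IsStep.unique (hD : IsOpen D) {θ τ : ℝ} (hθ : 0 ≤ θ) (hτ : 0 ≤ τ) {g : ℕ → L2 D}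
    {ξ m v v' : L2 D} (hm : EssBdd D 1 m) (h : IsStep D θ τ g ξ m v) (h' : IsStep D θ τ g ξ m v') :
    v = v' := by
  have hd := sub_mem_tangentSpace h.mem h'.mem
  have e := h.eq _ hd
  have e' := h'.eq _ hd
  rw [integral_idSubCross hm] at e e'
  -- Testing with the difference, the skew part cancels and the form that remains is positive
  -- definite.
  have e1 : inner ℝ (v - crossL m v) (v - v') - inner ℝ (v' - crossL m v') (v - v')
      = ‖v - v'‖ ^ 2 := by
    rw [← inner_sub_left]
    have : v - crossL m v - (v' - crossL m v') = (v - v') - crossL m (v - v') := by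
      rw [crossL_sub_right hm]
      abel
    rw [this, inner_sub_left, inner_crossL_self hm, sub_zero, real_inner_self_eq_norm_sq]
  have e2 : gradInner D v (v - v') - gradInner D v' (v - v') = gradReal D (v - v') := by
    rw [← gradInner_self]
    simp_rw [gradInner, ← Finset.sum_sub_distrib, ← inner_sub_left]
    refine Finset.sum_congr rfl fun i _ ↦ ?_
    rw [((h.mem.1.hasWeakPartial i).sub (h'.mem.1.hasWeakPartial i)).weakPartial_eq hD]
  have e3 : ‖v - v'‖ ^ 2 + 2 * θ * τ * gradReal D (v - v') = 0 := by
    rw [← e1, ← e2]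
    linarith
  have e4 : 0 ≤ 2 * θ * τ * gradReal D (v - v') :=
    mul_nonneg (by positivity) (gradReal_nonneg _)
  have e5 : ‖v - v'‖ ^ 2 = 0 := le_antisymm (by linarith) (by positivity)
  exact sub_eq_zero.1 (norm_eq_zero.1 (pow_eq_zero_iff two_ne_zero |>.1 e5))

/-- The residual of the equation of one step, as an element of the space of jets. -/
def stepRes (θ τ : ℝ) (g : ℕ → L2 D) (m : Jet1 D) (ξ : L2 D) (v : Jet1 D) : Jet1 D :=
  WithLp.toLp 2 (fun o ↦ o.elim
    (v none - crossL (m none) (v none)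
      - (crossL (m none) ξ - crossL (m none) (crossL (m none) ξ))
      - (τ / 2) • ∑' i, noiseCorr (m none) (g i))
    (fun i ↦ (2 * θ * τ) • v (some i) + (2 * τ) • m (some i)))

/-- The right side consists of countably many conditions on continuous functions of (m, ξ, v), so
the solutions form a Borel set. -/
lemma isStep_iff (hD : IsOpen D) {θ τ : ℝ} {g : ℕ → L2 D} {b : ℕ → ℝ} (hb0 : ∀ i, 0 ≤ b i)
    (hg : ∀ i, EssBdd D (b i) (g i)) (hS : Summable (fun i ↦ b i * ‖g i‖)) {s : ℕ → L2 D}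
    (hs : DenseRange s) (m v : jet1 D) (ξ : L2 D)
    (hm : ∀ᵐ x ∂(volume.restrict D), ‖m.1 none x‖ = 1) :
    IsStep D θ τ g ξ (m.1 none) (v.1 none) ↔ normalPart (m.1 none) (v.1 none) = 0 ∧
      ∀ n : ℕ, ∃ k : ℕ, ‖(jet1 D).orthogonalProjectionOnto
        (stepRes θ τ g m.1 ξ v.1 - jetFst (normalPart (m.1 none) (s k)))‖ < 1 / ((n : ℝ) + 1) := by
  have hmb := essBdd_of_norm_eq_one hm
  rw [← orthogonal_tangent_iff hm hs]
  have hsum : Summable (fun i ↦ noiseCorr (m.1 none) (g i)) :=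
    Summable.of_norm_bounded (hS.mul_left 2) fun i ↦ norm_noiseCorr_le hmb (hb0 i) (hg i)
  have key : ∀ p : jet1 D, inner ℝ (stepRes θ τ g m.1 ξ v.1) p.1 = (0 : ℝ) ↔
      (∫ x in D, inner ℝ (idSubCross (m.1 none x) (v.1 none x)) (p.1 none x))
        + 2 * θ * τ * gradInner D (v.1 none) (p.1 none)
      = -2 * τ * gradInner D (m.1 none) (p.1 none)
        + (∫ x in D, inner ℝ (idSubCross (m.1 none x) (cross (m.1 none x) (ξ x))) (p.1 none x))
        + τ / 2 * ∑' i : ℕ, ∫ x in D,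
          inner ℝ (idSubCross (m.1 none x) (cross (cross (m.1 none x) (g i x)) (g i x)))
            (p.1 none x) := by
    intro p
    rw [stepRes, inner_jet, integral_idSubCross hmb, integral_idSubCross_cross hmb]
    simp_rw [fun i ↦ integral_noiseCorr hmb (hg i) (p.1 none), gradInner, jet1_weakPartial hD,
      inner_add_left, real_inner_smul_left, Finset.sum_add_distrib, ← Finset.mul_sum]
    have ht : ∑' i, inner ℝ (noiseCorr (m.1 none) (g i)) (p.1 none)
        = (inner ℝ (∑' i, noiseCorr (m.1 none) (g i)) (p.1 none) : ℝ) := by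
      have := (innerSL ℝ (p.1 none)).map_tsum hsum
      simp only [innerSL_apply_apply] at this
      rw [real_inner_comm, this]
      simp_rw [real_inner_comm]
    rw [ht, inner_sub_left, inner_sub_left (v.1 none - crossL (m.1 none) (v.1 none)),
      real_inner_smul_left]
    constructor <;> intro h <;> linarith
  constructor
  · intro h
    exact ⟨((mem_tangentSpace_iff hm).1 h.mem).2, fun p hp ↦ (key p).2
      (h.eq _ ((mem_tangentSpace_iff hm).2 ⟨jet1_memH1 p, hp⟩))⟩
  · intro h
    refine ⟨(mem_tangentSpace_iff hm).2 ⟨jet1_memH1 v, h.1⟩, fun φ hφ ↦ ?_⟩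
    exact (key (toJet1 φ hφ.1)).1 (h.2 _ ((mem_tangentSpace_iff hm).1 hφ).2)

/-- The solution of one step is a Borel function of the previous state and the increment. -/
lemma exists_measurable_step (hD : IsOpen D) {θ τ : ℝ} (hθ : 0 ≤ θ) (hτ : 0 ≤ τ) {g : ℕ → L2 D}
    {b : ℕ → ℝ} (hb0 : ∀ i, 0 ≤ b i) (hg : ∀ i, EssBdd D (b i) (g i))
    (hS : Summable (fun i ↦ b i * ‖g i‖)) :
    ∃ Φ : L2 D × L2 D → L2 D, Measurable Φ ∧ ∀ m ξ v : L2 D, MemH1 D m →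
      (∀ᵐ x ∂(volume.restrict D), ‖m x‖ = 1) → IsStep D θ τ g ξ m v → v = Φ (m, ξ) := by
  -- On this closed, hence Polish, set of data with |m| = 1 the cross product with m is continuous.
  let X : Set (jet1 D × L2 D × jet1 D) :=
    {q | ∀ᵐ x ∂(volume.restrict D), ‖q.1.1 none x‖ = 1}
  have hX : IsClosed X := isClosed_norm_eq_one.preimage
    (by fun_prop : Continuous fun q : jet1 D × L2 D × jet1 D ↦ q.1.1 none)
  have hXp : PolishSpace X := hX.polishSpace
  let s := TopologicalSpace.denseSeq (L2 D)
  have hs : DenseRange s := TopologicalSpace.denseRange_denseSeq _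
  have hXb : ∀ q : X, EssBdd D 1 (q.1.1.1 none) := fun q ↦ essBdd_of_norm_eq_one q.2
  have cm : Continuous (fun q : X ↦ q.1.1.1 none) := by fun_prop
  have cv : Continuous (fun q : X ↦ q.1.2.2.1 none) := by fun_prop
  have cξ : Continuous (fun q : X ↦ q.1.2.1) := by fun_prop
  have ccross : ∀ {f : X → L2 D}, Continuous f → Continuous (fun q ↦ crossL (q.1.1.1 none) (f q)) :=
    fun hf ↦ continuous_crossL cm hf hXb
  have cnorm : ∀ {f : X → L2 D}, Continuous f →
      Continuous (fun q ↦ normalPart (q.1.1.1 none) (f q)) :=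
    fun hf ↦ hf.add (ccross (ccross hf))
  have ccorr : Continuous (fun q : X ↦ ∑' i, noiseCorr (q.1.1.1 none) (g i)) := by
    refine continuous_tsum (fun i ↦ ?_) (hS.mul_left 2)
      fun i q ↦ norm_noiseCorr_le (hXb q) (hb0 i) (hg i)
    have h1 := continuous_crossL_right (ccross (continuous_const (y := g i))) (hg i)
    exact h1.sub (ccross h1)
  have cres : Continuous (fun q : X ↦ stepRes θ τ g q.1.1.1 q.1.2.1 q.1.2.2.1) := by
    refine continuous_jet ?_ fun i ↦ by fun_prop
    exact ((cv.sub (ccross cv)).sub ((ccross cξ).sub (ccross (ccross cξ)))).sub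
      (Continuous.smul (continuous_const (y := τ / 2)) ccorr)
  have cfst : ∀ {f : X → L2 D}, Continuous f → Continuous (fun q ↦ jetFst (f q)) :=
    fun hf ↦ continuous_jet hf fun i ↦ continuous_const
  let Γ : Set X := {q | IsStep D θ τ g q.1.2.1 (q.1.1.1 none) (q.1.2.2.1 none)}
  have hΓ : MeasurableSet Γ := by
    have e : Γ = {q : X | normalPart (q.1.1.1 none) (q.1.2.2.1 none) = 0} ∩ ⋂ n : ℕ, ⋃ k : ℕ,
        {q : X | ‖(jet1 D).orthogonalProjectionOnto (stepRes θ τ g q.1.1.1 q.1.2.1 q.1.2.2.1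
          - jetFst (normalPart (q.1.1.1 none) (s k)))‖ < 1 / ((n : ℝ) + 1)} := by
      ext q
      simp only [Γ, Set.mem_ofPred_eq, Set.mem_inter_iff, Set.mem_iInter, Set.mem_iUnion]
      exact isStep_iff hD hb0 hg hS hs q.1.1 q.1.2.2 q.1.2.1 q.2
    rw [e]
    refine (isClosed_eq (cnorm cv) continuous_const).measurableSet.inter
      (MeasurableSet.iInter fun n ↦ MeasurableSet.iUnion fun k ↦ IsOpen.measurableSet ?_)
    refine isOpen_lt (Continuous.norm ?_) continuous_const
    exact (jet1 D).orthogonalProjectionOnto.continuous.comp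
      (cres.sub (cfst (cnorm continuous_const)))
  let π : X → L2 D × L2 D := fun q ↦ (q.1.1.1 none, q.1.2.1)
  have hπ : Continuous π := cm.prodMk cξ
  -- Uniqueness makes the projection injective on the Borel set Γ, hence a measurable embedding; Φ
  -- is v read through its inverse and extended arbitrarily. Existence of solutions plays no role.
  have hinj : Set.InjOn π Γ := by
    intro p hp q hq hpq
    have e1 : p.1.1.1 none = q.1.1.1 none := congrArg Prod.fst hpq
    have e2 : p.1.2.1 = q.1.2.1 := congrArg Prod.snd hpq
    have hp' : IsStep D θ τ g p.1.2.1 (p.1.1.1 none) (p.1.2.2.1 none) := hp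
    rw [e1, e2] at hp'
    exact Subtype.ext (Prod.ext (jet1_ext hD e1) (Prod.ext e2
      (jet1_ext hD (IsStep.unique hD hθ hτ (hXb q) hp' hq))))
  have hemb := hπ.continuousOn.measurableEmbedding hΓ hinj
  have hv : Measurable (fun q : Γ ↦ q.1.1.2.2.1 none) := cv.measurable.comp measurable_subtype_coe
  obtain ⟨Φ, hΦ, hΦv⟩ := hemb.exists_measurable_extend hv fun _ ↦ inferInstance
  refine ⟨Φ, hΦ, fun m ξ v hm1 hm hstep ↦ ?_⟩
  exact (congrFun hΦv ⟨⟨(toJet1 m hm1, ξ, toJet1 v hstep.mem.1), hm⟩, hstep⟩).symm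

end solution

/-! ### Brownian increments -/

section increments

variable {Ω : Type*} [MeasurableSpace Ω] {P : Measure Ω} {T : ℝ≥0}

/-- The process `B` stopped at the deterministic time `T`. -/
def stopped (T : ℝ≥0) (B : ℝ≥0 → Ω → ℝ) (t : ℝ≥0) (ω : Ω) : ℝ := B (min t T) ω

lemma IsBrownianOn.measurable_stopped {B : ℝ≥0 → Ω → ℝ} (hB : IsBrownianOn P T B) (t : ℝ≥0) :
    Measurable (stopped T B t) := hB.measurable _ (min_le_right _ _)

lemma IsBrownianOn.isGaussianProcess {B : ℝ≥0 → Ω → ℝ} (hB : IsBrownianOn P T B) :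
    IsGaussianProcess (stopped T B) P where
  hasGaussianLaw I := by
    classical
    let J : Finset ℝ≥0 := I.image (fun t ↦ min t T)
    have hJ : ∀ t ∈ J, t ≤ T := by
      intro t ht
      obtain ⟨s, -, rfl⟩ := Finset.mem_image.1 ht
      exact min_le_right _ _
    let L : (J → ℝ) →L[ℝ] I → ℝ := ContinuousLinearMap.pi fun t ↦
      ContinuousLinearMap.proj (⟨min t.1 T, Finset.mem_image_of_mem _ t.2⟩ : J)
    exact (hB.hasLaw J hJ).hasGaussianLaw.map L

lemma IsBrownianOn.covariance {B : ℝ≥0 → Ω → ℝ} (hB : IsBrownianOn P T B) (s t : ℝ≥0) :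
    cov[fun ω ↦ stopped T B s ω, fun ω ↦ stopped T B t ω; P]
      = ((min (min s T) (min t T) : ℝ≥0) : ℝ) := by
  classical
  let J : Finset ℝ≥0 := {min s T, min t T}
  have hJ : ∀ t ∈ J, t ≤ T := by
    intro r hr
    rcases Finset.mem_insert.1 hr with rfl | hr
    · exact min_le_right _ _
    · rw [Finset.mem_singleton.1 hr]
      exact min_le_right _ _
  have h := (hB.hasLaw J hJ).covariance_fun_comp
    (f := fun x ↦ x ⟨min s T, by simp [J]⟩) (g := fun x ↦ x ⟨min t T, by simp [J]⟩)
    (measurable_pi_apply _).aemeasurable (measurable_pi_apply _).aemeasurable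
  exact h.trans (BrownianReal.covariance_eval_projectiveFamily _ _ _)

lemma IsBrownianOn.integral_eq_zero {B : ℝ≥0 → Ω → ℝ} (hB : IsBrownianOn P T B) (t : ℝ≥0) :
    ∫ ω, stopped T B t ω ∂P = 0 := by
  classical
  let J : Finset ℝ≥0 := {min t T}
  have hJ : ∀ t ∈ J, t ≤ T := by
    intro r hr
    rw [Finset.mem_singleton.1 hr]
    exact min_le_right _ _
  have h := (hB.hasLaw J hJ).integral_comp
    (f := fun x ↦ x ⟨min t T, by simp [J]⟩) (measurable_pi_apply _).aestronglyMeasurable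
  exact h.trans (BrownianReal.integral_eval_projectiveFamily _ _)

lemma IsBrownianOn.memLp {B : ℝ≥0 → Ω → ℝ} (hB : IsBrownianOn P T B) (t : ℝ≥0) :
    MemLp (stopped T B t) 2 P := (hB.isGaussianProcess.hasGaussianLaw_eval t).memLp_two

/-- Jointly Gaussian uncorrelated increments are independent. Stopping at T gives a process on all
of ℝ≥0, although nothing is known of B after T. -/
lemma IsBrownianOn.hasIndepIncrements [IsProbabilityMeasure P] {B : ℝ≥0 → Ω → ℝ}
    (hB : IsBrownianOn P T B) : HasIndepIncrements (stopped T B) P := by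
  refine fun n t ht ↦ hB.isGaussianProcess.hasGaussianLaw_increments.iIndepFun_of_covariance_eq_zero
    fun i j hij ↦ ?_
  rw [covariance_fun_sub_fun_sub (hB.memLp _) (hB.memLp _) (hB.memLp _) (hB.memLp _)]
  simp_rw [hB.covariance]
  wlog h : i < j generalizing i j
  · have := this j i hij.symm (by grind)
    simp_rw [min_comm (min (t i.succ) T), min_comm (min (t i.castSucc) T)]
    linarith
  have h1 : i.succ ≤ j.succ := Fin.strictMono_succ h |>.le
  have h2 : i.castSucc ≤ j.succ := Fin.le_of_lt h1
  have h3 : i.castSucc ≤ j.castSucc := Fin.le_castSucc_iff.mpr h1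
  have mono : ∀ {a b}, a ≤ b → min (t a) T ≤ min (t b) T := fun h ↦ min_le_min_right _ (ht h)
  rw [min_eq_left (mono h1), min_eq_left (mono h), min_eq_left (mono h2), min_eq_left (mono h3)]
  simp

/-- The increments of a Brownian motion on `[0, T]` over the intervals of length `τ`. -/
def bmIncr (T τ : ℝ≥0) (B : ℝ≥0 → Ω → ℝ) (k : ℕ) (ω : Ω) : ℝ :=
  stopped T B ((k + 1 : ℕ) * τ) ω - stopped T B (k * τ) ω

lemma bmIncr_eq {Ω : Type*} {τ : ℝ≥0} {B : ℝ≥0 → Ω → ℝ} {k : ℕ} (hk : (k + 1 : ℕ) * τ ≤ T) (ω : Ω) :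
    bmIncr T τ B k ω = B ((k + 1 : ℕ) * τ) ω - B (k * τ) ω := by
  have hk' : k * τ ≤ T := le_trans (by gcongr; simp) hk
  simp only [bmIncr, stopped, min_eq_left hk, min_eq_left hk']

lemma IsBrownianOn.measurable_bmIncr {τ : ℝ≥0} {B : ℝ≥0 → Ω → ℝ} (hB : IsBrownianOn P T B)
    (k : ℕ) : Measurable (bmIncr T τ B k) :=
  (hB.measurable_stopped _).sub (hB.measurable_stopped _)

lemma IsBrownianOn.memLp_bmIncr {τ : ℝ≥0} {B : ℝ≥0 → Ω → ℝ} (hB : IsBrownianOn P T B)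
    (k : ℕ) : MemLp (bmIncr T τ B k) 2 P := (hB.memLp _).sub (hB.memLp _)

lemma IsBrownianOn.integral_bmIncr [IsProbabilityMeasure P] {τ : ℝ≥0} {B : ℝ≥0 → Ω → ℝ}
    (hB : IsBrownianOn P T B) (k : ℕ) : ∫ ω, bmIncr T τ B k ω ∂P = 0 := by
  simp only [bmIncr]
  rw [integral_sub ((hB.memLp _).integrable one_le_two) ((hB.memLp _).integrable one_le_two),
    hB.integral_eq_zero, hB.integral_eq_zero, sub_zero]

lemma IsBrownianOn.integral_bmIncr_sq [IsProbabilityMeasure P] {τ : ℝ≥0} {B : ℝ≥0 → Ω → ℝ}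
    (hB : IsBrownianOn P T B) {k : ℕ} (hk : (k + 1 : ℕ) * τ ≤ T) :
    ∫ ω, bmIncr T τ B k ω ^ 2 ∂P = τ := by
  have hk' : k * τ ≤ T := le_trans (by gcongr; simp) hk
  have hkk : k * τ ≤ (k + 1 : ℕ) * τ := by gcongr; simp
  have h := covariance_fun_sub_fun_sub (hB.memLp ((k + 1 : ℕ) * τ)) (hB.memLp (k * τ))
    (hB.memLp ((k + 1 : ℕ) * τ)) (hB.memLp (k * τ))
  rw [hB.covariance, hB.covariance, hB.covariance, hB.covariance, min_eq_left hk, min_eq_left hk',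
    min_self, min_self, min_eq_left hkk, min_eq_right hkk] at h
  have hv := covariance_eq_sub (hB.memLp_bmIncr (τ := τ) k) (hB.memLp_bmIncr (τ := τ) k)
  rw [hB.integral_bmIncr, mul_zero, sub_zero] at hv
  have e : ∫ ω, bmIncr T τ B k ω ^ 2 ∂P = P[bmIncr T τ B k * bmIncr T τ B k] := by
    refine integral_congr_ae (.of_forall fun ω ↦ ?_)
    simp [sq]
  rw [e, ← hv]
  refine h.trans ?_
  push_cast
  ring

lemma IsCylindricalWiener.iIndepFun_bmIncr [IsProbabilityMeasure P] {β : ℕ → ℝ≥0 → Ω → ℝ}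
    (hβ : IsCylindricalWiener P T β) (τ : ℝ≥0) :
    iIndepFun (fun (p : ℕ × ℕ) ω ↦ bmIncr T τ (β p.1) p.2 ω) P := by
  refine iIndepFun_uncurry' (X := fun i k ω ↦ bmIncr T τ (β i) k ω)
    (fun i k ↦ (hβ.brownian i).measurable_bmIncr k) ?_ fun i ↦ ?_
  · exact hβ.indep.comp (fun _ (f : Set.Iic T → ℝ) (k : ℕ) ↦
      f ⟨min ((k + 1 : ℕ) * τ) T, Set.mem_Iic.2 (min_le_right _ _)⟩
        - f ⟨min (k * τ) T, Set.mem_Iic.2 (min_le_right _ _)⟩)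
      fun i ↦ measurable_pi_lambda _ fun k ↦
        (measurable_pi_apply _).sub (measurable_pi_apply _)
  · exact (hβ.brownian i).hasIndepIncrements.nat (t := fun k ↦ k * τ)
      fun a b h ↦ mul_le_mul_left (Nat.cast_le.2 h) τ

lemma IsCylindricalWiener.integral_bmIncr_mul [IsProbabilityMeasure P] {β : ℕ → ℝ≥0 → Ω → ℝ}
    (hβ : IsCylindricalWiener P T β) (τ : ℝ≥0) {i j : ℕ} (hij : i ≠ j) (k : ℕ) :
    ∫ ω, bmIncr T τ (β i) k ω * bmIncr T τ (β j) k ω ∂P = 0 := by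
  have h := (hβ.iIndepFun_bmIncr τ).indepFun (i := (i, k)) (j := (j, k)) (by simp [hij])
  have := h.integral_mul_eq_mul_integral
    ((hβ.brownian i).measurable_bmIncr k).aestronglyMeasurable
    ((hβ.brownian j).measurable_bmIncr k).aestronglyMeasurable
  rw [(hβ.brownian i).integral_bmIncr, zero_mul] at this
  exact this

/-- The information on the increments before the step `n`. -/
abbrev past (T τ : ℝ≥0) (β : ℕ → ℝ≥0 → Ω → ℝ) (n : ℕ) : MeasurableSpace Ω :=
  ⨆ p ∈ {p : ℕ × ℕ | p.2 < n}, MeasurableSpace.comap (bmIncr T τ (β p.1) p.2) inferInstance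

/-- The information on the increments of the step `n`. -/
abbrev present (T τ : ℝ≥0) (β : ℕ → ℝ≥0 → Ω → ℝ) (n : ℕ) : MeasurableSpace Ω :=
  ⨆ p ∈ {p : ℕ × ℕ | p.2 = n}, MeasurableSpace.comap (bmIncr T τ (β p.1) p.2) inferInstance

lemma IsCylindricalWiener.past_le {β : ℕ → ℝ≥0 → Ω → ℝ} (hβ : IsCylindricalWiener P T β)
    (τ : ℝ≥0) (n : ℕ) : past T τ β n ≤ ‹MeasurableSpace Ω› :=
  iSup₂_le fun p _ ↦ ((hβ.brownian p.1).measurable_bmIncr p.2).comap_le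

lemma IsCylindricalWiener.present_le {β : ℕ → ℝ≥0 → Ω → ℝ} (hβ : IsCylindricalWiener P T β)
    (τ : ℝ≥0) (n : ℕ) : present T τ β n ≤ ‹MeasurableSpace Ω› :=
  iSup₂_le fun p _ ↦ ((hβ.brownian p.1).measurable_bmIncr p.2).comap_le

lemma past_mono {Ω : Type*} (T τ : ℝ≥0) (β : ℕ → ℝ≥0 → Ω → ℝ) (n : ℕ) :
    past T τ β n ≤ past T τ β (n + 1) :=
  biSup_mono fun _ hp ↦ Nat.lt_succ_of_lt hp

lemma present_le_past {Ω : Type*} (T τ : ℝ≥0) (β : ℕ → ℝ≥0 → Ω → ℝ) (n : ℕ) :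
    present T τ β n ≤ past T τ β (n + 1) :=
  biSup_mono fun _ hp ↦ Nat.lt_succ_of_le (le_of_eq hp)

lemma measurable_present {Ω : Type*} (T τ : ℝ≥0) (β : ℕ → ℝ≥0 → Ω → ℝ) (n i : ℕ) :
    Measurable[present T τ β n] (bmIncr T τ (β i) n) :=
  measurable_iff_comap_le.2 (le_iSup₂_of_le (i, n) rfl le_rfl)

lemma IsCylindricalWiener.indep_past_present [IsProbabilityMeasure P] {β : ℕ → ℝ≥0 → Ω → ℝ}
    (hβ : IsCylindricalWiener P T β) (τ : ℝ≥0) (n : ℕ) :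
    Indep (past T τ β n) (present T τ β n) P := by
  refine indep_iSup_of_disjoint
    (m := fun p : ℕ × ℕ ↦ MeasurableSpace.comap (bmIncr T τ (β p.1) p.2) inferInstance)
    (fun p ↦ ((hβ.brownian p.1).measurable_bmIncr p.2).comap_le)
    ((iIndepFun_iff_iIndep _ _ _).1 (hβ.iIndepFun_bmIncr τ)) ?_
  rw [Set.disjoint_left]
  rintro p (h1 : p.2 < n) (h2 : p.2 = n)
  omega

end increments

/-! ### Random series in a Hilbert space -/

/-- Square summable pairwise orthogonal vectors are summable. -/
lemma summable_of_pairwise_inner_eq_zero {H : Type*} [NormedAddCommGroup H]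
    [InnerProductSpace ℝ H] [CompleteSpace H] {u : ℕ → H}
    (hu : ∀ i j, i ≠ j → inner ℝ (u i) (u j) = 0) (hs : Summable fun i ↦ ‖u i‖ ^ 2) :
    Summable u ∧ ‖∑' i, u i‖ ^ 2 ≤ ∑' i, ‖u i‖ ^ 2 := by
  have hV : OrthogonalFamily ℝ (fun i ↦ (ℝ ∙ u i : Submodule ℝ H))
      (fun i ↦ (ℝ ∙ u i : Submodule ℝ H).subtypeₗᵢ) := by
    intro i j hij v w
    obtain ⟨a, ha⟩ := Submodule.mem_span_singleton.1 v.2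
    obtain ⟨b, hb⟩ := Submodule.mem_span_singleton.1 w.2
    change inner ℝ (v : H) (w : H) = 0
    rw [← ha, ← hb, real_inner_smul_left, real_inner_smul_right, hu i j hij, mul_zero, mul_zero]
  let f : ∀ i, (ℝ ∙ u i : Submodule ℝ H) := fun i ↦ ⟨u i, Submodule.mem_span_singleton_self _⟩
  have h1 : Summable u := (hV.summable_iff_norm_sq_summable f).2 hs
  refine ⟨h1, le_of_tendsto (((continuous_norm.pow 2).tendsto _).comp h1.hasSum) ?_⟩
  refine .of_forall fun s ↦ ?_
  exact (hV.norm_sum f s).trans_le (hs.sum_le_tsum s fun _ _ ↦ sq_nonneg _)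

variable {Ω : Type*} {M : MeasurableSpace Ω} [mΩ : MeasurableSpace Ω] {P : Measure Ω}

/-- A series `∑ X i • b i` with centered uncorrelated real coefficients of variance `τ`. -/
lemma exists_random_series [IsProbabilityMeasure P] {H : Type*} [NormedAddCommGroup H]
    [InnerProductSpace ℝ H] [CompleteSpace H] (hM : M ≤ mΩ)
    {X : ℕ → Ω → ℝ} (hXm : ∀ i, Measurable[M] (X i)) (hX : ∀ i, MemLp (X i) 2 P)
    (hX0 : ∀ i, ∫ ω, X i ω ∂P = 0) {τ : ℝ} (hXτ : ∀ i, ∫ ω, X i ω ^ 2 ∂P = τ)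
    (hXX : ∀ i j, i ≠ j → ∫ ω, X i ω * X j ω ∂P = 0)
    {b : ℕ → H} (hb : Summable fun i ↦ ‖b i‖ ^ 2) :
    ∃ η : Ω → H, AEStronglyMeasurable[M] η P ∧ MemLp η 2 P ∧ ∫ ω, η ω ∂P = 0 ∧
      ∫⁻ ω, ‖η ω‖ₑ ^ 2 ∂P ≤ ENNReal.ofReal (τ * ∑' i, ‖b i‖ ^ 2) ∧
      Tendsto (fun k : ℕ ↦ ∫⁻ ω, ‖η ω - ∑ i ∈ Finset.range k, X i ω • b i‖ₑ ^ 2 ∂P)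
        atTop (𝓝 0) := by
  have hmem : ∀ i, MemLp (fun ω ↦ X i ω • b i) 2 P := fun i ↦
    (ContinuousLinearMap.toSpanSingleton ℝ (b i)).comp_memLp' (hX i)
  -- Uncorrelated coefficients make the terms orthogonal in L²(P; H), so square summability of b
  -- gives convergence there.
  let u : ℕ → Lp H 2 P := fun i ↦ (hmem i).toLp
  have hcoe : ∀ i, u i =ᵐ[P] fun ω ↦ X i ω • b i := fun i ↦ (hmem i).coeFn_toLp
  have hin : ∀ i j, inner ℝ (u i) (u j) = (∫ ω, X i ω * X j ω ∂P) * inner ℝ (b i) (b j) := by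
    intro i j
    rw [L2.inner_def, ← integral_mul_const]
    refine integral_congr_ae ?_
    filter_upwards [hcoe i, hcoe j] with ω h1 h2
    rw [h1, h2, real_inner_smul_left, real_inner_smul_right]
    ring
  have hn : ∀ i, ‖u i‖ ^ 2 = τ * ‖b i‖ ^ 2 := by
    intro i
    rw [← real_inner_self_eq_norm_sq, hin, real_inner_self_eq_norm_sq, ← hXτ i]
    simp only [sq]
  obtain ⟨hs, hle⟩ := summable_of_pairwise_inner_eq_zero (u := u)
    (fun i j hij ↦ by rw [hin, hXX i j hij, zero_mul])
    ((summable_congr hn).2 (hb.mul_left τ))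
  rw [tsum_congr hn, tsum_mul_left] at hle
  have hps : ∀ k, ((∑ i ∈ Finset.range k, u i : Lp H 2 P) : Ω → H) =ᵐ[P]
      fun ω ↦ ∑ i ∈ Finset.range k, X i ω • b i := by
    intro k
    have h : ∀ᵐ ω ∂P, ∀ i, u i ω = X i ω • b i := ae_all_iff.2 hcoe
    filter_upwards [Lp.coeFn_finsetSum (Finset.range k) u, h] with ω h1 h2
    rw [h1, Finset.sum_apply]
    exact Finset.sum_congr rfl fun i _ ↦ h2 i
  have hlim : Tendsto (fun k : ℕ ↦ ∑ i ∈ Finset.range k, u i) atTop (𝓝 (∑' i, u i)) :=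
    hs.hasSum.tendsto_sum_nat
  have esq : ∀ f : Lp H 2 P, ‖f‖ₑ ^ 2 = ∫⁻ ω, ‖f ω‖ₑ ^ 2 ∂P := by
    intro f
    rw [Lp.enorm_def, eLpNorm_eq_lintegral_rpow_enorm_toReal (by norm_num) (by norm_num)]
    simp only [ENNReal.toReal_ofNat, ENNReal.rpow_ofNat]
    rw [← ENNReal.rpow_natCast, ← ENNReal.rpow_mul]
    simp
  refine ⟨(∑' i, u i : Lp H 2 P), ?_, Lp.memLp _, ?_, ?_, ?_⟩
  · refine (isClosed_aestronglyMeasurable (p := 2) (μ := P) (F := H) hM).mem_of_tendsto hlim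
      (.of_forall fun k ↦ ?_)
    refine AEStronglyMeasurable.congr ?_ (hps k).symm
    refine StronglyMeasurable.aestronglyMeasurable ?_
    exact Finset.stronglyMeasurable_fun_sum _ fun i _ ↦ (hXm i).stronglyMeasurable.smul_const (b i)
  · have hI : Tendsto (fun k : ℕ ↦ ∫ ω, (∑ i ∈ Finset.range k, u i : Lp H 2 P) ω ∂P) atTop
        (𝓝 (∫ ω, (∑' i, u i : Lp H 2 P) ω ∂P)) := by
      refine tendsto_integral_of_L1 _ (Lp.aestronglyMeasurable _)
        (.of_forall fun k ↦ (Lp.memLp _).integrable one_le_two) ?_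
      have h0 : Tendsto (fun k : ℕ ↦ ‖(∑ i ∈ Finset.range k, u i) - ∑' i, u i‖ₑ) atTop (𝓝 0) :=
        tendsto_iff_enorm_sub_tendsto_zero.1 hlim
      refine tendsto_of_tendsto_of_tendsto_of_le_of_le tendsto_const_nhds h0
        (fun _ ↦ zero_le) fun k ↦ ?_
      rw [Lp.enorm_def]
      refine le_trans ?_ (eLpNorm_le_eLpNorm_of_exponent_le one_le_two
        (Lp.aestronglyMeasurable _))
      rw [eLpNorm_one_eq_lintegral_enorm]
      refine lintegral_mono_ae ?_
      filter_upwards [Lp.coeFn_sub (∑ i ∈ Finset.range k, u i) (∑' i, u i)] with ω h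
      rw [h, Pi.sub_apply]
    refine tendsto_nhds_unique hI ?_
    refine tendsto_const_nhds.congr fun k ↦ ?_
    rw [integral_congr_ae (hps k), integral_finsetSum _ fun i _ ↦ (hmem i).integrable one_le_two]
    refine (Finset.sum_eq_zero fun i _ ↦ ?_).symm
    rw [integral_smul_const, hX0, zero_smul]
  · rw [← esq, ← ofReal_norm, ← ENNReal.ofReal_pow (norm_nonneg _)]
    exact ENNReal.ofReal_le_ofReal hle
  · have h0 : Tendsto (fun k : ℕ ↦ ‖(∑' i, u i) - ∑ i ∈ Finset.range k, u i‖ₑ ^ 2) atTop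
        (𝓝 0) := by
      have := (ENNReal.continuous_pow 2).tendsto 0 |>.comp
        (tendsto_iff_enorm_sub_tendsto_zero.1 hlim)
      refine Tendsto.congr (fun k ↦ ?_) (by simpa using this)
      simp only [Function.comp_apply]
      rw [enorm_sub_rev]
    refine h0.congr fun k ↦ ?_
    rw [esq]
    refine lintegral_congr_ae ?_
    filter_upwards [Lp.coeFn_sub (∑' i, u i) (∑ i ∈ Finset.range k, u i), hps k] with ω h1 h2
    rw [h1, Pi.sub_apply, h2]

/-! ### Second order jets and the noise -/

/-- The components of the second order jet of a function. -/
abbrev Idx2 : Type := Option (Fin 3 ⊕ Fin 3 × Fin 3)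

/-- The Hilbert space in which second order jets live. -/
abbrev Jet2 (D : Set E3) : Type := PiLp 2 (fun _ : Idx2 ↦ L2 D)

section jets

variable {D : Set E3} [IsFiniteMeasure (volume.restrict D)]

variable (D) in
/-- The space of the second order jets of the elements of `H²(D)³`. -/
def jet2 : Submodule ℝ (Jet2 D) where
  carrier := {p | (∀ i, HasWeakPartial D i (p none) (p (some (.inl i)))) ∧
    ∀ i j, HasWeakPartial D j (p (some (.inl i))) (p (some (.inr (i, j))))}
  add_mem' hp hq := ⟨fun i ↦ (hp.1 i).add (hq.1 i), fun i j ↦ (hp.2 i j).add (hq.2 i j)⟩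
  zero_mem' := ⟨fun i ↦ HasWeakPartial.zero i, fun _ j ↦ HasWeakPartial.zero j⟩
  smul_mem' r _ hp := ⟨fun i ↦ (hp.1 i).smul r, fun i j ↦ (hp.2 i j).smul r⟩

lemma isClosed_jet2 : IsClosed (jet2 D : Set (Jet2 D)) := by
  have h : (jet2 D : Set (Jet2 D))
      = (⋂ i, {p | HasWeakPartial D i (p none) (p (some (.inl i)))})
        ∩ ⋂ i, ⋂ j, {p | HasWeakPartial D j (p (some (.inl i))) (p (some (.inr (i, j))))} := by
    ext p
    simp only [Set.mem_inter_iff, Set.mem_iInter]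
    rfl
  rw [h]
  exact (isClosed_iInter fun i ↦ isClosed_hasWeakPartial i (by fun_prop) (by fun_prop)).inter
    (isClosed_iInter fun i ↦ isClosed_iInter fun j ↦
      isClosed_hasWeakPartial j (by fun_prop) (by fun_prop))

instance : CompleteSpace (jet2 D) := isClosed_jet2.completeSpace_coe

/-- The jet of an element of `H²(D)³`. -/
def toJet2 (f : L2 D) (hf : MemH2 D f) : jet2 D :=
  ⟨WithLp.toLp 2 fun o ↦ o.elim f (Sum.elim (fun i ↦ weakPartial D i f)
    fun q ↦ weakPartial D q.2 (weakPartial D q.1 f)),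
    fun i ↦ hf.1.hasWeakPartial i, fun i j ↦ (hf.2 i).hasWeakPartial j⟩

/-- A component of a jet. -/
def jetProj (o : Idx2) : jet2 D →L[ℝ] L2 D :=
  (PiLp.proj 2 (fun _ : Idx2 ↦ L2 D) o).comp (jet2 D).subtypeL

lemma jetProj_apply (o : Idx2) (p : jet2 D) : jetProj o p = p.1 o := rfl

lemma enorm_jetProj_le (o : Idx2) (p : jet2 D) : ‖jetProj o p‖ₑ ≤ ‖p‖ₑ := by
  rw [← ofReal_norm, ← ofReal_norm]
  exact ENNReal.ofReal_le_ofReal (PiLp.norm_apply_le p.1 o)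

lemma memH2_jet (hD : IsOpen D) (p : jet2 D) : MemH2 D (jetProj none p) := by
  refine ⟨fun i ↦ ⟨_, p.2.1 i⟩, fun i ↦ ?_⟩
  rw [jetProj_apply, (p.2.1 i).weakPartial_eq hD]
  exact fun j ↦ ⟨_, p.2.2 i j⟩

lemma weakPartial_jet (hD : IsOpen D) (p : jet2 D) (i : Fin 3) :
    weakPartial D i (jetProj none p) = jetProj (some (.inl i)) p :=
  (p.2.1 i).weakPartial_eq hD

lemma h2Sq_jet (hD : IsOpen D) (p : jet2 D) : h2Sq D (jetProj none p) = ‖p‖ₑ ^ 2 := by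
  have hn : ‖p‖ₑ ^ 2 = ∑ o, ‖jetProj o p‖ₑ ^ 2 := by
    have h : ‖p‖₊ ^ 2 = ∑ o, ‖jetProj o p‖₊ ^ 2 := by
      ext
      push_cast
      exact PiLp.norm_sq_eq_of_L2 (fun _ : Idx2 ↦ L2 D) p.1
    simp only [enorm_eq_nnnorm]
    exact_mod_cast h
  have h := memH2_jet hD p
  have hg : ∀ i, gradSq D (jetProj (some (.inl i)) p)
      = ∑ j, ‖jetProj (some (.inr (i, j))) p‖ₑ ^ 2 := by
    intro i
    rw [gradSq, if_pos (by simpa only [weakPartial_jet hD] using h.2 i)]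
    refine Finset.sum_congr rfl fun j _ ↦ ?_
    rw [jetProj_apply, (p.2.2 i j).weakPartial_eq hD, jetProj_apply]
  rw [hn, h2Sq, gradSq, if_pos h.1, Fintype.sum_option, Fintype.sum_sum_type,
    Fintype.sum_prod_type, add_assoc]
  simp only [weakPartial_jet hD, hg]

end jets

section noise

variable {Ω : Type*} [MeasurableSpace Ω] {P : Measure Ω}

lemma enorm_add_sq_le {E : Type*} [NormedAddCommGroup E] (a b : E) :
    ‖a + b‖ₑ ^ 2 ≤ 2 * ‖a‖ₑ ^ 2 + 2 * ‖b‖ₑ ^ 2 := by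
  have h : ‖a + b‖₊ ^ 2 ≤ 2 * ‖a‖₊ ^ 2 + 2 * ‖b‖₊ ^ 2 := by
    rw [← mul_add]
    exact le_trans (by gcongr; exact nnnorm_add_le a b) add_sq_le
  simp only [enorm_eq_nnnorm]
  exact_mod_cast h

lemma tendsto_lintegral_enorm_sq_add {E : Type*} [NormedAddCommGroup E] {f g : ℕ → Ω → E}
    (hfm : ∀ k, AEStronglyMeasurable (f k) P)
    (hf : Tendsto (fun k ↦ ∫⁻ ω, ‖f k ω‖ₑ ^ 2 ∂P) atTop (𝓝 0))
    (hg : Tendsto (fun k ↦ ∫⁻ ω, ‖g k ω‖ₑ ^ 2 ∂P) atTop (𝓝 0)) :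
    Tendsto (fun k ↦ ∫⁻ ω, ‖f k ω + g k ω‖ₑ ^ 2 ∂P) atTop (𝓝 0) := by
  have h2 : Tendsto (fun k ↦ 2 * ∫⁻ ω, ‖f k ω‖ₑ ^ 2 ∂P + 2 * ∫⁻ ω, ‖g k ω‖ₑ ^ 2 ∂P) atTop
      (𝓝 0) := by
    have := (ENNReal.Tendsto.const_mul (a := 2) hf (.inr ENNReal.ofNat_ne_top)).add
      (ENNReal.Tendsto.const_mul (a := 2) hg (.inr ENNReal.ofNat_ne_top))
    simpa using this
  refine tendsto_of_tendsto_of_tendsto_of_le_of_le tendsto_const_nhds h2 (fun _ ↦ zero_le)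
    fun k ↦ ?_
  dsimp only
  rw [← lintegral_const_mul' _ _ (by simp), ← lintegral_const_mul' _ _ (by simp),
    ← lintegral_add_left' (((hfm k).enorm.pow_const 2).const_mul 2)]
  refine lintegral_mono fun ω ↦ ?_
  exact enorm_add_sq_le _ _

/-- The increment is given only as a limit in L². Summing the same series in the Hilbert space of
second order jets, whose norm is the H² norm, provides H² regularity, second moment and centred
derivatives at once. -/
lemma exists_jet_noise [IsProbabilityMeasure P] {D : Set E3} (hD : IsOpen D)
    [IsFiniteMeasure (volume.restrict D)] {T K : ℝ≥0} {e : HilbertBasis ℕ ℝ (L2 D)}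
    {G : L2 D →L[ℝ] L2 D} (hG : ∀ f, MemH2 D (G f)) (hK : hsSq D e G ≤ (K : ℝ≥0∞) ^ 2)
    {β : ℕ → ℝ≥0 → Ω → ℝ} {GW : ℝ≥0 → Ω → L2 D} (hβ : IsCylindricalWiener P T β)
    (hGW : IsGW P T D e G β GW) {N n : ℕ} (hn : n < N) :
    ∃ η : Ω → jet2 D, AEStronglyMeasurable[present T (dt T N) β n] η P ∧ MemLp η 2 P ∧
      ∫ ω, η ω ∂P = 0 ∧ ∫⁻ ω, ‖η ω‖ₑ ^ 2 ∂P ≤ dt T N * (K : ℝ≥0∞) ^ 2 ∧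
      ∀ᵐ ω ∂P, jetProj none (η ω) = incr T N GW n ω := by
  have hN : (N : ℝ≥0) ≠ 0 := by
    have : N ≠ 0 := by omega
    exact_mod_cast this
  have ht1 : ((n + 1 : ℕ) : ℝ≥0) * dt T N ≤ T := by
    calc ((n + 1 : ℕ) : ℝ≥0) * dt T N ≤ N * dt T N := by
          gcongr
          exact_mod_cast hn
      _ = T := by rw [dt]; field_simp
  have ht0 : (n : ℝ≥0) * dt T N ≤ T := le_trans (by gcongr; simp) ht1
  let b : ℕ → jet2 D := fun i ↦ toJet2 (G (e i)) (hG _)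
  have hbe : ∀ i, ‖b i‖ₑ ^ 2 = h2Sq D (G (e i)) := fun i ↦ (h2Sq_jet hD (b i)).symm
  have hbs : ∑' i, ‖b i‖ₑ ^ 2 ≤ (K : ℝ≥0∞) ^ 2 := by
    simp_rw [hbe]
    exact hK
  have hbo : ∀ i, ENNReal.ofReal (‖b i‖ ^ 2) = ‖b i‖ₑ ^ 2 := fun i ↦ by
    rw [ENNReal.ofReal_pow (norm_nonneg _), ofReal_norm]
  have hsum : Summable fun i ↦ ‖b i‖ ^ 2 := by
    refine (ENNReal.summable_toReal (f := fun i ↦ ‖b i‖ₑ ^ 2)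
      (ne_top_of_le_ne_top (by simp) hbs)).congr fun i ↦ ?_
    simp
  obtain ⟨η, h1, h2, h3, h4, h5⟩ := exists_random_series (hβ.present_le (dt T N) n)
    (X := fun i ↦ bmIncr T (dt T N) (β i) n) (measurable_present T (dt T N) β n)
    (fun i ↦ (hβ.brownian i).memLp_bmIncr n) (fun i ↦ (hβ.brownian i).integral_bmIncr n)
    (fun i ↦ (hβ.brownian i).integral_bmIncr_sq ht1)
    (fun i j hij ↦ hβ.integral_bmIncr_mul (dt T N) hij n) hsum
  refine ⟨η, h1, h2, h3, h4.trans ?_, ?_⟩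
  · rw [ENNReal.ofReal_mul (by positivity), ENNReal.ofReal_tsum_of_nonneg (fun _ ↦ sq_nonneg _)
      hsum, ENNReal.ofReal_coe_nnreal]
    simp_rw [hbo]
    gcongr
  · let S : ℝ≥0 → ℕ → Ω → L2 D := fun t k ω ↦ ∑ i ∈ Finset.range k, β i t ω • G (e i)
    have hSm : ∀ t ≤ T, ∀ k, AEStronglyMeasurable (S t k) P := fun t ht k ↦
      (Finset.stronglyMeasurable_fun_sum _ fun i _ ↦
        (((hβ.brownian i).measurable t ht).stronglyMeasurable.smul_const _)).aestronglyMeasurable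
    have hdiff : ∀ k ω, ∑ i ∈ Finset.range k, bmIncr T (dt T N) (β i) n ω • G (e i)
        = S ((n + 1 : ℕ) * dt T N) k ω - S (n * dt T N) k ω := by
      intro k ω
      simp only [S, ← Finset.sum_sub_distrib, ← sub_smul]
      exact Finset.sum_congr rfl fun i _ ↦ by rw [bmIncr_eq ht1]
    have hproj : ∀ k ω, jetProj none (∑ i ∈ Finset.range k, bmIncr T (dt T N) (β i) n ω • b i)
        = S ((n + 1 : ℕ) * dt T N) k ω - S (n * dt T N) k ω := by
      intro k ω
      rw [← hdiff, map_sum]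
      exact Finset.sum_congr rfl fun i _ ↦ by rw [map_smul]; rfl
    have hη : Tendsto (fun k ↦ ∫⁻ ω, ‖jetProj none (η ω)
        - (S ((n + 1 : ℕ) * dt T N) k ω - S (n * dt T N) k ω)‖ₑ ^ 2 ∂P) atTop (𝓝 0) := by
      refine tendsto_of_tendsto_of_tendsto_of_le_of_le tendsto_const_nhds h5
        (fun _ ↦ zero_le) fun k ↦ lintegral_mono fun ω ↦ ?_
      dsimp only
      rw [← hproj, ← map_sub]
      gcongr
      exact enorm_jetProj_le _ _
    have hneg : Tendsto (fun k ↦ ∫⁻ ω, ‖-(GW ((n + 1 : ℕ) * dt T N) ω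
        - S ((n + 1 : ℕ) * dt T N) k ω)‖ₑ ^ 2 ∂P) atTop (𝓝 0) := by
      simp_rw [enorm_neg]
      exact hGW.tendsto _ ht1
    -- The difference between the first jet component and the increment does not depend on k, yet is
    -- a sum of three terms tending to zero in mean square.
    have h6 := tendsto_lintegral_enorm_sq_add
      (fun k ↦ ((hGW.aestronglyMeasurable _ ht1).sub (hSm _ ht1 k)).neg) hneg
      (tendsto_lintegral_enorm_sq_add
        (fun k ↦ (hGW.aestronglyMeasurable _ ht0).sub (hSm _ ht0 k)) (hGW.tendsto _ ht0) hη)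
    have h7 : ∫⁻ ω, ‖jetProj none (η ω) - incr T N GW n ω‖ₑ ^ 2 ∂P = 0 := by
      refine tendsto_nhds_unique (tendsto_const_nhds.congr fun k ↦ ?_) h6
      refine lintegral_congr fun ω ↦ ?_
      congr 2
      simp only [incr, Pi.neg_apply, Pi.sub_apply]
      abel
    have hm : AEStronglyMeasurable (fun ω ↦ jetProj none (η ω) - incr T N GW n ω) P :=
      ((jetProj none).continuous.comp_aestronglyMeasurable h2.1).sub
        ((hGW.aestronglyMeasurable _ ht1).sub (hGW.aestronglyMeasurable _ ht0))
    rw [lintegral_eq_zero_iff' (hm.enorm.pow_const 2)] at h7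
    filter_upwards [h7] with ω hω
    simpa [sub_eq_zero] using hω

end noise

/-! ### The energy inequality in the mean -/

section measurability

variable {D : Set E3} [IsFiniteMeasure (volume.restrict D)]

lemma measurable_gradSq (hD : IsOpen D) : Measurable (gradSq D) := by
  choose d hd hdw using fun i ↦ exists_measurable_weakPartial (D := D) hD i
  have h : Measurable fun f : L2 D ↦ ∑ i, ‖d i f‖ₑ ^ 2 :=
    Finset.measurable_fun_sum _ fun i _ ↦ (hd i).enorm.pow_const 2
  classical
  have e : gradSq D = {f : L2 D | MemH1 D f}.piecewise (fun f ↦ ∑ i, ‖d i f‖ₑ ^ 2)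
      (fun _ ↦ ⊤) := by
    funext f
    by_cases hf : MemH1 D f
    · rw [Set.piecewise_eq_of_mem _ _ _ hf, gradSq_of_memH1 hf]
      exact Finset.sum_congr rfl fun i _ ↦ by rw [hdw i f hf]
    · rw [Set.piecewise_eq_of_notMem _ _ _ hf, gradSq, if_neg hf]
  rw [e]
  exact h.piecewise (measurableSet_memH1 hD) measurable_const

/-- The cross product with a field of unit vectors is a Borel map. -/
lemma exists_measurable_crossL :
    ∃ c : L2 D × L2 D → L2 D, Measurable c ∧ ∀ m f : L2 D,
      (∀ᵐ x ∂(volume.restrict D), ‖m x‖ = 1) → c (m, f) = crossL m f := by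
  let X : Set (L2 D × L2 D) := {q | ∀ᵐ x ∂(volume.restrict D), ‖q.1 x‖ = 1}
  have hX : IsClosed X := isClosed_norm_eq_one.preimage continuous_fst
  have hc : Continuous (fun q : X ↦ crossL q.1.1 q.1.2) :=
    continuous_crossL (by fun_prop) (by fun_prop) fun q ↦ essBdd_of_norm_eq_one q.2
  obtain ⟨c, hc1, hc2⟩ := (MeasurableEmbedding.subtype_coe hX.measurableSet).exists_measurable_extend
    hc.measurable fun _ ↦ inferInstance
  exact ⟨c, hc1, fun m f hm ↦ congrFun hc2 ⟨(m, f), hm⟩⟩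

variable (D) in
/-- The pointwise projection on the unit ball, as a map of `L²(D)³`. -/
def ballProjL (f : L2 D) : L2 D := lipschitzWith_ballProj.compLp ballProj_zero f

lemma coeFn_ballProjL {D : Set E3} (f : L2 D) :
    ∀ᵐ x ∂(volume.restrict D), ballProjL D f x = ballProj (f x) :=
  lipschitzWith_ballProj.coeFn_compLp ballProj_zero f

lemma continuous_ballProjL {D : Set E3} : Continuous (ballProjL D) :=
  lipschitzWith_ballProj.continuous_compLp ballProj_zero

lemma gradReal_jet_le (hD : IsOpen D) (p : jet2 D) : gradReal D (jetProj none p) ≤ ‖p‖ ^ 2 := by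
  have h : gradSq D (jetProj none p) ≤ ‖p‖ₑ ^ 2 := by
    rw [← h2Sq_jet hD, h2Sq]
    exact le_add_right le_add_self
  rw [gradSq_eq_ofReal (memH2_jet hD p).1, ← ofReal_norm, ← ENNReal.ofReal_pow (norm_nonneg _)] at h
  exact (ENNReal.ofReal_le_ofReal_iff (by positivity)).1 h

end measurability

section expectation

variable {Ω : Type*} {F M : MeasurableSpace Ω} [mΩ : MeasurableSpace Ω] {P : Measure Ω}

/-- The signed Z can vanish only in a Bochner integral, so the estimate passes from lower integrals
to integrals and back. X need not be measurable. -/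
lemma lintegral_ofReal_le_of_integral_eq_zero {X R Z : Ω → ℝ} (hX : ∀ᵐ ω ∂P, 0 ≤ X ω)
    (hXR : ∀ᵐ ω ∂P, X ω ≤ R ω + Z ω) (hR : AEStronglyMeasurable R P) (hR0 : ∀ ω, 0 ≤ R ω)
    (hZ : Integrable Z P) (hZ0 : ∫ ω, Z ω ∂P = 0) :
    ∫⁻ ω, ENNReal.ofReal (X ω) ∂P ≤ ∫⁻ ω, ENNReal.ofReal (R ω) ∂P := by
  by_cases h : ∫⁻ ω, ENNReal.ofReal (R ω) ∂P = ⊤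
  · rw [h]
    exact le_top
  have hRi : Integrable R P :=
    ⟨hR, (hasFiniteIntegral_iff_ofReal (.of_forall hR0)).2 (lt_top_iff_ne_top.2 h)⟩
  calc ∫⁻ ω, ENNReal.ofReal (X ω) ∂P ≤ ∫⁻ ω, ENNReal.ofReal (R ω + Z ω) ∂P :=
        lintegral_mono_ae (hXR.mono fun ω h ↦ ENNReal.ofReal_le_ofReal h)
    _ = ENNReal.ofReal (∫ ω, (R ω + Z ω) ∂P) := by
        refine (ofReal_integral_eq_lintegral_ofReal (hRi.add hZ) ?_).symm
        filter_upwards [hX, hXR] with ω h1 h2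
        exact h1.trans h2
    _ = ENNReal.ofReal (∫ ω, R ω ∂P) := by rw [integral_add hRi hZ, hZ0, add_zero]
    _ = ∫⁻ ω, ENNReal.ofReal (R ω) ∂P := ofReal_integral_eq_lintegral_ofReal hRi (.of_forall hR0)

/-- Independence gives E(Y, ζ) = (EY, Eζ) and takes the place of a conditional expectation. -/
lemma integrable_inner_of_indep [IsFiniteMeasure P] {H : Type*} [NormedAddCommGroup H]
    [InnerProductSpace ℝ H] [CompleteSpace H] [MeasurableSpace H] [BorelSpace H]
    (hFM : Indep F M P) {Y ζ : Ω → H} (hYm : Measurable[F] Y) (hζm : Measurable[M] ζ)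
    (hY : MemLp Y 2 P) (hζ : MemLp ζ 2 P) (hζ0 : ∫ ω, ζ ω ∂P = 0) :
    Integrable (fun ω ↦ inner ℝ (Y ω) (ζ ω)) P ∧ ∫ ω, inner ℝ (Y ω) (ζ ω) ∂P = 0 := by
  have hind : IndepFun Y ζ P := by
    rw [IndepFun_iff_Indep]
    exact indep_of_indep_of_le_left (indep_of_indep_of_le_right hFM
      (measurable_iff_comap_le.1 hζm)) (measurable_iff_comap_le.1 hYm)
  have h := hind.integral_bilin (hY.integrable one_le_two) (hζ.integrable one_le_two)
    (innerSL ℝ (E := H))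
  rw [hζ0, map_zero] at h
  exact ⟨hind.integrable_bilin (hY.integrable one_le_two) (hζ.integrable one_le_two)
    (innerSL ℝ (E := H)), h⟩

variable {D : Set E3}

lemma ofReal_bound_le {H : Type*} [NormedAddCommGroup H] {a s : ℝ} (ha : 0 ≤ a) (hs : 0 ≤ s)
    (C : ℝ≥0) (γ : ℝ≥0∞) (p : H) :
    ENNReal.ofReal (γ.toReal + a * (C * (γ.toReal * ‖p‖ ^ 2) + ‖p‖ ^ 2) + s)
      ≤ γ + ENNReal.ofReal a * (C * (γ * ‖p‖ₑ ^ 2) + ‖p‖ₑ ^ 2) + ENNReal.ofReal s := by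
  have h1 : 0 ≤ γ.toReal := ENNReal.toReal_nonneg
  have h2 : ENNReal.ofReal γ.toReal ≤ γ := ENNReal.ofReal_toReal_le
  rw [ENNReal.ofReal_add (by positivity) hs, ENNReal.ofReal_add h1
    (by positivity), ENNReal.ofReal_mul ha, ENNReal.ofReal_add (by positivity)
    (by positivity), ENNReal.ofReal_mul (p := (C : ℝ)) C.2, ENNReal.ofReal_mul h1,
    ENNReal.ofReal_pow (norm_nonneg _), ofReal_norm, ENNReal.ofReal_coe_nnreal]
  gcongr

lemma normSq_sub_noiseTerm {m v ξ : L2 D} (hm : ∀ᵐ x ∂(volume.restrict D), ‖m x‖ = 1) :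
    normSq D (fun x ↦ v x - noiseTerm m ξ x) = ‖v - crossL m ξ‖ₑ ^ 2 := by
  rw [← normSq_eq]
  refine lintegral_congr_ae ?_
  filter_upwards [Lp.coeFn_sub v (crossL m ξ), coeFn_crossL_left (essBdd_of_norm_eq_one hm) ξ]
    with x e1 e2
  rw [e1, Pi.sub_apply, e2, noiseTerm]

/-- Superadditivity of the lower integral holds without measurability, and this is the direction
needed. -/
lemma lintegral_energy_le_lintegral_ofReal (hD : IsOpen D) (hb : Bornology.IsBounded D)
    [IsFiniteMeasure (volume.restrict D)] {a b : ℝ} (ha : 0 ≤ a) (hb0 : 0 ≤ b)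
    {m m' v ξ : Ω → L2 D}
    (hm : ∀ᵐ ω ∂P, MemH1 D (m ω) ∧ ∀ᵐ x ∂(volume.restrict D), ‖m ω x‖ = 1)
    (hv : ∀ᵐ ω ∂P, v ω ∈ tangentSpace D (m ω))
    (hr : ∀ᵐ ω ∂P, ∀ᵐ x ∂(volume.restrict D),
      m' ω x = (‖m ω x + v ω x‖⁻¹ : ℝ) • (m ω x + v ω x)) :
    (∫⁻ ω, gradSq D (m' ω) ∂P)
        + ENNReal.ofReal a *
          (∫⁻ ω, normSq D (fun x ↦ v ω x - noiseTerm (m ω) (ξ ω) x) ∂P)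
        + ENNReal.ofReal b * (∫⁻ ω, gradSq D (v ω) ∂P)
      ≤ ∫⁻ ω, ENNReal.ofReal (gradReal D (m' ω) + a * ‖v ω - crossL (m ω) (ξ ω)‖ ^ 2
        + b * gradReal D (v ω)) ∂P := by
  have e : ∫⁻ ω, ENNReal.ofReal (gradReal D (m' ω) + a * ‖v ω - crossL (m ω) (ξ ω)‖ ^ 2
        + b * gradReal D (v ω)) ∂P = ∫⁻ ω, (gradSq D (m' ω)
        + ENNReal.ofReal a * normSq D (fun x ↦ v ω x - noiseTerm (m ω) (ξ ω) x)
        + ENNReal.ofReal b * gradSq D (v ω)) ∂P := by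
    refine lintegral_congr_ae ?_
    filter_upwards [hm, hv, hr] with ω h1 h5 h6
    have hm'1 := (step_renorm hD hb h1.1 h1.2 h5 h6).2.2.1
    have hg1 := gradReal_nonneg (m' ω)
    have hg2 := gradReal_nonneg (v ω)
    rw [ENNReal.ofReal_add (by positivity) (mul_nonneg hb0 hg2), ENNReal.ofReal_add hg1
      (by positivity), ENNReal.ofReal_mul ha, ENNReal.ofReal_mul hb0, normSq_sub_noiseTerm h1.2,
      gradSq_eq_ofReal hm'1, gradSq_eq_ofReal h5.1, ENNReal.ofReal_pow (norm_nonneg _),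
      ofReal_norm]
  rw [e]
  refine le_trans ?_ (le_lintegral_add _ _)
  gcongr
  · refine le_trans ?_ (le_lintegral_add _ _)
    gcongr
    exact lintegral_const_mul_le _ _
  · exact lintegral_const_mul_le _ _

lemma lintegral_step_le [IsProbabilityMeasure P] (hD : IsOpen D) (hb : Bornology.IsBounded D)
    [IsFiniteMeasure (volume.restrict D)] {θ τ ε : ℝ} (hτ : 0 < τ) (hε : 0 < ε) (hε1 : ε ≤ 1)
    (hεθ : 0 ≤ 2 * θ - 1 - ε) (hF : F ≤ mΩ) (hM : M ≤ mΩ) (hFM : Indep F M P)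
    {m m' v ξ mt : Ω → L2 D} (hmt : Measurable[F] mt) (hmm : m =ᵐ[P] mt)
    (hm : ∀ᵐ ω ∂P, MemH1 D (m ω) ∧ ∀ᵐ x ∂(volume.restrict D), ‖m ω x‖ = 1)
    {η : Ω → jet2 D} (hη : AEStronglyMeasurable[M] η P) (hη2 : MemLp η 2 P)
    (hη0 : ∫ ω, η ω ∂P = 0) (hηξ : ∀ᵐ ω ∂P, jetProj none (η ω) = ξ ω)
    {g : ℕ → L2 D} (hs : ∀ᵐ ω ∂P, IsStep D θ τ g (ξ ω) (m ω) (v ω))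
    (hr : ∀ᵐ ω ∂P, ∀ᵐ x ∂(volume.restrict D),
      m' ω x = (‖m ω x + v ω x‖⁻¹ : ℝ) • (m ω x + v ω x))
    {b : ℕ → ℝ} (hb0 : ∀ i, 0 ≤ b i) (hg : ∀ i, EssBdd D (b i) (g i)) {S : ℝ}
    (hS : HasSum (fun i ↦ b i * ‖g i‖) S) {Cs : ℝ≥0}
    (hCs : ∀ f : L2 D, MemH2 D f → EssBdd D (Real.sqrt (Cs * (h2Sq D f).toReal)) f)
    (hfin : ∫⁻ ω, gradSq D (m ω) ∂P ≠ ⊤) :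
    (∫⁻ ω, gradSq D (m' ω) ∂P)
        + ENNReal.ofReal ((1 - ε) / τ) *
          (∫⁻ ω, normSq D (fun x ↦ v ω x - noiseTerm (m ω) (ξ ω) x) ∂P)
        + ENNReal.ofReal (2 * θ - 1 - ε) * (∫⁻ ω, gradSq D (v ω) ∂P)
      ≤ (∫⁻ ω, gradSq D (m ω) ∂P) + ENNReal.ofReal (2 * θ ^ 2 / ε) *
          (Cs * ((∫⁻ ω, gradSq D (m ω) ∂P) * ∫⁻ ω, ‖η ω‖ₑ ^ 2 ∂P) + ∫⁻ ω, ‖η ω‖ₑ ^ 2 ∂P)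
        + ENNReal.ofReal (S ^ 2 / (4 * ε) * τ) := by
  choose d hd hdw using fun i ↦ exists_measurable_weakPartial (D := D) hD i
  obtain ⟨c, hc, hcw⟩ := exists_measurable_crossL (D := D)
  let ηt : Ω → jet2 D := hη.mk η
  have hηt : StronglyMeasurable[M] ηt := hη.stronglyMeasurable_mk
  have hηη : η =ᵐ[P] ηt := hη.ae_eq_mk
  -- As m × is skew, (∂ᵢm, m × ∂ᵢξ) = −(m × ∂ᵢm, ∂ᵢξ). This separates a past factor from a present
  -- one and explains the −2 in Z.
  let Y : Fin 3 → Ω → L2 D := fun i ω ↦ c (mt ω, d i (mt ω))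
  let ζ : Fin 3 → Ω → L2 D := fun i ω ↦ jetProj (some (.inl i)) (ηt ω)
  have hYm : ∀ i, Measurable[F] (Y i) := fun i ↦ hc.comp (hmt.prodMk ((hd i).comp hmt))
  have hζm : ∀ i, Measurable[M] (ζ i) := fun i ↦
    ((jetProj (some (.inl i))).continuous.comp_stronglyMeasurable hηt).measurable
  have hGm : Measurable[F] fun ω ↦ gradSq D (mt ω) := (measurable_gradSq hD).comp hmt
  have hEm : Measurable[M] fun ω ↦ ‖ηt ω‖ₑ ^ 2 := hηt.enorm.pow_const 2
  have eG : ∫⁻ ω, gradSq D (m ω) ∂P = ∫⁻ ω, gradSq D (mt ω) ∂P :=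
    lintegral_congr_ae (hmm.mono fun ω h ↦ by simp only [h])
  have eE : ∫⁻ ω, ‖η ω‖ₑ ^ 2 ∂P = ∫⁻ ω, ‖ηt ω‖ₑ ^ 2 ∂P :=
    lintegral_congr_ae (hηη.mono fun ω h ↦ by simp only [h])
  have hmt' : ∀ᵐ ω ∂P, MemH1 D (mt ω) ∧ ∀ᵐ x ∂(volume.restrict D), ‖mt ω x‖ = 1 := by
    filter_upwards [hm, hmm] with ω h1 h2
    rwa [← h2]
  have hηt2 : MemLp ηt 2 P := hη2.ae_eq hηη
  have hζ2 : ∀ i, MemLp (ζ i) 2 P := fun i ↦ (jetProj (some (.inl i))).comp_memLp' hηt2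
  have hζ0 : ∀ i, ∫ ω, ζ i ω ∂P = 0 := by
    intro i
    have := (jetProj (D := D) (some (.inl i))).integral_comp_comm (hηt2.integrable one_le_two)
    rw [← integral_congr_ae hηη, hη0, map_zero] at this
    exact this
  have hY2 : ∀ i, MemLp (Y i) 2 P := by
    intro i
    refine ⟨((hYm i).mono hF le_rfl).aestronglyMeasurable, ?_⟩
    have hle : ∫⁻ ω, ‖Y i ω‖ₑ ^ 2 ∂P ≤ ∫⁻ ω, gradSq D (mt ω) ∂P := by
      refine lintegral_mono_ae ?_
      filter_upwards [hmt'] with ω h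
      have h1 : ‖Y i ω‖ ≤ ‖weakPartial D i (mt ω)‖ := by
        simp only [Y]
        rw [hcw _ _ h.2, hdw i _ h.1]
        simpa using norm_crossL_le_left (essBdd_of_norm_eq_one h.2) (weakPartial D i (mt ω))
      have h2 : ‖Y i ω‖ₑ ≤ ‖weakPartial D i (mt ω)‖ₑ := by
        rw [← ofReal_norm, ← ofReal_norm]
        exact ENNReal.ofReal_le_ofReal h1
      rw [gradSq_of_memH1 h.1]
      exact le_trans (by gcongr) (Finset.single_le_sum
        (f := fun i ↦ ‖weakPartial D i (mt ω)‖ₑ ^ 2) (fun _ _ ↦ zero_le) (Finset.mem_univ i))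
    rw [eLpNorm_lt_top_iff_lintegral_rpow_enorm_lt_top (by norm_num) (by norm_num)]
    simp only [ENNReal.toReal_ofNat, ENNReal.rpow_ofNat]
    exact hle.trans_lt (lt_top_iff_ne_top.2 (eG ▸ hfin))
  have hYζ : ∀ i, Integrable (fun ω ↦ inner ℝ (Y i ω) (ζ i ω)) P := fun i ↦
    (integrable_inner_of_indep hFM (hYm i) (hζm i) (hY2 i) (hζ2 i) (hζ0 i)).1
  have hYζ0 : ∀ i, ∫ ω, inner ℝ (Y i ω) (ζ i ω) ∂P = 0 := fun i ↦
    (integrable_inner_of_indep hFM (hYm i) (hζm i) (hY2 i) (hζ2 i) (hζ0 i)).2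
  let Z : Ω → ℝ := fun ω ↦ -2 * ∑ i, inner ℝ (Y i ω) (ζ i ω)
  have hZ : Integrable Z P := (integrable_finsetSum _ fun i _ ↦ hYζ i).const_mul _
  have hZ0 : ∫ ω, Z ω ∂P = 0 := by
    simp only [Z]
    rw [integral_const_mul, integral_finsetSum _ fun i _ ↦ hYζ i]
    simp [hYζ0]
  let γ : Ω → ℝ := fun ω ↦ (gradSq D (mt ω)).toReal
  have hγm : Measurable γ := (hGm.mono hF le_rfl).ennreal_toReal
  let R : Ω → ℝ := fun ω ↦ γ ω + 2 * θ ^ 2 / ε * (Cs * (γ ω * ‖ηt ω‖ ^ 2) + ‖ηt ω‖ ^ 2)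
    + S ^ 2 / (4 * ε) * τ
  have hηn : Measurable fun ω ↦ ‖ηt ω‖ ^ 2 :=
    ((hηt.mono hM).norm.measurable).pow_const 2
  have hR : AEStronglyMeasurable R P := by
    refine Measurable.aestronglyMeasurable ?_
    exact (hγm.add ((((hγm.mul hηn).const_mul _).add hηn).const_mul _)).add_const _
  have hγ0 : ∀ ω, 0 ≤ γ ω := fun ω ↦ ENNReal.toReal_nonneg
  have hR0 : ∀ ω, 0 ≤ R ω := fun ω ↦ by
    have := hγ0 ω
    positivity
  let X : Ω → ℝ := fun ω ↦ gradReal D (m' ω) + (1 - ε) / τ * ‖v ω - crossL (m ω) (ξ ω)‖ ^ 2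
    + (2 * θ - 1 - ε) * gradReal D (v ω)
  have h1ε : 0 ≤ (1 - ε) / τ := div_nonneg (by linarith) hτ.le
  have hX0 : ∀ ω, 0 ≤ X ω := fun ω ↦ by
    have h1 := gradReal_nonneg (m' ω)
    have h2 := gradReal_nonneg (v ω)
    positivity
  have hXR : ∀ᵐ ω ∂P, X ω ≤ R ω + Z ω := by
    filter_upwards [hm, hmm, hηη, hηξ, hs, hr] with ω h1 h2 h3 h4 h5 h6
    have hH2 : MemH2 D (ξ ω) := h4 ▸ memH2_jet hD _
    have hh : (h2Sq D (ξ ω)).toReal = ‖ηt ω‖ ^ 2 := by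
      rw [← h4, h2Sq_jet hD, ← h3]
      simp
    have key := step_energy hD hb hτ hε h1.1 h1.2 h5 h6 hH2.1 (hCs _ hH2) hb0 hg hS
    rw [hh, Real.sq_sqrt (by positivity)] at key
    have hgr : gradReal D (ξ ω) ≤ ‖ηt ω‖ ^ 2 := by
      rw [← h4, ← h3]
      exact gradReal_jet_le hD _
    have hγe : γ ω = gradReal D (m ω) := by
      simp only [γ]
      rw [← h2, gradSq_eq_ofReal h1.1, ENNReal.toReal_ofReal (gradReal_nonneg _)]
    have hZe : Z ω = 2 * ∑ i, inner ℝ (weakPartial D i (m ω))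
        (crossL (m ω) (weakPartial D i (ξ ω))) := by
      simp only [Z, Y, ζ]
      rw [neg_mul, ← mul_neg, ← Finset.sum_neg_distrib]
      congr 1
      refine Finset.sum_congr rfl fun i _ ↦ ?_
      rw [← h2, hcw _ _ h1.2, hdw i _ h1.1, ← h3, ← weakPartial_jet hD, h4,
        inner_crossL_left (essBdd_of_norm_eq_one h1.2), neg_neg]
    have hA : 0 ≤ 2 * θ ^ 2 / ε := by positivity
    have h7 : 2 * θ ^ 2 / ε * (Cs * ‖ηt ω‖ ^ 2 * gradReal D (m ω) + gradReal D (ξ ω))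
        ≤ 2 * θ ^ 2 / ε * (Cs * (γ ω * ‖ηt ω‖ ^ 2) + ‖ηt ω‖ ^ 2) := by
      rw [hγe]
      gcongr ?_ * (?_ + ?_)
      exact le_of_eq (by ring)
    simp only [X, R]
    rw [hZe, hγe] at *
    linarith
  have main := lintegral_ofReal_le_of_integral_eq_zero (.of_forall hX0) hXR hR hR0 hZ hZ0
  have hlow := lintegral_energy_le_lintegral_ofReal (P := P) hD hb h1ε hεθ hm (hs.mono fun ω h ↦ h.mem)
    hr (ξ := ξ)
  refine hlow.trans (main.trans ?_)
  have hS0 : 0 ≤ S ^ 2 / (4 * ε) * τ := by positivity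
  have hA0 : 0 ≤ 2 * θ ^ 2 / ε := by positivity
  have hup : ∀ ω, ENNReal.ofReal (R ω) ≤ gradSq D (mt ω) + ENNReal.ofReal (2 * θ ^ 2 / ε) *
      (Cs * (gradSq D (mt ω) * ‖ηt ω‖ₑ ^ 2) + ‖ηt ω‖ₑ ^ 2)
      + ENNReal.ofReal (S ^ 2 / (4 * ε) * τ) := fun ω ↦ ofReal_bound_le hA0 hS0 Cs _ _
  refine (lintegral_mono hup).trans (le_of_eq ?_)
  have hG' : Measurable fun ω ↦ gradSq D (mt ω) := hGm.mono hF le_rfl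
  have hE' : Measurable fun ω ↦ ‖ηt ω‖ₑ ^ 2 := hEm.mono hM le_rfl
  -- The energy belongs to the past and ‖ηt‖² to the present, so the mean of their product
  -- factorises.
  rw [lintegral_add_right _ measurable_const, lintegral_add_left hG',
    lintegral_const_mul' _ _ ENNReal.ofReal_ne_top, lintegral_add_right _ hE',
    lintegral_const_mul' _ _ ENNReal.coe_ne_top,
    lintegral_mul_eq_lintegral_mul_lintegral_of_independent_measurableSpace hF hM hFM hGm hEm,
    eG, eE]
  simp

end expectation

/-! ### Adaptedness of the scheme -/

section scheme

variable {Ω : Type*} [mΩ : MeasurableSpace Ω] {P : Measure Ω} {D : Set E3}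

/-- The Sobolev bounds `√(C ‖G e_i‖²_{H²})` of the noise coefficients, multiplied by their `L²`
norms, are summable. -/
lemma hasSum_noise_coeff {e : HilbertBasis ℕ ℝ (L2 D)} {G : L2 D →L[ℝ] L2 D} {K : ℝ≥0}
    (hK : hsSq D e G ≤ (K : ℝ≥0∞) ^ 2) (Cs : ℝ≥0) :
    ∃ S : ℝ, 0 ≤ S ∧ S ^ 2 ≤ Cs * K ^ 4 ∧
      HasSum (fun i ↦ Real.sqrt (Cs * (h2Sq D (G (e i))).toReal) * ‖G (e i)‖) S := by
  have htop : hsSq D e G ≠ ⊤ := ne_top_of_le_ne_top (by simp) hK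
  have hs : Summable fun i ↦ (h2Sq D (G (e i))).toReal := ENNReal.summable_toReal htop
  have hsum : ∑' i, (h2Sq D (G (e i))).toReal ≤ (K : ℝ) ^ 2 := by
    rw [← ENNReal.tsum_toReal_eq fun i ↦ ENNReal.ne_top_of_tsum_ne_top htop i]
    have := ENNReal.toReal_mono (by simp) hK
    rw [hsSq] at this
    simpa using this
  have hle : ∀ i, Real.sqrt (Cs * (h2Sq D (G (e i))).toReal) * ‖G (e i)‖
      ≤ Real.sqrt Cs * (h2Sq D (G (e i))).toReal := by
    intro i
    have h1 : ‖G (e i)‖ ≤ Real.sqrt (h2Sq D (G (e i))).toReal := by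
      refine Real.le_sqrt_of_sq_le ?_
      have h2 : ‖G (e i)‖ₑ ^ 2 ≤ h2Sq D (G (e i)) := by
        rw [h2Sq, add_assoc]
        exact le_self_add
      have := ENNReal.toReal_mono (ENNReal.ne_top_of_tsum_ne_top htop i) h2
      simpa using this
    rw [Real.sqrt_mul (by positivity), mul_assoc]
    refine mul_le_mul_of_nonneg_left ?_ (Real.sqrt_nonneg _)
    refine (mul_le_mul_of_nonneg_left h1 (Real.sqrt_nonneg _)).trans_eq ?_
    rw [Real.mul_self_sqrt ENNReal.toReal_nonneg]
  have hsb := Summable.of_nonneg_of_le (fun i ↦ by positivity) hle (hs.mul_left (Real.sqrt Cs))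
  have h0 : 0 ≤ ∑' i, Real.sqrt (Cs * (h2Sq D (G (e i))).toReal) * ‖G (e i)‖ :=
    tsum_nonneg fun i ↦ by positivity
  refine ⟨_, h0, ?_, hsb.hasSum⟩
  have h1 := hsb.tsum_le_tsum hle (hs.mul_left (Real.sqrt Cs))
  rw [tsum_mul_left] at h1
  calc _ ≤ (Real.sqrt Cs * (K : ℝ) ^ 2) ^ 2 := by
        gcongr
        exact h1.trans (by gcongr)
    _ = Cs * K ^ 4 := by
        rw [mul_pow, Real.sq_sqrt Cs.coe_nonneg]
        ring

/-- The data of the scheme together with its solution. -/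
structure IsSolution (P : Measure Ω) (T : ℝ≥0) (θ : ℝ) (D : Set E3) (K : ℝ≥0)
    (e : HilbertBasis ℕ ℝ (L2 D)) (G : L2 D →L[ℝ] L2 D) (β : ℕ → ℝ≥0 → Ω → ℝ)
    (GW : ℝ≥0 → Ω → L2 D) (m₀ : L2 D) (N : ℕ) (m v : ℕ → Ω → L2 D) : Prop where
  memH1 : MemH1 D m₀
  norm_eq : ∀ᵐ x ∂(volume.restrict D), ‖m₀ x‖ = 1
  memH2 : ∀ f, MemH2 D (G f)
  hsSq_le : hsSq D e G ≤ (K : ℝ≥0∞) ^ 2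
  wiener : IsCylindricalWiener P T β
  isGW : IsGW P T D e G β GW
  scheme : IsScheme P T θ D e G GW m₀ N m v

variable {T K : ℝ≥0} {θ : ℝ} {e : HilbertBasis ℕ ℝ (L2 D)} {G : L2 D →L[ℝ] L2 D}
  {β : ℕ → ℝ≥0 → Ω → ℝ} {GW : ℝ≥0 → Ω → L2 D} {m₀ : L2 D} {N : ℕ} {m v : ℕ → Ω → L2 D}
  {Cs : ℝ≥0}

lemma IsSolution.exists_measurable_step (h : IsSolution P T θ D K e G β GW m₀ N m v)
    (hD : IsOpen D) [IsFiniteMeasure (volume.restrict D)] (hθ : 0 ≤ θ)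
    (hCs : ∀ f : L2 D, MemH2 D f → EssBdd D (Real.sqrt (Cs * (h2Sq D f).toReal)) f) :
    ∃ Φ : L2 D × L2 D → L2 D, Measurable Φ ∧ ∀ n < N, (∀ᵐ ω ∂P, MemH1 D (m n ω) ∧
      ∀ᵐ x ∂(volume.restrict D), ‖m n ω x‖ = 1) →
        ∀ᵐ ω ∂P, v n ω = Φ (m n ω, incr T N GW n ω) := by
  obtain ⟨S, -, -, hS⟩ := hasSum_noise_coeff h.hsSq_le Cs
  obtain ⟨Φ, hΦ, hΦv⟩ := SLLG.exists_measurable_step hD hθ (dt T N).2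
    (fun i ↦ Real.sqrt_nonneg _) (fun i ↦ hCs _ (h.memH2 (e i))) hS.summable
  refine ⟨Φ, hΦ, fun n hn hm ↦ ?_⟩
  filter_upwards [hm, h.scheme.step n hn] with ω h1 h2
  exact hΦv _ _ _ h1.1 h1.2 h2

/-- Induction: the new state is the ball projection of m + Φ(m, ξ), with m known from the past and ξ
from the present. Adaptedness can hold only up to null sets, hence the version `mt`. -/
lemma IsSolution.adapted [IsProbabilityMeasure P] (h : IsSolution P T θ D K e G β GW m₀ N m v)
    (hD : IsOpen D) (hb : Bornology.IsBounded D) [IsFiniteMeasure (volume.restrict D)]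
    (hθ : 0 ≤ θ)
    (hCs : ∀ f : L2 D, MemH2 D f → EssBdd D (Real.sqrt (Cs * (h2Sq D f).toReal)) f) :
    ∀ n ≤ N, (∃ mt : Ω → L2 D, Measurable[past T (dt T N) β n] mt ∧ m n =ᵐ[P] mt) ∧
      ∀ᵐ ω ∂P, MemH1 D (m n ω) ∧ ∀ᵐ x ∂(volume.restrict D), ‖m n ω x‖ = 1 := by
  obtain ⟨Φ, hΦ, hΦv⟩ := h.exists_measurable_step hD hθ hCs
  intro n
  induction n with
  | zero =>
    intro _
    refine ⟨⟨fun _ ↦ m₀, measurable_const, h.scheme.init⟩, ?_⟩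
    filter_upwards [h.scheme.init] with ω hω
    rw [hω]
    exact ⟨h.memH1, h.norm_eq⟩
  | succ n ih =>
    intro hn
    obtain ⟨⟨mt, hmt, hmm⟩, hm⟩ := ih (by omega)
    obtain ⟨η, hη, -, -, -, hηξ⟩ := exists_jet_noise hD h.memH2 h.hsSq_le h.wiener h.isGW
      (N := N) (n := n) (by omega)
    have hv := hΦv n (by omega) hm
    have hξt : Measurable[past T (dt T N) β (n + 1)] fun ω ↦ jetProj none (hη.mk η ω) :=
      (((jetProj none).continuous.comp_stronglyMeasurable
        hη.stronglyMeasurable_mk).measurable).mono (present_le_past _ _ _ _) le_rfl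
    have hmt' : Measurable[past T (dt T N) β (n + 1)] mt := hmt.mono (past_mono _ _ _ _) le_rfl
    have hstep : ∀ᵐ ω ∂P, m (n + 1) ω = ballProjL D (m n ω + v n ω) ∧ MemH1 D (m (n + 1) ω) ∧
        ∀ᵐ x ∂(volume.restrict D), ‖m (n + 1) ω x‖ = 1 := by
      filter_upwards [hm, h.scheme.step n (by omega), h.scheme.renorm n (by omega)]
        with ω h1 h2 h3
      obtain ⟨e1, e2, e3, -⟩ := step_renorm hD hb h1.1 h1.2 h2.mem h3
      refine ⟨Lp.ext ?_, e3, e2⟩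
      filter_upwards [e1, coeFn_ballProjL (m n ω + v n ω)] with x h4 h5
      rw [h4, h5]
    refine ⟨⟨fun ω ↦ ballProjL D (mt ω + Φ (mt ω, jetProj none (hη.mk η ω))), ?_, ?_⟩,
      hstep.mono fun ω h ↦ h.2⟩
    · have hc : Measurable fun p : L2 D × L2 D ↦ ballProjL D (p.1 + p.2) :=
        (continuous_ballProjL.comp continuous_add).measurable
      exact hc.comp (hmt'.prodMk (hΦ.comp (hmt'.prodMk hξt)))
    · filter_upwards [hstep, hv, hmm, hη.ae_eq_mk, hηξ] with ω h1 h2 h3 h4 h5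
      rw [h1.1, h2, h3, ← h4, h5]

/-- The energy inequality of one step, in the mean. -/
lemma IsSolution.energy_step [IsProbabilityMeasure P] {ε : ℝ}
    (h : IsSolution P T θ D K e G β GW m₀ N m v) (hT : 0 < T)
    (hD : IsOpen D) (hb : Bornology.IsBounded D) [IsFiniteMeasure (volume.restrict D)]
    (hθ : θ ≤ 1) (hε : 0 < ε) (hε' : ε < 2 * θ - 1)
    (hCs : ∀ f : L2 D, MemH2 D f → EssBdd D (Real.sqrt (Cs * (h2Sq D f).toReal)) f)
    {C : ℝ≥0} (hC : (2 * θ ^ 2 / ε).toNNReal * (Cs * K ^ 2 + K ^ 2)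
      + (1 / (4 * ε)).toNNReal * (Cs * K ^ 4) ≤ C) {n : ℕ} (hn : n < N) :
    (∫⁻ ω, gradSq D (m (n + 1) ω) ∂P)
        + ENNReal.ofReal ((1 - ε) / dt T N) *
            (∫⁻ ω, normSq D (fun x ↦ v n ω x - noiseTerm (m n ω) (incr T N GW n ω) x) ∂P)
        + ENNReal.ofReal (2 * θ - 1 - ε) * (∫⁻ ω, gradSq D (v n ω) ∂P)
      ≤ (1 + C * dt T N) * (∫⁻ ω, gradSq D (m n ω) ∂P) + C * dt T N := by
  -- With infinite energy the right side is infinite, so no induction on finiteness is needed.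
  by_cases hfin : ∫⁻ ω, gradSq D (m n ω) ∂P = ⊤
  · rw [hfin, ENNReal.mul_top (by simp), top_add]
    exact le_top
  have hτ : 0 < dt T N := by
    have : (0 : ℝ≥0) < N := by exact_mod_cast (by omega : 0 < N)
    exact div_pos hT this
  obtain ⟨S, hS0, hS4, hS⟩ := hasSum_noise_coeff h.hsSq_le Cs
  obtain ⟨⟨mt, hmt, hmm⟩, hm⟩ := h.adapted hD hb (by linarith) hCs n hn.le
  obtain ⟨η, hη, hη2, hη0, hηK, hηξ⟩ := exists_jet_noise hD h.memH2 h.hsSq_le h.wiener h.isGW hn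
  have key := lintegral_step_le (m' := m (n + 1)) (τ := dt T N) (ε := ε) hD hb hτ hε (by linarith)
    (by linarith) (h.wiener.past_le _ n) (h.wiener.present_le _ n) (h.wiener.indep_past_present _ n)
    hmt hmm hm hη hη2 hη0 hηξ (h.scheme.step n hn) (h.scheme.renorm n hn)
    (fun i ↦ Real.sqrt_nonneg _) (fun i ↦ hCs _ (h.memH2 (e i))) hS hCs hfin
  refine key.trans ?_
  set E := ∫⁻ ω, gradSq D (m n ω) ∂P
  set H := ∫⁻ ω, ‖η ω‖ₑ ^ 2 ∂P
  set a : ℝ≥0 := (2 * θ ^ 2 / ε).toNNReal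
  set τ := dt T N
  have ea : ENNReal.ofReal (2 * θ ^ 2 / ε) = a := rfl
  have es : ENNReal.ofReal (S ^ 2 / (4 * ε) * τ)
      ≤ (((1 / (4 * ε)).toNNReal * (Cs * K ^ 4) * τ : ℝ≥0) : ℝ≥0∞) := by
    rw [← ENNReal.ofReal_coe_nnreal]
    refine ENNReal.ofReal_le_ofReal ?_
    push_cast
    rw [Real.coe_toNNReal _ (by positivity)]
    gcongr
    rw [div_eq_mul_one_div, mul_comm]
    gcongr
  rw [ea]
  calc E + a * (Cs * (E * H) + H) + ENNReal.ofReal (S ^ 2 / (4 * ε) * τ)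
      ≤ E + a * (Cs * (E * (τ * (K : ℝ≥0∞) ^ 2)) + τ * (K : ℝ≥0∞) ^ 2)
        + (((1 / (4 * ε)).toNNReal * (Cs * K ^ 4) * τ : ℝ≥0) : ℝ≥0∞) := by gcongr
    _ = E + ((a * (Cs * K ^ 2) : ℝ≥0) : ℝ≥0∞) * τ * E
        + ((a * K ^ 2 + (1 / (4 * ε)).toNNReal * (Cs * K ^ 4) : ℝ≥0) : ℝ≥0∞) * τ := by
        push_cast
        ring
    _ ≤ E + C * τ * E + C * τ := by
        gcongr
        · refine le_trans ?_ hC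
          rw [mul_add, add_assoc]
          exact le_self_add
        · refine le_trans ?_ hC
          rw [mul_add, add_assoc]
          exact le_add_self
    _ = (1 + C * τ) * E + C * τ := by ring

end scheme

/-! ### Summation of the energy inequalities -/

/-- A discrete Gronwall inequality. -/
lemma gronwall_sum {E U : ℕ → ℝ≥0∞} {N : ℕ} {C τ : ℝ≥0}
    (h : ∀ n < N, E (n + 1) + U n ≤ (1 + C * τ) * E n + C * τ) {L : ℝ≥0}
    (hL : ∀ n ≤ N, (1 + C * τ) ^ n ≤ L) :
    (∀ n ≤ N, E n + 1 ≤ L * (E 0 + 1)) ∧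
      ∑ n ∈ Finset.range N, U n ≤ E 0 + N * (C * τ * (L * (E 0 + 1))) := by
  -- Adding 1 makes the recursion homogeneous: (1 + Cτ)E + Cτ + 1 = (1 + Cτ)(E + 1).
  have h1 : ∀ n ≤ N, E n + 1 ≤ (((1 + C * τ) ^ n : ℝ≥0) : ℝ≥0∞) * (E 0 + 1) := by
    intro n
    induction n with
    | zero => simp
    | succ n ih =>
      intro hn
      calc E (n + 1) + 1 ≤ (1 + C * τ) * E n + C * τ + 1 := by
            gcongr
            exact le_self_add.trans (h n (by omega))
        _ = (1 + C * τ) * (E n + 1) := by ring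
        _ ≤ (1 + C * τ) * ((((1 + C * τ) ^ n : ℝ≥0) : ℝ≥0∞) * (E 0 + 1)) := by
            gcongr
            exact ih (by omega)
        _ = _ := by
            push_cast
            ring
  have h2 : ∀ n ≤ N, E n + 1 ≤ L * (E 0 + 1) := fun n hn ↦
    (h1 n hn).trans (by gcongr; exact hL n hn)
  refine ⟨h2, ?_⟩
  have h3 : ∀ n ≤ N, E n + ∑ k ∈ Finset.range n, U k
      ≤ E 0 + n * (C * τ * (L * (E 0 + 1))) := by
    intro n
    induction n with
    | zero => simp
    | succ n ih =>
      intro hn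
      calc E (n + 1) + ∑ k ∈ Finset.range (n + 1), U k
          = (E (n + 1) + U n) + ∑ k ∈ Finset.range n, U k := by
            rw [Finset.sum_range_succ]
            ring
        _ ≤ ((1 + C * τ) * E n + C * τ) + ∑ k ∈ Finset.range n, U k :=
            add_le_add_left (h n (by omega)) _
        _ = (E n + ∑ k ∈ Finset.range n, U k) + C * τ * (E n + 1) := by ring
        _ ≤ (E 0 + n * (C * τ * (L * (E 0 + 1)))) + C * τ * (L * (E 0 + 1)) :=
            add_le_add (ih (by omega)) (mul_le_mul_right (h2 n (by omega)) _)
        _ = _ := by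
            push_cast
            ring
  exact le_add_self.trans (h3 N le_rfl)

/-! ### The uniform estimates -/

section uniform

variable {Ω : Type*} [mΩ : MeasurableSpace Ω] {P : Measure Ω} {D : Set E3}
  {T K : ℝ≥0} {θ : ℝ} {e : HilbertBasis ℕ ℝ (L2 D)} {G : L2 D →L[ℝ] L2 D}
  {β : ℕ → ℝ≥0 → Ω → ℝ} {GW : ℝ≥0 → Ω → L2 D} {m₀ : L2 D} {N : ℕ} {m v : ℕ → Ω → L2 D}
  {Cs : ℝ≥0}

/-- Bounding the integral of a sum by the sum of the integrals requires measurability, unlike the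
superadditivity used for one step. -/
lemma IsSolution.aemeasurable [IsProbabilityMeasure P]
    (h : IsSolution P T θ D K e G β GW m₀ N m v)
    (hD : IsOpen D) (hb : Bornology.IsBounded D) [IsFiniteMeasure (volume.restrict D)]
    (hθ : 0 ≤ θ)
    (hCs : ∀ f : L2 D, MemH2 D f → EssBdd D (Real.sqrt (Cs * (h2Sq D f).toReal)) f)
    {n : ℕ} (hn : n < N) :
    AEMeasurable (m n) P ∧ AEMeasurable (v n) P ∧ AEMeasurable (incr T N GW n) P := by
  obtain ⟨⟨mt, hmt, hmm⟩, hm⟩ := h.adapted hD hb hθ hCs n hn.le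
  obtain ⟨Φ, hΦ, hΦv⟩ := h.exists_measurable_step hD hθ hCs
  obtain ⟨η, -, hη2, -, -, hηξ⟩ := exists_jet_noise hD h.memH2 h.hsSq_le h.wiener h.isGW hn
  have h1 : AEMeasurable (m n) P := ⟨mt, hmt.mono (h.wiener.past_le _ n) le_rfl, hmm⟩
  have h2 : AEMeasurable (incr T N GW n) P :=
    (((jetProj none).continuous.comp_aestronglyMeasurable hη2.1).aemeasurable).congr hηξ
  have h3 : AEMeasurable (fun ω ↦ Φ (m n ω, incr T N GW n ω)) P :=
    hΦ.comp_aemeasurable (h1.prodMk h2)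
  exact ⟨h1, h3.congr (by filter_upwards [hΦv n hn hm] with ω hω using hω.symm), h2⟩

lemma IsSolution.aemeasurable_normSq_sub [IsProbabilityMeasure P]
    (h : IsSolution P T θ D K e G β GW m₀ N m v)
    (hD : IsOpen D) (hb : Bornology.IsBounded D) [IsFiniteMeasure (volume.restrict D)]
    (hθ : 0 ≤ θ)
    (hCs : ∀ f : L2 D, MemH2 D f → EssBdd D (Real.sqrt (Cs * (h2Sq D f).toReal)) f)
    {n : ℕ} (hn : n < N) :
    AEMeasurable (fun ω ↦ normSq D fun x ↦ v n ω x - noiseTerm (m n ω) (incr T N GW n ω) x) P := by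
  obtain ⟨h1, h2, h3⟩ := h.aemeasurable hD hb hθ hCs hn
  obtain ⟨c, hc, hcw⟩ := exists_measurable_crossL (D := D)
  have h4 : AEMeasurable (fun ω ↦ ‖v n ω - c (m n ω, incr T N GW n ω)‖ₑ ^ 2) P :=
    ((h2.sub (hc.comp_aemeasurable (h1.prodMk h3))).enorm).pow_const 2
  refine h4.congr ?_
  filter_upwards [(h.adapted hD hb hθ hCs n hn.le).2] with ω hω
  rw [normSq_sub_noiseTerm hω.2, hcw _ _ hω.2]

/-- From v = (v − A) + A and ‖A‖ ≤ ‖ξ‖, whose second moment is at most τK². -/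
lemma IsSolution.lintegral_velocity_le [IsProbabilityMeasure P]
    (h : IsSolution P T θ D K e G β GW m₀ N m v)
    (hD : IsOpen D) (hb : Bornology.IsBounded D) [IsFiniteMeasure (volume.restrict D)]
    (hθ : 0 ≤ θ)
    (hCs : ∀ f : L2 D, MemH2 D f → EssBdd D (Real.sqrt (Cs * (h2Sq D f).toReal)) f)
    {n : ℕ} (hn : n < N) :
    ∫⁻ ω, normSq D (v n ω) ∂P
      ≤ 2 * (∫⁻ ω, normSq D (fun x ↦ v n ω x - noiseTerm (m n ω) (incr T N GW n ω) x) ∂P)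
        + 2 * (dt T N * (K : ℝ≥0∞) ^ 2) := by
  obtain ⟨η, -, -, -, hηK, hηξ⟩ := exists_jet_noise hD h.memH2 h.hsSq_le h.wiener h.isGW hn
  calc ∫⁻ ω, normSq D (v n ω) ∂P
      ≤ ∫⁻ ω, (2 * normSq D (fun x ↦ v n ω x - noiseTerm (m n ω) (incr T N GW n ω) x)
          + 2 * ‖η ω‖ₑ ^ 2) ∂P := by
        refine lintegral_mono_ae ?_
        filter_upwards [(h.adapted hD hb hθ hCs n hn.le).2, hηξ] with ω h1 h2
        rw [normSq_eq, normSq_sub_noiseTerm h1.2]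
        have h3 := enorm_add_sq_le (v n ω - crossL (m n ω) (incr T N GW n ω))
          (crossL (m n ω) (incr T N GW n ω))
        rw [sub_add_cancel] at h3
        refine h3.trans ?_
        gcongr
        rw [← h2]
        refine le_trans ?_ (enorm_jetProj_le none (η ω))
        rw [← ofReal_norm, ← ofReal_norm]
        refine ENNReal.ofReal_le_ofReal ?_
        simpa using norm_crossL_le_left (essBdd_of_norm_eq_one h1.2) (jetProj none (η ω))
    _ = 2 * (∫⁻ ω, normSq D (fun x ↦ v n ω x - noiseTerm (m n ω) (incr T N GW n ω) x) ∂P)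
        + 2 * ∫⁻ ω, ‖η ω‖ₑ ^ 2 ∂P := by
        rw [lintegral_add_left' ((h.aemeasurable_normSq_sub hD hb hθ hCs hn).const_mul 2),
          lintegral_const_mul' _ _ (by simp), lintegral_const_mul' _ _ (by simp)]
    _ ≤ _ := by gcongr

lemma le_inv_mul_of_mul_le {a : ℝ≥0} (ha : 0 < a) {x y : ℝ≥0∞} (h : a * x ≤ y) :
    x ≤ ((a⁻¹ : ℝ≥0) : ℝ≥0∞) * y := by
  calc x = ((a⁻¹ * a : ℝ≥0) : ℝ≥0∞) * x := by rw [inv_mul_cancel₀ ha.ne', ENNReal.coe_one, one_mul]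
    _ = ((a⁻¹ : ℝ≥0) : ℝ≥0∞) * (a * x) := by
        push_cast
        ring
    _ ≤ _ := by gcongr

lemma one_add_mul_pow_le {C τ T : ℝ≥0} {n N : ℕ} (hn : n ≤ N) (hT : N * τ = T) :
    (1 + C * τ) ^ n ≤ (Real.exp (C * T)).toNNReal := by
  rw [← NNReal.coe_le_coe, Real.coe_toNNReal _ (Real.exp_pos _).le]
  push_cast
  have h1 : (1 + (C : ℝ) * τ) ≤ Real.exp (C * τ) := by
    rw [add_comm]
    exact Real.add_one_le_exp _
  have h2 : (n : ℝ) * (C * τ) ≤ C * T := by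
    rw [← hT]
    push_cast
    have h3 : (n : ℝ) ≤ N := by exact_mod_cast hn
    calc (n : ℝ) * (C * τ) ≤ N * (C * τ) := by gcongr
      _ = _ := by ring
  calc (1 + (C : ℝ) * τ) ^ n ≤ Real.exp (C * τ) ^ n := by gcongr
    _ = Real.exp (n * (C * τ)) := (Real.exp_nat_mul _ _).symm
    _ ≤ _ := Real.exp_le_exp.2 h2

/-- The uniform bounds, with explicit constants. -/
lemma IsSolution.uniform [IsProbabilityMeasure P] {ε : ℝ}
    (h : IsSolution P T θ D K e G β GW m₀ N m v) (hT : 0 < T)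
    (hD : IsOpen D) (hb : Bornology.IsBounded D) [IsFiniteMeasure (volume.restrict D)]
    (hθ : θ ≤ 1) (hε : 0 < ε) (hε' : ε < 2 * θ - 1)
    (hCs : ∀ f : L2 D, MemH2 D f → EssBdd D (Real.sqrt (Cs * (h2Sq D f).toReal)) f)
    {C : ℝ≥0} (hC : (2 * θ ^ 2 / ε).toNNReal * (Cs * K ^ 2 + K ^ 2)
      + (1 / (4 * ε)).toNNReal * (Cs * K ^ 4) ≤ C) (hN : 0 < N) {E₀ : ℝ≥0}
    (hE₀ : gradSq D m₀ = E₀) {M₁ M₂ : ℝ≥0} (hM₁ : M₁ = (Real.exp (C * T)).toNNReal * (E₀ + 1))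
    (hM₂ : M₂ = E₀ + C * T * M₁) :
    (∀ n ≤ N, ∫⁻ ω, gradSq D (m n ω) ∂P ≤ M₁) ∧
    (∫⁻ ω, ∑ n ∈ Finset.range N,
        normSq D (fun x ↦ v n ω x - noiseTerm (m n ω) (incr T N GW n ω) x) ∂P
      ≤ ((1 - ε).toNNReal⁻¹ * M₂ : ℝ≥0) * dt T N) ∧
    (∫⁻ ω, ∑ n ∈ Finset.range N, normSq D (v n ω) ∂P
      ≤ (2 * ((1 - ε).toNNReal⁻¹ * M₂ * T) + 2 * (T * K ^ 2) : ℝ≥0)) ∧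
    (∫⁻ ω, ∑ n ∈ Finset.range N, gradSq D (v n ω) ∂P
      ≤ ((2 * θ - 1 - ε).toNNReal⁻¹ * M₂ : ℝ≥0)) := by
  have hθ0 : 0 ≤ θ := by linarith
  have hN' : (0 : ℝ≥0) < N := by exact_mod_cast hN
  have hNτ : N * dt T N = T := by rw [dt]; field_simp
  have hτ : 0 < dt T N := div_pos hT hN'
  set τ := dt T N with hτdef
  set E : ℕ → ℝ≥0∞ := fun n ↦ ∫⁻ ω, gradSq D (m n ω) ∂P with hE
  set u : ℕ → ℝ≥0∞ := fun n ↦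
    ∫⁻ ω, normSq D (fun x ↦ v n ω x - noiseTerm (m n ω) (incr T N GW n ω) x) ∂P with hu
  set w : ℕ → ℝ≥0∞ := fun n ↦ ∫⁻ ω, gradSq D (v n ω) ∂P with hw
  have hE0 : E 0 = E₀ := by
    simp only [E]
    rw [lintegral_congr_ae (g := fun _ ↦ (E₀ : ℝ≥0∞))
      (h.scheme.init.mono fun ω hω ↦ by simp only [hω, hE₀])]
    simp
  obtain ⟨h1, h2⟩ := gronwall_sum (E := E)
    (U := fun n ↦ ENNReal.ofReal ((1 - ε) / τ) * u n + ENNReal.ofReal (2 * θ - 1 - ε) * w n)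
    (N := N) (C := C) (τ := τ) (fun n hn ↦ by
      rw [← add_assoc]
      exact h.energy_step hT hD hb hθ hε hε' hCs hC hn)
    (fun n hn ↦ one_add_mul_pow_le hn hNτ)
  rw [hE0] at h1 h2
  have e1 : ((Real.exp (C * T)).toNNReal : ℝ≥0∞) * (E₀ + 1) = M₁ := by rw [hM₁]; push_cast; rfl
  have e2 : (E₀ : ℝ≥0∞) + N * (C * τ * M₁) = M₂ := by
    rw [hM₂, ← hNτ]
    push_cast
    ring
  rw [e1] at h1 h2
  rw [e2, Finset.sum_add_distrib, ← Finset.mul_sum, ← Finset.mul_sum] at h2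
  -- The weight (1 − ε)/τ yields the factor τ after division; 1 − ε > 0 because ε < 2θ − 1 ≤ 1.
  have hu' : ∑ n ∈ Finset.range N, u n ≤ (((1 - ε).toNNReal⁻¹ * M₂ : ℝ≥0) : ℝ≥0∞) * τ := by
    have ha : 0 < (1 - ε).toNNReal := Real.toNNReal_pos.2 (by linarith)
    have h3 : ((1 - ε).toNNReal : ℝ≥0∞) * ∑ n ∈ Finset.range N, u n ≤ M₂ * τ := by
      have h4 : ((1 - ε).toNNReal : ℝ≥0∞) = τ * ENNReal.ofReal ((1 - ε) / τ) := by
        rw [← ENNReal.ofReal_coe_nnreal (p := τ), ← ENNReal.ofReal_mul τ.coe_nonneg,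
          mul_div_cancel₀ _ (by exact_mod_cast hτ.ne')]
        rfl
      rw [h4, mul_assoc, mul_comm (M₂ : ℝ≥0∞)]
      gcongr
      exact le_self_add.trans h2
    refine (le_inv_mul_of_mul_le ha h3).trans_eq ?_
    push_cast
    ring
  refine ⟨fun n hn ↦ le_self_add.trans (h1 n hn), ?_, ?_, ?_⟩
  · rw [lintegral_finsetSum' _ fun n hn ↦
      h.aemeasurable_normSq_sub hD hb hθ0 hCs (Finset.mem_range.1 hn)]
    exact hu'
  · rw [lintegral_finsetSum' _ fun n hn ↦ by
      simp_rw [normSq_eq]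
      exact (h.aemeasurable hD hb hθ0 hCs (Finset.mem_range.1 hn)).2.1.enorm.pow_const 2]
    calc ∑ n ∈ Finset.range N, ∫⁻ ω, normSq D (v n ω) ∂P
        ≤ ∑ n ∈ Finset.range N, (2 * u n + 2 * (τ * (K : ℝ≥0∞) ^ 2)) :=
          Finset.sum_le_sum fun n hn ↦
            h.lintegral_velocity_le hD hb hθ0 hCs (Finset.mem_range.1 hn)
      _ = 2 * ∑ n ∈ Finset.range N, u n + 2 * (N * τ * (K : ℝ≥0∞) ^ 2) := by
          rw [Finset.sum_add_distrib, ← Finset.mul_sum, Finset.sum_const, Finset.card_range,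
            nsmul_eq_mul]
          ring
      _ ≤ 2 * ((((1 - ε).toNNReal⁻¹ * M₂ : ℝ≥0) : ℝ≥0∞) * T) + 2 * (T * (K : ℝ≥0∞) ^ 2) := by
          have h5 : τ ≤ T := by
            rw [← hNτ]
            exact le_mul_of_one_le_left (zero_le) (by exact_mod_cast hN)
          have h6 : (N : ℝ≥0∞) * τ = T := by rw [← hNτ]; push_cast; rfl
          rw [h6]
          gcongr
          exact hu'.trans (by gcongr)
      _ = _ := by push_cast; rfl
  · rw [lintegral_finsetSum' (f := fun n ω ↦ gradSq D (v n ω)) _ fun n hn ↦ (measurable_gradSq hD).comp_aemeasurable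
      (h.aemeasurable hD hb hθ0 hCs (Finset.mem_range.1 hn)).2.1]
    have hb' : 0 < (2 * θ - 1 - ε).toNNReal := Real.toNNReal_pos.2 (by linarith)
    exact (le_inv_mul_of_mul_le hb' (le_add_self.trans h2)).trans_eq (by push_cast; rfl)

end uniform

end SLLG

end

/-! ### The energy estimates and the choice of constants -/

theorem proposition1 (D : Set E3) (hDo : IsOpen D) (hDb : Bornology.IsBounded D)
    (hDc : ConeCondition D) (T : ℝ≥0) (hT : 0 < T) (θ : ℝ) (hθ : 1 / 2 < θ) (hθ' : θ ≤ 1)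
    (K : ℝ≥0) :
    -- the uniform energy estimates
    (∀ m₀ : L2 D, MemH1 D m₀ → (∀ᵐ x ∂(volume.restrict D), ‖m₀ x‖ = 1) →
      ∃ C : ℝ≥0,
        ∀ (e : HilbertBasis ℕ ℝ (L2 D)) (G : L2 D →L[ℝ] L2 D), (∀ f, MemH2 D (G f)) →
        hsSq D e G ≤ (K : ℝ≥0∞) ^ 2 →
        ∀ (Ω : Type*) [MeasurableSpace Ω] (P : Measure Ω) [IsProbabilityMeasure P]
          (β : ℕ → ℝ≥0 → Ω → ℝ) (GW : ℝ≥0 → Ω → L2 D),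
        IsCylindricalWiener P T β → IsGW P T D e G β GW →
        ∀ (N : ℕ), 0 < N → ∀ (m v : ℕ → Ω → L2 D), IsScheme P T θ D e G GW m₀ N m v →
          (∀ n ≤ N, ∫⁻ ω, gradSq D (m n ω) ∂P ≤ C) ∧
          (∫⁻ ω, ∑ n ∈ Finset.range N,
              normSq D (fun x ↦ v n ω x - noiseTerm (m n ω) (incr T N GW n ω) x) ∂P
            ≤ C * dt T N) ∧
          (∫⁻ ω, ∑ n ∈ Finset.range N, normSq D (v n ω) ∂P ≤ C) ∧
          (∫⁻ ω, ∑ n ∈ Finset.range N, gradSq D (v n ω) ∂P ≤ C)) ∧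
    -- the one-step energy inequality, with a constant independent of the initial datum
    (∀ ε : ℝ, 0 < ε → ε < 2 * θ - 1 →
      ∃ C : ℝ≥0, 0 < C ∧
        ∀ m₀ : L2 D, MemH1 D m₀ → (∀ᵐ x ∂(volume.restrict D), ‖m₀ x‖ = 1) →
        ∀ (e : HilbertBasis ℕ ℝ (L2 D)) (G : L2 D →L[ℝ] L2 D), (∀ f, MemH2 D (G f)) →
        hsSq D e G ≤ (K : ℝ≥0∞) ^ 2 →
        ∀ (Ω : Type*) [MeasurableSpace Ω] (P : Measure Ω) [IsProbabilityMeasure P]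
          (β : ℕ → ℝ≥0 → Ω → ℝ) (GW : ℝ≥0 → Ω → L2 D),
        IsCylindricalWiener P T β → IsGW P T D e G β GW →
        ∀ (N : ℕ), 0 < N → ∀ (m v : ℕ → Ω → L2 D), IsScheme P T θ D e G GW m₀ N m v →
        ∀ n < N,
          (∫⁻ ω, gradSq D (m (n + 1) ω) ∂P)
            + ENNReal.ofReal ((1 - ε) / dt T N) *
                (∫⁻ ω, normSq D (fun x ↦ v n ω x - noiseTerm (m n ω) (incr T N GW n ω) x) ∂P)
            + ENNReal.ofReal (2 * θ - 1 - ε) * (∫⁻ ω, gradSq D (v n ω) ∂P)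
          ≤ (1 + C * dt T N) * (∫⁻ ω, gradSq D (m n ω) ∂P) + C * dt T N) := by
  have := isFiniteMeasure_restrict hDb
  -- The Sobolev constant depends on D alone and is fixed before all other data.
  obtain ⟨Cs, hCs⟩ := exists_essBdd_h2 hDo hDb hDc
  constructor
  · intro m₀ hm₀ hm₁
    -- Any ε in (0, 2θ − 1) would do; it only has to keep 1 − ε and 2θ − 1 − ε positive.
    have hε : 0 < (2 * θ - 1) / 2 := by linarith
    have hε' : (2 * θ - 1) / 2 < 2 * θ - 1 := by linarith
    set ε : ℝ := (2 * θ - 1) / 2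
    set E₀ : ℝ≥0 := (gradSq D m₀).toNNReal
    have hE₀ : gradSq D m₀ = E₀ := (ENNReal.coe_toNNReal hm₀.gradSq_ne_top).symm
    set C : ℝ≥0 := (2 * θ ^ 2 / ε).toNNReal * (Cs * K ^ 2 + K ^ 2)
      + (1 / (4 * ε)).toNNReal * (Cs * K ^ 4)
    set M₁ : ℝ≥0 := (Real.exp (C * T)).toNNReal * (E₀ + 1)
    set M₂ : ℝ≥0 := E₀ + C * T * M₁
    set c₁ : ℝ≥0 := (1 - ε).toNNReal⁻¹ * M₂
    set c₂ : ℝ≥0 := 2 * (c₁ * T) + 2 * (T * K ^ 2)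
    set c₃ : ℝ≥0 := (2 * θ - 1 - ε).toNNReal⁻¹ * M₂
    refine ⟨M₁ + c₁ + c₂ + c₃, fun e G hG hK Ω _ P _ β GW hβ hGW N hN m v hs ↦ ?_⟩
    have h : IsSolution P T θ D K e G β GW m₀ N m v := ⟨hm₀, hm₁, hG, hK, hβ, hGW, hs⟩
    obtain ⟨h1, h2, h3, h4⟩ := h.uniform hT hDo hDb hθ' hε hε' hCs le_rfl hN hE₀ rfl rfl
    have i1 : M₁ ≤ M₁ + c₁ + c₂ + c₃ := by rw [add_assoc, add_assoc]; exact le_self_add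
    have i2 : c₁ ≤ M₁ + c₁ + c₂ + c₃ := by
      rw [add_assoc]; exact le_add_self.trans le_self_add
    have i3 : c₂ ≤ M₁ + c₁ + c₂ + c₃ := le_add_self.trans le_self_add
    have i4 : c₃ ≤ M₁ + c₁ + c₂ + c₃ := le_add_self
    exact ⟨fun n hn ↦ (h1 n hn).trans (ENNReal.coe_le_coe.2 i1),
      h2.trans (mul_le_mul_left (ENNReal.coe_le_coe.2 i2) _),
      h3.trans (ENNReal.coe_le_coe.2 i3), h4.trans (ENNReal.coe_le_coe.2 i4)⟩
  · intro ε hε hε'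
    -- The summand 1 makes the constant positive even for K = 0.
    refine ⟨(2 * θ ^ 2 / ε).toNNReal * (Cs * K ^ 2 + K ^ 2)
      + (1 / (4 * ε)).toNNReal * (Cs * K ^ 4) + 1, by positivity,
      fun m₀ hm₀ hm₁ e G hG hK Ω _ P _ β GW hβ hGW N hN m v hs n hn ↦ ?_⟩
    have h : IsSolution P T θ D K e G β GW m₀ N m v := ⟨hm₀, hm₁, hG, hK, hβ, hGW, hs⟩
    exact h.energy_step hT hDo hDb hθ' hε hε' hCs le_self_add hn
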